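/- Let $S$ be a connected simply connected solvable Lie group with Lie algebra $\mathfrak s$, and let $M$ be a nonempty closed $C^\infty$ manifold. Let $\rho_0,\rho\colon M\times S\to M$ be $C^\infty$ locally free (discrete isotropy groups) right actions with the same orbit foliation $\mathcal F$, that is, with the same orbits. For $x\in M$, let $\omega_0,\omega\colon T_x\mathcal F\to\mathfrak s$ be the canonical $1$-forms of $\rho_0,\rho$: the inverses of the derivatives at $1$ of $s\mapsto\rho_0(x,s)$ and $s\mapsto\rho(x,s)$. Let $\mathfrak h$ be a linear subspace with $[\mathfrak s,\mathfrak s]\subset\mathfrak h\subset\mathfrak n$, where $\mathfrak n$ is the nilradical of $\mathfrak s$. Fix an inner product on $\mathfrak s$, give $S$ the corresponding left invariant Riemannian metric, and, for the connected Lie subgroup $K$ of $S$ with Lie algebra an ideal $\mathfrak k$, give $S/K$ the left invariant Riemannian metric for which $\mathfrak k^\perp\to\mathfrak s/\mathfrak k=T_K(S/K)$ is an isometry. There is a unique $C^\infty$ map $a\colon M\times S\to S$ with $\rho_0(x,s)=\rho(x,a(x,s))$ and $a(x,1)=1$ for all $x\in M$, $s\in S$. For every $x\in M$ the map $a(x,\cdot)\colon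 S\to S$ is a $C^\infty$ diffeomorphism and is biLipschitz. Let moreover $\varphi_\rho\colon\mathfrak s\to\mathfrak s/\mathfrak h$ be a linear map that vanishes on $[\mathfrak s,\mathfrak s]$ and satisfies $\omega \bmod \mathfrak h=\varphi_\rho\,\omega_0+d_{\mathcal F}h$ for some $C^\infty$ map $h\colon M\to\mathfrak s/\mathfrak h$, where $d_{\mathcal F}$ is the leafwise exterior derivative. (If $H^1(\mathcal F;\mathfrak s/\mathfrak h)=H^1(\mathfrak s;\mathfrak s/\mathfrak h)$ with trivial coefficients, i.e. if every $d_{\mathcal F}$-closed smooth leafwise $\mathfrak s/\mathfrak h$-valued $1$-form equals $\varphi\,\omega_0+d_{\mathcal F}h$ for some linear $\varphi\colon\mathfrak s\to\mathfrak s/\mathfrak h$ vanishing on $[\mathfrak s,\mathfrak s]$ and some $C^\infty$ map $h\colon M\to\mathfrak s/\mathfrak h$, then exactly one such $\varphi_\rho$ exists.) Let $K_\rho$ and $H$ be the connected Lie subgroups of $S$ with Lie algebras $\ker\varphi_\rho$ and $\mathfrak h$. Then $K_\rho$ and $H$ are normal, $S/K_\rho$ and $S/H$ are vector groups (the exponential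 maps $\mathfrak s/\ker\varphi_\rho\to S/K_\rho$ and $\mathfrak s/\mathfrak h\to S/H$ are well defined isomorphisms of topological groups), $\varphi_\rho$ induces a linear isomorphism $\mathfrak s/\ker\varphi_\rho\to\mathfrak s/\mathfrak h$ and hence a linear isomorphism $\tilde\varphi_\rho\colon S/K_\rho\to S/H$, and for every $x\in M$ the map $a(x,\cdot)$ is fiber respecting over $\tilde\varphi_\rho$ with respect to the natural projections $\tilde q\colon S\to S/K_\rho$ and $\tilde p\colon S\to S/H$. That is, $\tilde q$ and $\tilde p$ are distance respecting projections (each is surjective, and the distance of two points of the base equals both the infimum distance and the Hausdorff distance $d_{\mathcal H}$ of their fibers), and there is $C>0$ with $$d_{\mathcal H}\bigl(a(x,\tilde q^{-1}(b)),\ \tilde p^{-1}(\tilde\varphi_\rho(b))\bigr)<C\qquad\text{for all } b\in S/K_\rho .$$ -/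

import Mathlib

open Set
open scoped Manifold ContDiff ENNReal NNReal Topology

noncomputable section

/-! ### Metric notions -/

/-- A biLipschitz map (both Lipschitz bounds with a common constant). -/
def IsBiLipschitz {X Y : Type*} [PseudoEMetricSpace X] [PseudoEMetricSpace Y] (f : X → Y) : Prop :=
  ∃ C : ℝ≥0, LipschitzWith C f ∧ AntilipschitzWith C f

/-- A surjective map `p : X → B` is a distance respecting projection if the distance of two points
of `B` is both the (infimum) distance and the Hausdorff distance of their fibers. -/
def IsDistanceRespectingProjection {X B : Type*} [PseudoEMetricSpace X] [EDist B]
    (p : X → B) : Prop :=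
  Function.Surjective p ∧ ∀ b b' : B,
    edist b b' = (⨅ x ∈ p ⁻¹' {b}, ⨅ y ∈ p ⁻¹' {b'}, edist x y) ∧
    edist b b' = Metric.hausdorffEDist (p ⁻¹' {b}) (p ⁻¹' {b'})

/-- `f : X → X'` is fiber respecting over `φ : B → B'`, with respect to distance respecting
projections `p : X → B` and `p' : X' → B'`. -/
structure IsFiberRespecting {X B X' B' : Type*} [PseudoEMetricSpace X] [EDist B]
    [PseudoEMetricSpace X'] [EDist B'] (p : X → B) (p' : X' → B') (φ : B → B') (f : X → X') :
    Prop where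
  source : IsDistanceRespectingProjection p
  target : IsDistanceRespectingProjection p'
  bounded : ∃ C : ℝ≥0, 0 < C ∧
    ∀ b : B, Metric.hausdorffEDist (f '' (p ⁻¹' {b})) (p' ⁻¹' {φ b}) < (C : ℝ≥0∞)

/-! ### Lie groups: exponential map, connected subgroups, nilradical -/

section LieGroups

variable {E : Type*} [NormedAddCommGroup E] [NormedSpace ℝ E]
  {S : Type*} [TopologicalSpace S] [ChartedSpace E S] [Group S]

/-- `g = exp X`: the integral curve through `1` of the left invariant vector field `X` is at `g` at
time one. -/
def IsLieExp (X : GroupLieAlgebra 𝓘(ℝ, E) S) (g : S) : Prop :=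
  ∃ γ : ℝ → S, IsMIntegralCurve (I := 𝓘(ℝ, E)) γ (mulInvariantVectorField X) ∧ γ 0 = 1 ∧ γ 1 = g

/-- The exponential map of a Lie group (each `X` has exactly one `g` with `IsLieExp X g`). -/
def lieExp (X : GroupLieAlgebra 𝓘(ℝ, E) S) : S :=
  Classical.epsilon (fun g : S => IsLieExp X g)

/-- The connected Lie subgroup with Lie algebra `𝔨`: the subgroup generated by `exp 𝔨`. -/
def connectedLieSubgroup (𝔨 : Submodule ℝ (GroupLieAlgebra 𝓘(ℝ, E) S)) : Subgroup S :=
  Subgroup.closure (lieExp '' (𝔨 : Set (GroupLieAlgebra 𝓘(ℝ, E) S)))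

variable (E S) in
/-- The nilradical of the Lie algebra of a Lie group: the sum of all ideals which are nilpotent as
Lie algebras. -/
def lieNilradical [FiniteDimensional ℝ E] [LieGroup 𝓘(ℝ, E) ∞ S] :
    Submodule ℝ (GroupLieAlgebra 𝓘(ℝ, E) S) :=
  haveI : CompleteSpace E := FiniteDimensional.complete ℝ E
  haveI : LieGroup 𝓘(ℝ, E) (minSmoothness ℝ 3) S := by
    rw [minSmoothness_of_isRCLikeNormedField]
    infer_instance
  (sSup {J : LieIdeal ℝ (GroupLieAlgebra 𝓘(ℝ, E) S) | LieRing.IsNilpotent J} :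
    LieIdeal ℝ (GroupLieAlgebra 𝓘(ℝ, E) S)).toSubmodule

/-- The left Maurer--Cartan form `Θ`, `Θ_g(v) = (L_{g⁻¹})_* v`. -/
def maurerCartan (g : S) (v : TangentSpace 𝓘(ℝ, E) g) : GroupLieAlgebra 𝓘(ℝ, E) S :=
  mfderiv 𝓘(ℝ, E) 𝓘(ℝ, E) (fun x : S => g⁻¹ * x) g v

/-! ### Left invariant Riemannian distances -/

/-- The left invariant field of (semi)norms on the tangent spaces of `S` which is `N` at `1`. -/
@[reducible] def leftInvariantENorm (N : GroupLieAlgebra 𝓘(ℝ, E) S → ℝ) (g : S) :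
    ENorm (TangentSpace 𝓘(ℝ, E) g) :=
  ⟨fun v => ENNReal.ofReal (N (maurerCartan g v))⟩

/-- The infimum of the lengths of `C^1` paths from `x` to `y`, the length being measured by the left
invariant field of (semi)norms given by `N`. -/
def leftInvariantEDist (N : GroupLieAlgebra 𝓘(ℝ, E) S → ℝ) (x y : S) : ℝ≥0∞ :=
  letI : ∀ g : S, ENorm (TangentSpace 𝓘(ℝ, E) g) := leftInvariantENorm N
  Manifold.riemannianEDist 𝓘(ℝ, E) x y

/-- The norm of an inner product on the Lie algebra. -/
def innerNorm (c : InnerProductSpace.Core ℝ (GroupLieAlgebra 𝓘(ℝ, E) S))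
    (X : GroupLieAlgebra 𝓘(ℝ, E) S) : ℝ :=
  Real.sqrt (c.inner X X)

theorem innerNorm_smul (c : InnerProductSpace.Core ℝ (GroupLieAlgebra 𝓘(ℝ, E) S)) (r : ℝ)
    (X : GroupLieAlgebra 𝓘(ℝ, E) S) : innerNorm c (r • X) = |r| * innerNorm c X := by
  have h1 : ∀ Y, c.inner (r • X) Y = r * c.inner X Y := fun Y => by simpa using c.smul_left X Y r
  have h2 : c.inner X (r • X) = r * c.inner X X := by
    have := c.conj_inner_symm X (r • X)
    simp only [conj_trivial] at this
    rw [← this, h1]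
  unfold innerNorm
  rw [h1, h2, ← mul_assoc, Real.sqrt_mul (mul_self_nonneg r), Real.sqrt_mul_self_eq_abs]

/-- The distance of the left invariant Riemannian metric on `S` given by the inner product `c` on
its Lie algebra. -/
@[reducible] def leftInvariantMetric [IsManifold 𝓘(ℝ, E) 1 S]
    (c : InnerProductSpace.Core ℝ (GroupLieAlgebra 𝓘(ℝ, E) S)) : PseudoEMetricSpace S :=
  letI : ∀ g : S, ENorm (TangentSpace 𝓘(ℝ, E) g) := leftInvariantENorm (innerNorm c)
  haveI : ∀ g : S, ENormSMulClass ℝ (TangentSpace 𝓘(ℝ, E) g) := fun g => ⟨fun r v => by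
    change ENNReal.ofReal (innerNorm c (maurerCartan g (r • v)))
      = ‖r‖ₑ * ENNReal.ofReal (innerNorm c (maurerCartan g v))
    have : maurerCartan g (r • v) = r • maurerCartan g v := by
      unfold maurerCartan
      exact map_smul _ r v
    rw [this, innerNorm_smul, ENNReal.ofReal_mul (abs_nonneg r), Real.enorm_eq_ofReal_abs]⟩
  { edist := leftInvariantEDist (innerNorm c)
    edist_self := fun _ => Manifold.riemannianEDist_self
    edist_comm := fun _ _ => Manifold.riemannianEDist_comm
    edist_triangle := fun _ _ _ => Manifold.riemannianEDist_triangle }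

/-- The norm on `𝔰 ⧸ 𝔨` for which `𝔨ᗮ → 𝔰 ⧸ 𝔨` is an isometry, as a function on `𝔰`. -/
def quotientNorm (c : InnerProductSpace.Core ℝ (GroupLieAlgebra 𝓘(ℝ, E) S))
    (𝔨 : Submodule ℝ (GroupLieAlgebra 𝓘(ℝ, E) S)) (X : GroupLieAlgebra 𝓘(ℝ, E) S) : ℝ :=
  ⨅ Y : 𝔨, innerNorm c (X + Y)

/-- The Riemannian distance on `S ⧸ K`, `K` the connected Lie subgroup with Lie algebra `𝔨`, for
the left invariant Riemannian metric given by the inner product on `T_K (S ⧸ K) = 𝔰 ⧸ 𝔨` for which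
`𝔨ᗮ → 𝔰 ⧸ 𝔨` is an isometry. The `C^1` paths in `S ⧸ K` are exactly the projections of the `C^1`
paths `γ` in `S`, and the speed of the projection is the norm of the class of `Θ(γ')` in `𝔰 ⧸ 𝔨`.
So the distance is the infimum of the lengths of such paths from one coset to the other. -/
@[reducible] def quotientEDist (c : InnerProductSpace.Core ℝ (GroupLieAlgebra 𝓘(ℝ, E) S))
    (𝔨 : Submodule ℝ (GroupLieAlgebra 𝓘(ℝ, E) S)) : EDist (S ⧸ connectedLieSubgroup 𝔨) :=
  ⟨fun b b' => ⨅ (g : S) (_ : (g : S ⧸ connectedLieSubgroup 𝔨) = b)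
    (g' : S) (_ : (g' : S ⧸ connectedLieSubgroup 𝔨) = b'),
      leftInvariantEDist (E := E) (S := S) (quotientNorm c 𝔨) g g'⟩

/-- `e` exhibits `S ⧸ K`, `K` the connected Lie subgroup with Lie algebra `𝔨`, as a vector group:
`K` is normal, and `e` is the exponential map `𝔰 ⧸ 𝔨 → S ⧸ K` of the quotient group, which is a
homeomorphism and a homomorphism of groups. -/
structure IsVectorGroupExp (𝔨 : Submodule ℝ (GroupLieAlgebra 𝓘(ℝ, E) S))
    (e : (GroupLieAlgebra 𝓘(ℝ, E) S ⧸ 𝔨) ≃ₜ (S ⧸ connectedLieSubgroup 𝔨)) : Prop where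
  normal : (connectedLieSubgroup 𝔨).Normal
  exp_mk : ∀ X : GroupLieAlgebra 𝓘(ℝ, E) S,
    e (𝔨.mkQ X) = ((lieExp X : S) : S ⧸ connectedLieSubgroup 𝔨)
  map_add : ∀ (v w : GroupLieAlgebra 𝓘(ℝ, E) S ⧸ 𝔨) (g g' : S),
    e v = (g : S ⧸ connectedLieSubgroup 𝔨) → e w = (g' : S ⧸ connectedLieSubgroup 𝔨) →
      e (v + w) = ((g * g' : S) : S ⧸ connectedLieSubgroup 𝔨)

end LieGroups

/-! ### Locally free actions, their orbit foliations and canonical forms -/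

/-- A `C^∞` locally free right action of the Lie group `S` on the manifold `M`. -/
structure LocallyFreeAction (E F S M : Type*) [NormedAddCommGroup E] [NormedSpace ℝ E]
    [NormedAddCommGroup F] [NormedSpace ℝ F]
    [TopologicalSpace S] [ChartedSpace E S] [Group S]
    [TopologicalSpace M] [ChartedSpace F M] where
  act : M → S → M
  act_one : ∀ x, act x 1 = x
  act_mul : ∀ x s t, act x (s * t) = act (act x s) t
  smooth : ContMDiff (𝓘(ℝ, F).prod 𝓘(ℝ, E)) 𝓘(ℝ, F) ∞ (fun p : M × S => act p.1 p.2)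
  locallyFree : ∀ x, DiscreteTopology {s : S | act x s = x}

section Actions

variable {E F S M : Type*} [NormedAddCommGroup E] [NormedSpace ℝ E]
  [NormedAddCommGroup F] [NormedSpace ℝ F]
  [TopologicalSpace S] [ChartedSpace E S] [Group S]
  [TopologicalSpace M] [ChartedSpace F M]

/-- Two locally free actions have the same orbit foliation: they have the same leaves. -/
def SameOrbitFoliation (ρ₀ ρ : LocallyFreeAction E F S M) : Prop :=
  ∀ x : M, Set.range (ρ.act x) = Set.range (ρ₀.act x)

/-- `a : M × S → S` is the smooth map with `ρ₀(x, s) = ρ(x, a(x, s))` and `a(x, 1) = 1`. -/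
structure IsTransitionCocycle (ρ₀ ρ : LocallyFreeAction E F S M) (a : M → S → S) : Prop where
  smooth : ContMDiff (𝓘(ℝ, F).prod 𝓘(ℝ, E)) 𝓘(ℝ, E) ∞ (fun p : M × S => a p.1 p.2)
  map_one : ∀ x, a x 1 = 1
  act_eq : ∀ x s, ρ₀.act x s = ρ.act x (a x s)

/-- The derivative at `1` of `s ↦ ρ(x, s)`; for fixed `X ∈ 𝔰` this is the vector field on `M`
defined by `X`. -/
def LocallyFreeAction.field (ρ : LocallyFreeAction E F S M) (x : M) :
    GroupLieAlgebra 𝓘(ℝ, E) S →ₗ[ℝ] TangentSpace 𝓘(ℝ, F) x :=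
  (mfderiv 𝓘(ℝ, E) 𝓘(ℝ, F) (fun s : S => ρ.act x s) 1).toLinearMap

/-- The tangent space at `x` of the orbit foliation. -/
def LocallyFreeAction.leafTangent (ρ : LocallyFreeAction E F S M) (x : M) :
    Submodule ℝ (TangentSpace 𝓘(ℝ, F) x) :=
  LinearMap.range (ρ.field x)

/-- The canonical `1`-form of `ρ`, at `x` the inverse `T_x𝓕 → 𝔰` of the derivative at `1` of
`s ↦ ρ(x, s)`. It is meaningful only for `v` tangent to the orbit foliation. -/
def LocallyFreeAction.canonicalForm (ρ : LocallyFreeAction E F S M) (x : M)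
    (v : TangentSpace 𝓘(ℝ, F) x) : GroupLieAlgebra 𝓘(ℝ, E) S :=
  Function.invFun (ρ.field x) v

/-- The derivative of a real function at `x` in the direction `v`. -/
def directionalDeriv (f : M → ℝ) (x : M) (v : TangentSpace 𝓘(ℝ, F) x) : ℝ :=
  mfderiv 𝓘(ℝ, F) 𝓘(ℝ, ℝ) f x v

variable (F) in
/-- Smoothness of a map to a finite dimensional real vector space (no norm chosen): all its
compositions with linear functionals are smooth. -/
def IsSmoothVectorMap {W : Type*} [AddCommGroup W] [Module ℝ W] (h : M → W) : Prop :=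
  ∀ l : Module.Dual ℝ W, ContMDiff 𝓘(ℝ, F) 𝓘(ℝ, ℝ) ∞ (fun x => l (h x))

/-- A smooth leafwise `W`-valued `1`-form of the orbit foliation of `ρ`. Smoothness is tested on the
global frame of the tangent bundle of the foliation given by the Lie algebra. -/
structure LeafwiseOneForm (ρ : LocallyFreeAction E F S M) (W : Type*) [AddCommGroup W]
    [Module ℝ W] where
  toFun : ∀ x : M, ρ.leafTangent x →ₗ[ℝ] W
  smooth : ∀ X : GroupLieAlgebra 𝓘(ℝ, E) S,
    IsSmoothVectorMap F (fun x => toFun x ⟨ρ.field x X, LinearMap.mem_range_self _ X⟩)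

/-- The function `η(X)` on `M`, for `X ∈ 𝔰` regarded as a vector field on `M`. -/
def LeafwiseOneForm.eval {ρ : LocallyFreeAction E F S M} {W : Type*} [AddCommGroup W] [Module ℝ W]
    (η : LeafwiseOneForm ρ W) (X : GroupLieAlgebra 𝓘(ℝ, E) S) (x : M) : W :=
  η.toFun x ⟨ρ.field x X, LinearMap.mem_range_self _ X⟩

/-- `d_𝓕 η = 0`, that is `X η(Y) - Y η(X) = η([X, Y])` for the vector fields on `M` defined by
`X, Y ∈ 𝔰`. -/
def LeafwiseOneForm.IsClosed {ρ : LocallyFreeAction E F S M} {W : Type*} [AddCommGroup W]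
    [Module ℝ W] (η : LeafwiseOneForm ρ W) : Prop :=
  ∀ (X Y : GroupLieAlgebra 𝓘(ℝ, E) S) (l : Module.Dual ℝ W) (x : M),
    directionalDeriv (fun y => l (η.eval Y y)) x (ρ.field x X)
      - directionalDeriv (fun y => l (η.eval X y)) x (ρ.field x Y) = l (η.eval ⁅X, Y⁆ x)

/-- `H¹(𝓕; W) = H¹(𝔰; W)` (trivial coefficients): each closed leafwise `W`-valued `1`-form equals
`φ ω₀ + d_𝓕 h` for some linear `φ : 𝔰 → W` vanishing on `[𝔰, 𝔰]` and some smooth `h : M → W`. -/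
def LeafwiseH1EqLieH1 (ρ₀ : LocallyFreeAction E F S M) (W : Type*) [AddCommGroup W]
    [Module ℝ W] : Prop :=
  ∀ η : LeafwiseOneForm ρ₀ W, η.IsClosed →
    ∃ φ : GroupLieAlgebra 𝓘(ℝ, E) S →ₗ[ℝ] W,
      (∀ X Y : GroupLieAlgebra 𝓘(ℝ, E) S, φ ⁅X, Y⁆ = 0) ∧
      ∃ h : M → W, IsSmoothVectorMap F h ∧
        ∀ (x : M) (v : ρ₀.leafTangent x) (l : Module.Dual ℝ W),
          l (η.toFun x v) = l (φ (ρ₀.canonicalForm x v))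
            + directionalDeriv (fun y => l (h y)) x (v : TangentSpace 𝓘(ℝ, F) x)

/-- `φ = φ_ρ`: the linear map `φ : 𝔰 → 𝔰 ⧸ 𝔥` vanishes on `[𝔰, 𝔰]`, and `ω mod 𝔥 = φ ω₀ + d_𝓕 h`
for some smooth `h : M → 𝔰 ⧸ 𝔥`, where `ω₀`, `ω` are the canonical forms of `ρ₀`, `ρ`. -/
def IsCharacteristicMap (ρ₀ ρ : LocallyFreeAction E F S M)
    (𝔥 : Submodule ℝ (GroupLieAlgebra 𝓘(ℝ, E) S))
    (φ : GroupLieAlgebra 𝓘(ℝ, E) S →ₗ[ℝ] (GroupLieAlgebra 𝓘(ℝ, E) S ⧸ 𝔥)) : Prop :=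
  (∀ X Y : GroupLieAlgebra 𝓘(ℝ, E) S, φ ⁅X, Y⁆ = 0) ∧
  ∃ h : M → GroupLieAlgebra 𝓘(ℝ, E) S ⧸ 𝔥, IsSmoothVectorMap F h ∧
    ∀ (x : M) (v : ρ₀.leafTangent x) (l : Module.Dual ℝ (GroupLieAlgebra 𝓘(ℝ, E) S ⧸ 𝔥)),
      l (𝔥.mkQ (ρ.canonicalForm x v))
        = l (φ (ρ₀.canonicalForm x v)) + directionalDeriv (fun y => l (h y)) x (v : TangentSpace 𝓘(ℝ, F) x)

end Actions

end

noncomputable section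

set_option linter.unusedSectionVars false

/-! ### Generalities on manifolds and simply connected spaces -/

/-! Both actions parametrize the same leaves, so `a(x, ·)` is a lift. The orbit of `x` is the
quotient of `S` by a discrete isotropy group, so `S` covers it through `ρ(x, ·)`, and `ρ₀(x, ·)`
lifts uniquely through this covering because `S` is simply connected. Continuity for the leaf
topology is the delicate point. In a flow box of `ρ`, an orbit meets only countably many plaques
because `S` is separable, so a connected piece of a `ρ₀`-orbit stays in one plaque
(`LocallyFreeAction.eq_of_mem_orbit`). Uniqueness of lifts gives the cocycle identity `a(x, st) =
a(x, s) a(ρ₀(x, s), t)`. With compactness of `M`, it spreads smoothness from `s = 1` to all of `S`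
(`SameOrbitFoliation.contMDiff_cocycle`). Exchanging the actions gives a cocycle `b` with `b(x, ·)`
inverse to `a(x, ·)`.

Write `A(y)` for the derivative of `a(y, ·)` at `1`. By the cocycle identity, the left trivialized
derivative of `a(x, ·)` at `g` is `A(ρ₀(x, g))` (`IsTransitionCocycle.maurerCartan_mfderiv`). It is
bounded because `M` is compact, so `a(x, ·)` is Lipschitz, and so is its inverse.

A left invariant form that vanishes on brackets is closed, and on the simply connected `S` its
primitive is a homomorphism to `ℝ`. For a subspace `𝔨` containing all brackets, such characters
assemble to a homomorphism `P : S → 𝔰/𝔨` (`exists_isQuotientHom`). Its kernel is the connected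
subgroup `K` of `𝔨` (`IsQuotientHom.mem_connectedLieSubgroup_iff`), so `S/K` is a vector group.
Norming functionals bound distances between fibers from below and one-parameter subgroups bound them
from above, so both fiber distances equal the quotient norm.

On the frame of `ρ₀`, the form `ω` is `A`. Integrating `ω mod 𝔥 = φ ω₀ + d h` along an orbit
therefore gives `P(a(x, s)) = φbar(Q(s)) + h(ρ₀(x, s)) - h(x)`, with `P`, `Q` the homomorphisms for
`𝔥` and `ker φ` (`IsTransitionCocycle.exists_coboundary`). The last two terms are bounded. Along
one-parameter subgroups, boundedness forces `φ` to be unique and surjective. It also says that `a(x,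
·)` sends the fiber over `b` close to the fiber over `φbar b`. The inverse `b(x, ·)` and the
Lipschitz bound give the other half of the Hausdorff estimate. -/

open Bundle in
/-- Primitives on the members of an open cover of a simply connected space, whose differences are
locally constant, glue to a global primitive. -/
theorem exists_glued_primitive {X ι : Type*} [TopologicalSpace X] [SimplyConnectedSpace X]
    [LocallyPathConnectedSpace X] (U : ι → Set X) (hU : ∀ i, IsOpen (U i))
    (hcov : ∀ x, ∃ i, x ∈ U i) (f : ι → X → ℝ)
    (hf : ∀ i j, ∀ x ∈ U i ∩ U j, ∀ᶠ y in 𝓝 x, f i y - f j y = f i x - f j x) :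
    ∃ F : X → ℝ, ∀ i, ∀ x ∈ U i, ∀ᶠ y in 𝓝 x, F y - f i y = F x - f i x := by
  classical
  -- A copy of `ℝ` with the discrete topology: a fiber bundle with discrete fiber is a covering.
  obtain ⟨D, tD, hD, ⟨e⟩⟩ : ∃ (D : Type) (_ : TopologicalSpace D) (_ : DiscreteTopology D),
      Nonempty (D ≃ ℝ) := ⟨ℝ, ⊥, @DiscreteTopology.mk ℝ ⊥ rfl, ⟨Equiv.refl ℝ⟩⟩
  choose idx hidx using hcov
  let Z : FiberBundleCore ι X D :=
    { baseSet := U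
      isOpen_baseSet := hU
      indexAt := idx
      mem_baseSet_at := hidx
      coordChange := fun i j x v => e.symm (e v + (f i x - f j x))
      coordChange_self := fun i x _ v => by simp
      continuousOn_coordChange := fun i j => by
        rintro ⟨x, v⟩ ⟨hx, -⟩
        apply ContinuousAt.continuousWithinAt
        apply (continuousAt_const (y := e.symm (e v + (f i x - f j x)))).congr
        have h1 : ∀ᶠ p : X × D in 𝓝 (x, v), f i p.1 - f j p.1 = f i x - f j x :=
          (continuousAt_fst (p := (x, v))).eventually (hf i j x hx)
        have h2 : ∀ᶠ p : X × D in 𝓝 (x, v), p.2 = v :=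
          (continuousAt_snd (p := (x, v))).eventually (show ∀ᶠ w in 𝓝 v, w = v by simp [nhds_discrete])
        filter_upwards [h1, h2] with p hp1 hp2
        rw [hp1, hp2]
      coordChange_comp := fun i j k x _ v => by
        simp only [Equiv.apply_symm_apply, EmbeddingLike.apply_eq_iff_eq]
        ring }
  have cov : IsCoveringMap (π D Z.Fiber) := FiberBundle.isCoveringMap
  obtain ⟨x₀⟩ : Nonempty X := inferInstance
  -- Lifting the identity of the simply connected base produces a global section.
  obtain ⟨G, ⟨-, hG⟩, -⟩ := cov.existsUnique_continuousMap_lifts (ContinuousMap.id X) x₀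
    (⟨x₀, e.symm 0⟩ : TotalSpace D Z.Fiber) rfl
  have hproj : ∀ x, (G x).proj = x := fun x => congrFun hG x
  have key : ∀ i, ∀ x ∈ U i, ∀ᶠ y in 𝓝 x,
      (Z.localTriv i (G y)).2 = (Z.localTriv i (G x)).2 := by
    intro i x hx
    have hc : ContinuousAt (fun y => (Z.localTriv i (G y)).2) x := by
      have h1 : ContinuousAt (Z.localTriv i) (G x) := by
        apply (Z.localTriv i).toOpenPartialHomeomorph.continuousAt
        change G x ∈ (Z.localTriv i).source
        rw [Trivialization.mem_source]
        change (G x).proj ∈ U i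
        exact (hproj x).symm ▸ hx
      exact continuousAt_snd.comp (h1.comp G.continuous.continuousAt)
    exact hc.eventually (show ∀ᶠ w in 𝓝 _, w = _ by simp [nhds_discrete])
  refine ⟨fun x => e (G x).2 + f (idx x) x, fun i x hx => ?_⟩
  -- The coordinate of the section in the `i`-th trivialization is the glued function minus `f i`;
  -- it is locally constant since the fiber is discrete.
  have hval : ∀ y, e ((Z.localTriv i (G y)).2) = e (G y).2 + f (idx y) y - f i y := by
    intro y
    have : (Z.localTriv i (G y)).2 = e.symm (e (G y).2 + (f (idx (G y).proj) (G y).proj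
      - f i (G y).proj)) := rfl
    rw [this, hproj, Equiv.apply_symm_apply]
    ring
  filter_upwards [key i x hx] with y hy
  have := congrArg e hy
  rw [hval, hval] at this
  exact this

section Manifold

variable {E : Type*} [NormedAddCommGroup E] [NormedSpace ℝ E]
  {M : Type*} [TopologicalSpace M] [ChartedSpace E M]
  {E' : Type*} [NormedAddCommGroup E'] [NormedSpace ℝ E']
  {N : Type*} [TopologicalSpace N] [ChartedSpace E' N]

/-- A map between manifolds is locally constant near a point near which its derivative vanishes. -/
theorem eventually_eq_of_mfderiv_eq_zero [IsManifold 𝓘(ℝ, E) 1 M] [IsManifold 𝓘(ℝ, E') 1 N]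
    {f : M → N} {x : M} (hf : ∀ᶠ y in 𝓝 x, MDifferentiableAt 𝓘(ℝ, E) 𝓘(ℝ, E') f y)
    (hf' : ∀ᶠ y in 𝓝 x, mfderiv 𝓘(ℝ, E) 𝓘(ℝ, E') f y = 0) :
    ∀ᶠ y in 𝓝 x, f y = f x := by
  have hsymm : ContinuousAt (extChartAt 𝓘(ℝ, E) x).symm (extChartAt 𝓘(ℝ, E) x x) :=
    continuousAt_extChartAt_symm x
  have hcont : ContinuousAt f x := hf.self_of_nhds.continuousAt
  have h1 : ∀ᶠ y in 𝓝 x, f y ∈ (extChartAt 𝓘(ℝ, E') (f x)).source :=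
    hcont.eventually (extChartAt_source_mem_nhds (f x))
  have h2 : ∀ᶠ u in 𝓝 (extChartAt 𝓘(ℝ, E) x x), u ∈ (extChartAt 𝓘(ℝ, E) x).target := by
    simpa using extChartAt_target_mem_nhds (I := 𝓘(ℝ, E)) x
  have hall : ∀ᶠ u in 𝓝 (extChartAt 𝓘(ℝ, E) x x), u ∈ (extChartAt 𝓘(ℝ, E) x).target ∧
      f ((extChartAt 𝓘(ℝ, E) x).symm u) ∈ (extChartAt 𝓘(ℝ, E') (f x)).source ∧
      MDifferentiableAt 𝓘(ℝ, E) 𝓘(ℝ, E') f ((extChartAt 𝓘(ℝ, E) x).symm u) ∧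
      mfderiv 𝓘(ℝ, E) 𝓘(ℝ, E') f ((extChartAt 𝓘(ℝ, E) x).symm u) = 0 := by
    have hs : Filter.Tendsto (extChartAt 𝓘(ℝ, E) x).symm (𝓝 (extChartAt 𝓘(ℝ, E) x x)) (𝓝 x) := by
      simpa [ContinuousAt] using hsymm
    exact h2.and ((hs.eventually h1).and ((hs.eventually hf).and (hs.eventually hf')))
  obtain ⟨r, hr, hball⟩ := Metric.eventually_nhds_iff_ball.1 hall
  have hder : ∀ u ∈ Metric.ball (extChartAt 𝓘(ℝ, E) x x) r,
      HasFDerivAt (fun u => extChartAt 𝓘(ℝ, E') (f x) (f ((extChartAt 𝓘(ℝ, E) x).symm u)))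
        (0 : E →L[ℝ] E') u := by
    intro u hu
    obtain ⟨hu1, hu2, hu3, hu4⟩ := hball u hu
    have a1 : MDifferentiableAt 𝓘(ℝ, E) 𝓘(ℝ, E) (extChartAt 𝓘(ℝ, E) x).symm u := by
      have := mdifferentiableWithinAt_extChartAt_symm (I := 𝓘(ℝ, E)) hu1
      rwa [modelWithCornersSelf_coe, range_id, mdifferentiableWithinAt_univ] at this
    have a2 : MDifferentiableAt 𝓘(ℝ, E') 𝓘(ℝ, E') (extChartAt 𝓘(ℝ, E') (f x))
        (f ((extChartAt 𝓘(ℝ, E) x).symm u)) :=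
      mdifferentiableAt_extChartAt (by simpa using hu2)
    have a3 := (hu3.hasMFDerivAt.comp u a1.hasMFDerivAt)
    have a4 := a2.hasMFDerivAt.comp u a3
    rw [hu4] at a4
    have a5 := a4.hasFDerivAt
    rwa [ContinuousLinearMap.zero_comp, ContinuousLinearMap.comp_zero] at a5
  have hopen : IsOpen (Metric.ball (extChartAt 𝓘(ℝ, E) x x) r) := Metric.isOpen_ball
  have hconst : ∀ u ∈ Metric.ball (extChartAt 𝓘(ℝ, E) x x) r,
      extChartAt 𝓘(ℝ, E') (f x) (f ((extChartAt 𝓘(ℝ, E) x).symm u))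
        = extChartAt 𝓘(ℝ, E') (f x) (f x) := by
    intro u hu
    have := (convex_ball (extChartAt 𝓘(ℝ, E) x x) r).is_const_of_fderivWithin_eq_zero (𝕜 := ℝ)
      (f := fun u => extChartAt 𝓘(ℝ, E') (f x) (f ((extChartAt 𝓘(ℝ, E) x).symm u)))
      (fun u hu => (hder u hu).differentiableAt.differentiableWithinAt)
      (fun u hu => by
        rw [fderivWithin_of_isOpen hopen hu]; exact (hder u hu).fderiv)
      hu (Metric.mem_ball_self hr)
    simpa using this
  have h3 : ∀ᶠ y in 𝓝 x, extChartAt 𝓘(ℝ, E) x y ∈ Metric.ball (extChartAt 𝓘(ℝ, E) x x) r :=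
    (continuousAt_extChartAt x).eventually (Metric.ball_mem_nhds _ hr)
  filter_upwards [h3, extChartAt_source_mem_nhds (I := 𝓘(ℝ, E)) x, h1] with y hy hy' hy''
  have := hconst _ hy
  rw [(extChartAt 𝓘(ℝ, E) x).left_inv hy'] at this
  exact (extChartAt 𝓘(ℝ, E') (f x)).injOn hy'' (mem_extChartAt_source _) this

/-- A map with vanishing derivative on a connected manifold is constant. -/
theorem eq_of_mfderiv_eq_zero [IsManifold 𝓘(ℝ, E) 1 M] [IsManifold 𝓘(ℝ, E') 1 N]
    [PreconnectedSpace M] {f : M → N} (hf : MDifferentiable 𝓘(ℝ, E) 𝓘(ℝ, E') f)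
    (hf' : ∀ y, mfderiv 𝓘(ℝ, E) 𝓘(ℝ, E') f y = 0) (x y : M) : f x = f y := by
  have : IsLocallyConstant f := (IsLocallyConstant.iff_eventually_eq f).2 fun x =>
    eventually_eq_of_mfderiv_eq_zero (.of_forall hf) (.of_forall hf')
  exact this.apply_eq_of_preconnectedSpace x y

end Manifold

/-! ### Vector fields as differential operators -/

section VectorField

open VectorField

variable {E : Type*} [NormedAddCommGroup E] [NormedSpace ℝ E]

/-- The value of the exterior derivative of a `1`-form on two vector fields, in a vector space. -/
theorem fderiv_form_apply_sub {η : E → E →L[ℝ] ℝ} {V W : E → E} {u : E}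
    (hη : DifferentiableAt ℝ η u) (hV : DifferentiableAt ℝ V u) (hW : DifferentiableAt ℝ W u) :
    fderiv ℝ (fun y => η y (W y)) u (V u) - fderiv ℝ (fun y => η y (V y)) u (W u)
      = fderiv ℝ η u (V u) (W u) - fderiv ℝ η u (W u) (V u) + η u (lieBracket ℝ V W u) := by
  rw [fderiv_clm_apply hη hW, fderiv_clm_apply hη hV, lieBracket_eq]
  simp only [add_apply, ContinuousLinearMap.comp_apply,
    ContinuousLinearMap.flip_apply, map_sub]
  ring

variable {M : Type*} [TopologicalSpace M] [ChartedSpace E M]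

/-- A vector field on a manifold, read in the chart at `x`. -/
def chartField (x : M) (V : Π y : M, TangentSpace 𝓘(ℝ, E) y) (u : E) : E :=
  mpullback 𝓘(ℝ, E) 𝓘(ℝ, E) (extChartAt 𝓘(ℝ, E) x).symm V u

section Chart

variable {x : M} {u : E}

theorem contMDiffAt_extChartAt_symm_self {n : ℕ∞} [IsManifold 𝓘(ℝ, E) n M]
    (hu : u ∈ (extChartAt 𝓘(ℝ, E) x).target) :
    ContMDiffAt 𝓘(ℝ, E) 𝓘(ℝ, E) n (extChartAt 𝓘(ℝ, E) x).symm u := by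
  have := contMDiffWithinAt_extChartAt_symm_range (I := 𝓘(ℝ, E)) (n := n) x hu
  rwa [modelWithCornersSelf_coe, range_id, contMDiffWithinAt_univ] at this

theorem isInvertible_mfderiv_extChartAt_symm_self [IsManifold 𝓘(ℝ, E) 1 M]
    (hu : u ∈ (extChartAt 𝓘(ℝ, E) x).target) :
    (mfderiv 𝓘(ℝ, E) 𝓘(ℝ, E) (extChartAt 𝓘(ℝ, E) x).symm u).IsInvertible := by
  have := isInvertible_mfderivWithin_extChartAt_symm (I := 𝓘(ℝ, E)) hu
  rwa [modelWithCornersSelf_coe, range_id, mfderivWithin_univ] at this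

variable [CompleteSpace E] [IsManifold 𝓘(ℝ, E) 2 M] {V W : Π y : M, TangentSpace 𝓘(ℝ, E) y}

theorem differentiableAt_mpullback_extChartAt_symm (hu : u ∈ (extChartAt 𝓘(ℝ, E) x).target)
    (hV : MDifferentiableAt 𝓘(ℝ, E) 𝓘(ℝ, E).tangent
      (fun y => (V y : TangentBundle 𝓘(ℝ, E) M)) ((extChartAt 𝓘(ℝ, E) x).symm u)) :
    DifferentiableAt ℝ (chartField x V) u := by
  have : IsManifold 𝓘(ℝ, E) 1 M := .of_le (n := 2) one_le_two
  have h1 := MDifferentiableAt.mpullback_vectorField (n := 2) hV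
    (contMDiffAt_extChartAt_symm_self (n := 2) hu) (isInvertible_mfderiv_extChartAt_symm_self hu)
    le_rfl
  rw [← mdifferentiableWithinAt_univ] at h1
  refine differentiableWithinAt_univ.1 (MDifferentiableWithinAt.differentiableWithinAt ?_)
  exact (contMDiff_snd_tangentBundle_modelSpace E 𝓘(ℝ, E)).contMDiffAt.mdifferentiableAt one_ne_zero
    |>.comp_mdifferentiableWithinAt _ h1

/-- Brackets commute with pullback along the inverse chart, so bracket computations can be done in
`E`. -/
theorem lieBracket_mpullback_extChartAt_symm [IsManifold 𝓘(ℝ, E) (minSmoothness ℝ 3) M]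
    (hu : u ∈ (extChartAt 𝓘(ℝ, E) x).target)
    (hV : MDifferentiableAt 𝓘(ℝ, E) 𝓘(ℝ, E).tangent
      (fun y => (V y : TangentBundle 𝓘(ℝ, E) M)) ((extChartAt 𝓘(ℝ, E) x).symm u))
    (hW : MDifferentiableAt 𝓘(ℝ, E) 𝓘(ℝ, E).tangent
      (fun y => (W y : TangentBundle 𝓘(ℝ, E) M)) ((extChartAt 𝓘(ℝ, E) x).symm u)) :
    lieBracket ℝ (chartField x V) (chartField x W) u
      = chartField x (mlieBracket 𝓘(ℝ, E) V W) u := by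
  have h := mpullback_mlieBracket (n := 2) hV hW (contMDiffAt_extChartAt_symm_self (n := 2) hu)
    (by rw [minSmoothness_of_isRCLikeNormedField])
  rw [← mlieBracketWithin_univ (V := mpullback 𝓘(ℝ, E) 𝓘(ℝ, E) _ V),
    mlieBracketWithin_eq_lieBracketWithin] at h
  exact ((congrFun (lieBracketWithin_univ (𝕜 := ℝ) (V := chartField x V) (W := chartField x W))
    u).symm.trans h.symm)

omit [CompleteSpace E] [IsManifold 𝓘(ℝ, E) 2 M] in
theorem fderiv_comp_extChartAt_symm_mpullback [IsManifold 𝓘(ℝ, E) 1 M] {f : M → ℝ}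
    (hu : u ∈ (extChartAt 𝓘(ℝ, E) x).target)
    (hf : MDifferentiableAt 𝓘(ℝ, E) 𝓘(ℝ, ℝ) f ((extChartAt 𝓘(ℝ, E) x).symm u)) :
    fderiv ℝ (f ∘ (extChartAt 𝓘(ℝ, E) x).symm) u
      (chartField x V u)
      = directionalDeriv f ((extChartAt 𝓘(ℝ, E) x).symm u)
          (V ((extChartAt 𝓘(ℝ, E) x).symm u)) := by
  have hs := (contMDiffAt_extChartAt_symm_self (n := 1) hu).mdifferentiableAt one_ne_zero
  have h := mfderiv_comp u hf hs
  rw [mfderiv_eq_fderiv] at h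
  have h1 := DFunLike.congr_fun h (chartField x V u)
  refine h1.trans ?_
  change mfderiv 𝓘(ℝ, E) 𝓘(ℝ, ℝ) f _ (mfderiv 𝓘(ℝ, E) 𝓘(ℝ, E) _ u
    ((mfderiv 𝓘(ℝ, E) 𝓘(ℝ, E) _ u).inverse _)) = mfderiv 𝓘(ℝ, E) 𝓘(ℝ, ℝ) f _ _
  rw [(isInvertible_mfderiv_extChartAt_symm_self hu).self_apply_inverse]

end Chart

/-- The Lie bracket of vector fields is the commutator of the directional derivatives. -/
theorem directionalDeriv_mlieBracket [CompleteSpace E] [IsManifold 𝓘(ℝ, E) ∞ M] {f : M → ℝ} {x : M}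
    {V W : Π y : M, TangentSpace 𝓘(ℝ, E) y}
    (hf : ContMDiff 𝓘(ℝ, E) 𝓘(ℝ, ℝ) 2 f)
    (hV : MDifferentiable 𝓘(ℝ, E) 𝓘(ℝ, E).tangent (fun y => (V y : TangentBundle 𝓘(ℝ, E) M)))
    (hW : MDifferentiable 𝓘(ℝ, E) 𝓘(ℝ, E).tangent (fun y => (W y : TangentBundle 𝓘(ℝ, E) M))) :
    directionalDeriv (fun y => directionalDeriv f y (W y)) x (V x)
      - directionalDeriv (fun y => directionalDeriv f y (V y)) x (W x)
      = directionalDeriv f x (mlieBracket 𝓘(ℝ, E) V W x) := by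
  have : IsManifold 𝓘(ℝ, E) 2 M := .of_le (n := ∞) ENat.LEInfty.out
  have : IsManifold 𝓘(ℝ, E) 1 M := .of_le (n := 2) one_le_two
  have : IsManifold 𝓘(ℝ, E) (minSmoothness ℝ 3) M := by
    rw [minSmoothness_of_isRCLikeNormedField]
    exact .of_le (n := ∞) ENat.LEInfty.out
  set e := extChartAt 𝓘(ℝ, E) x with he
  have hfd : MDifferentiable 𝓘(ℝ, E) 𝓘(ℝ, ℝ) f := hf.mdifferentiable two_ne_zero
  have hmem : e x ∈ e.target := mem_extChartAt_target x
  have hex : e.symm (e x) = x := extChartAt_to_inv x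
  set V' : E → E := chartField x V with hV'
  set W' : E → E := chartField x W with hW'
  have dV : DifferentiableAt ℝ V' (e x) := differentiableAt_mpullback_extChartAt_symm hmem (hV _)
  have dW : DifferentiableAt ℝ W' (e x) := differentiableAt_mpullback_extChartAt_symm hmem (hW _)
  have htarget : e.target ∈ 𝓝 (e x) := extChartAt_target_mem_nhds (I := 𝓘(ℝ, E)) x
  have cf : ContDiffAt ℝ 2 (f ∘ e.symm) (e x) :=
    ((hf _).comp (e x) (contMDiffAt_extChartAt_symm_self (n := 2) hmem)).contDiffAt
  have dω : DifferentiableAt ℝ (fderiv ℝ (f ∘ e.symm)) (e x) :=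
    (cf.fderiv_right (m := 1) le_rfl).differentiableAt one_ne_zero
  -- Read in the chart, iterated directional derivatives become derivatives of the exact form `d(f ∘
  -- e.symm)` evaluated on chart fields, to which `fderiv_form_apply_sub` applies.
  have key : ∀ U Z : Π y : M, TangentSpace 𝓘(ℝ, E) y,
      DifferentiableAt ℝ (chartField x U ) (e x) →
      directionalDeriv (fun y => directionalDeriv f y (U y)) x (Z x)
        = fderiv ℝ (fun u => fderiv ℝ (f ∘ e.symm) u
            (chartField x U u)) (e x)
            (chartField x Z (e x)) := by
    intro U Z hU
    have hg : MDifferentiableAt 𝓘(ℝ, E) 𝓘(ℝ, ℝ)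
        (fun y => directionalDeriv f y (U y)) x := by
      have h1 : MDifferentiableAt 𝓘(ℝ, E) 𝓘(ℝ, ℝ) ((fun u => fderiv ℝ (f ∘ e.symm) u
          (chartField x U u)) ∘ e) x := by
        apply MDifferentiableAt.comp x (I' := 𝓘(ℝ, E))
        · exact (dω.clm_apply hU).mdifferentiableAt
        · exact mdifferentiableAt_extChartAt (by simp)
      apply h1.congr_of_eventuallyEq
      filter_upwards [extChartAt_source_mem_nhds (I := 𝓘(ℝ, E)) x] with y hy
      have := fderiv_comp_extChartAt_symm_mpullback (V := U) (e.map_source hy) (hfd _)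
      rw [← he] at this
      rw [Function.comp_apply, this, e.left_inv hy]
    have h2 := fderiv_comp_extChartAt_symm_mpullback
      (f := fun y => directionalDeriv f y (U y)) (V := Z) hmem (by rwa [← he, hex])
    rw [← he] at h2
    rw [hex] at h2
    rw [← h2]
    congr 1
    apply Filter.EventuallyEq.fderiv_eq
    filter_upwards [htarget] with u hu
    exact (fderiv_comp_extChartAt_symm_mpullback (V := U) hu (hfd _)).symm
  rw [key W V dW, key V W dV]
  have hmain := fderiv_form_apply_sub dω dV dW
  refine hmain.trans ?_
  -- Symmetry of the second derivative removes all but the bracket term.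
  have hsym : fderiv ℝ (fderiv ℝ (f ∘ e.symm)) (e x) (V' (e x)) (W' (e x))
      = fderiv ℝ (fderiv ℝ (f ∘ e.symm)) (e x) (W' (e x)) (V' (e x)) := by
    have := cf.isSymmSndFDerivAt (by simp [minSmoothness_of_isRCLikeNormedField])
    exact this.eq _ _
  rw [hsym, sub_self, zero_add]
  have hb := lieBracket_mpullback_extChartAt_symm hmem (hV _) (hW _)
  have h3 := fderiv_comp_extChartAt_symm_mpullback (V := mlieBracket 𝓘(ℝ, E) V W) hmem (hfd _)
  rw [← he, hex] at h3
  rw [← h3]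
  congr 1

end VectorField

/-! ### One-parameter subgroups -/

section OneParam

variable {E : Type*} [NormedAddCommGroup E] [NormedSpace ℝ E]
  {S : Type*} [TopologicalSpace S] [ChartedSpace E S] [Group S] [LieGroup 𝓘(ℝ, E) ∞ S]

variable (E S) in
theorem lieGroup_of_le_infty {n : ℕ∞} : LieGroup 𝓘(ℝ, E) n S :=
  .of_le (n := ∞) (by exact_mod_cast le_top)

variable (E S) in
theorem lieGroup_minSmoothness : LieGroup 𝓘(ℝ, E) (minSmoothness ℝ 3) S := by
  rw [minSmoothness_of_isRCLikeNormedField]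
  exact lieGroup_of_le_infty E S (n := 3)

variable (E S) in
theorem isManifold_of_lieGroup (n : ℕ∞) : IsManifold 𝓘(ℝ, E) n S :=
  (lieGroup_of_le_infty E S (n := n)).toIsManifold

theorem mdifferentiable_mul_left_self (g : S) :
    MDifferentiable 𝓘(ℝ, E) 𝓘(ℝ, E) (fun x : S => g * x) :=
  (contMDiff_mul_left (I := 𝓘(ℝ, E)) (n := ∞) (a := g)).mdifferentiable (by simp)

/-- Tangent spaces at different points are all `E` but have different types; this moves the base
point along an equality. -/
theorem mfderiv_apply_congr_point {N : Type*} [TopologicalSpace N] {F : Type*}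
    [NormedAddCommGroup F] [NormedSpace ℝ F] [ChartedSpace F N] {f : S → N} {k k' : S}
    (h : k = k') (v : E) :
    (show F from mfderiv 𝓘(ℝ, E) 𝓘(ℝ, F) f k v) = mfderiv 𝓘(ℝ, E) 𝓘(ℝ, F) f k' v := by
  subst h
  rfl

theorem mfderiv_mul_left_mulInvariantVectorField (X : GroupLieAlgebra 𝓘(ℝ, E) S) (g h : S) :
    mfderiv 𝓘(ℝ, E) 𝓘(ℝ, E) (fun x : S => g * x) h (mulInvariantVectorField X h)
      = mulInvariantVectorField X (g * h) := by
  have h1 : (fun x : S => g * h * x) = (fun x => g * x) ∘ (fun x => h * x) := by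
    ext x; simp [mul_assoc]
  have h2 : mfderiv 𝓘(ℝ, E) 𝓘(ℝ, E) (fun x : S => g * h * x) 1
      = (mfderiv 𝓘(ℝ, E) 𝓘(ℝ, E) (fun x : S => g * x) (h * 1)).comp
        (mfderiv 𝓘(ℝ, E) 𝓘(ℝ, E) (fun x : S => h * x) 1) := by
    rw [h1, mfderiv_comp (I' := 𝓘(ℝ, E)) _ (mdifferentiable_mul_left_self g _)
      (mdifferentiable_mul_left_self h _)]
  have h3 := DFunLike.congr_fun h2 X
  exact (mfderiv_apply_congr_point (F := E) (mul_one h).symm _).trans h3.symm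

theorem maurerCartan_mulInvariantVectorField (X : GroupLieAlgebra 𝓘(ℝ, E) S) (g : S) :
    maurerCartan g (mulInvariantVectorField X g) = X := by
  have h1 : (fun x : S => x) = (fun x => g⁻¹ * x) ∘ (fun x => g * x) := by
    ext x; simp
  have h2 : mfderiv 𝓘(ℝ, E) 𝓘(ℝ, E) (fun x : S => x) 1
      = (mfderiv 𝓘(ℝ, E) 𝓘(ℝ, E) (fun x : S => g⁻¹ * x) (g * 1)).comp
        (mfderiv 𝓘(ℝ, E) 𝓘(ℝ, E) (fun x : S => g * x) 1) := by
    rw [h1, mfderiv_comp (I' := 𝓘(ℝ, E)) _ (mdifferentiable_mul_left_self _ _)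
      (mdifferentiable_mul_left_self g _)]
  have h3 := DFunLike.congr_fun h2 X
  rw [mul_one] at h3
  refine h3.symm.trans ?_
  exact DFunLike.congr_fun (mfderiv_id (I := 𝓘(ℝ, E)) (x := (1 : S))) X

theorem mulInvariantVectorField_maurerCartan (g : S) (v : TangentSpace 𝓘(ℝ, E) g) :
    mulInvariantVectorField (maurerCartan g v) g = v := by
  have h1 : (fun x : S => x) = (fun x => g * x) ∘ (fun x => g⁻¹ * x) := by
    ext x; simp
  have h2 : mfderiv 𝓘(ℝ, E) 𝓘(ℝ, E) (fun x : S => x) g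
      = (mfderiv 𝓘(ℝ, E) 𝓘(ℝ, E) (fun x : S => g * x) (g⁻¹ * g)).comp
        (mfderiv 𝓘(ℝ, E) 𝓘(ℝ, E) (fun x : S => g⁻¹ * x) g) := by
    rw [h1, mfderiv_comp (I' := 𝓘(ℝ, E)) _ (mdifferentiable_mul_left_self _ _)
      (mdifferentiable_mul_left_self _ _)]
  have h3 := DFunLike.congr_fun h2 v
  rw [inv_mul_cancel] at h3
  refine h3.symm.trans ?_
  exact DFunLike.congr_fun (mfderiv_id (I := 𝓘(ℝ, E)) (x := g)) v

theorem isMIntegralCurveOn_mul_left {X : GroupLieAlgebra 𝓘(ℝ, E) S} {γ : ℝ → S} {s : Set ℝ}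
    (hγ : IsMIntegralCurveOn γ (mulInvariantVectorField X) s) (g : S) :
    IsMIntegralCurveOn (fun t => g * γ t) (mulInvariantVectorField X) s := by
  intro t ht
  have h := (mdifferentiable_mul_left_self g (γ t)).hasMFDerivAt.comp_hasMFDerivWithinAt t (hγ t ht)
  refine h.congr_mfderiv ?_
  ext
  change mfderiv 𝓘(ℝ, E) 𝓘(ℝ, E) (fun x : S => g * x) (γ t)
    ((1 : ℝ) • mulInvariantVectorField X (γ t)) = (1 : ℝ) • mulInvariantVectorField X (g * γ t)
  rw [one_smul, one_smul, mfderiv_mul_left_mulInvariantVectorField]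

theorem contMDiff_one_mulInvariantVectorField (X : GroupLieAlgebra 𝓘(ℝ, E) S) :
    ContMDiff 𝓘(ℝ, E) 𝓘(ℝ, E).tangent 1
      (fun g => (mulInvariantVectorField X g : TangentBundle 𝓘(ℝ, E) S)) := by
  have := lieGroup_minSmoothness E S
  have := isManifold_of_lieGroup E S 2
  have := isManifold_of_lieGroup E S 1
  refine (contMDiff_mulInvariantVectorField (I := 𝓘(ℝ, E)) X).of_le ?_
  rw [minSmoothness_of_isRCLikeNormedField]
  exact one_le_two

theorem mdifferentiable_mulInvariantVectorField_self (X : GroupLieAlgebra 𝓘(ℝ, E) S) :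
    MDifferentiable 𝓘(ℝ, E) 𝓘(ℝ, E).tangent
      (fun g => (mulInvariantVectorField X g : TangentBundle 𝓘(ℝ, E) S)) := by
  have := isManifold_of_lieGroup E S 2
  exact (contMDiff_one_mulInvariantVectorField X).mdifferentiable one_ne_zero

variable [FiniteDimensional ℝ E] [T2Space S]

/-- Left translates of one local integral curve through `1` exist for the same time `ε` at every
point, and a uniform existence time makes the field complete. -/
theorem exists_oneParam (X : GroupLieAlgebra 𝓘(ℝ, E) S) :
    ∃ γ : ℝ → S, γ 0 = 1 ∧ IsMIntegralCurve γ (mulInvariantVectorField X) := by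
  have : CompleteSpace E := FiniteDimensional.complete ℝ E
  have := isManifold_of_lieGroup E S 1
  have hv := contMDiff_one_mulInvariantVectorField X
  obtain ⟨γ, h0, hγ⟩ := exists_isMIntegralCurveAt_of_contMDiffAt_boundaryless 0 (hv.contMDiffAt
    (x := (1 : S)))
  obtain ⟨ε, hε, hγ⟩ := isMIntegralCurveAt_iff'.1 hγ
  rw [Real.ball_eq_Ioo, zero_sub, zero_add] at hγ
  exact exists_isMIntegralCurve_of_isMIntegralCurveOn hv hε
    (fun x => ⟨fun t => x * γ t, by simp [h0], isMIntegralCurveOn_mul_left hγ x⟩) 1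

/-- The one-parameter subgroup with initial velocity `X`. -/
def oneParam (X : GroupLieAlgebra 𝓘(ℝ, E) S) : ℝ → S := (exists_oneParam X).choose

theorem oneParam_zero (X : GroupLieAlgebra 𝓘(ℝ, E) S) : oneParam X 0 = 1 :=
  (exists_oneParam X).choose_spec.1

theorem isMIntegralCurve_oneParam (X : GroupLieAlgebra 𝓘(ℝ, E) S) :
    IsMIntegralCurve (oneParam X) (mulInvariantVectorField X) :=
  (exists_oneParam X).choose_spec.2

theorem isMIntegralCurve_mul_oneParam (g : S) (X : GroupLieAlgebra 𝓘(ℝ, E) S) :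
    IsMIntegralCurve (fun t => g * oneParam X t) (mulInvariantVectorField X) := by
  rw [isMIntegralCurve_iff_isMIntegralCurveOn]
  exact isMIntegralCurveOn_mul_left ((isMIntegralCurve_oneParam X).isMIntegralCurveOn _) g

theorem eq_oneParam {X : GroupLieAlgebra 𝓘(ℝ, E) S} {γ : ℝ → S}
    (hγ : IsMIntegralCurve γ (mulInvariantVectorField X)) (h0 : γ 0 = 1) : γ = oneParam X := by
  have : CompleteSpace E := FiniteDimensional.complete ℝ E
  have := isManifold_of_lieGroup E S 1
  exact isMIntegralCurve_Ioo_eq_of_contMDiff_boundaryless (t₀ := 0)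
    (contMDiff_one_mulInvariantVectorField X) hγ (isMIntegralCurve_oneParam X)
    (h0.trans (oneParam_zero X).symm)

theorem oneParam_add (X : GroupLieAlgebra 𝓘(ℝ, E) S) (s t : ℝ) :
    oneParam X (s + t) = oneParam X s * oneParam X t := by
  have h1 : IsMIntegralCurve (fun t => (oneParam X s)⁻¹ * oneParam X (t + s))
      (mulInvariantVectorField X) := by
    rw [isMIntegralCurve_iff_isMIntegralCurveOn]
    exact isMIntegralCurveOn_mul_left
      (((isMIntegralCurve_oneParam X).comp_add s).isMIntegralCurveOn _) _
  have h2 := congrFun (eq_oneParam h1 (by simp)) t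
  rw [← h2, mul_inv_cancel_left, add_comm]

theorem oneParam_smul (r : ℝ) (X : GroupLieAlgebra 𝓘(ℝ, E) S) (t : ℝ) :
    oneParam (r • X) t = oneParam X (t * r) := by
  have h1 := (isMIntegralCurve_oneParam X).comp_mul r
  rw [← mulInvariantVectorField_smul] at h1
  exact (congrFun (eq_oneParam h1 (by simp [oneParam_zero])) t).symm

/-- Integral curves are unique, so the choice in `lieExp` has only one candidate. -/
theorem lieExp_eq_oneParam (X : GroupLieAlgebra 𝓘(ℝ, E) S) : lieExp X = oneParam X 1 := by
  have h : IsLieExp X (lieExp X) :=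
    Classical.epsilon_spec (p := fun g : S => IsLieExp X g)
      ⟨oneParam X 1, oneParam X, isMIntegralCurve_oneParam X, oneParam_zero X, rfl⟩
  obtain ⟨γ, hγ, h0, h1⟩ := h
  rw [← h1, eq_oneParam hγ h0]

theorem oneParam_eq_lieExp (X : GroupLieAlgebra 𝓘(ℝ, E) S) (t : ℝ) :
    oneParam X t = lieExp (t • X) := by
  rw [lieExp_eq_oneParam, oneParam_smul, one_mul]

theorem continuous_oneParam (X : GroupLieAlgebra 𝓘(ℝ, E) S) : Continuous (oneParam X) :=
  (isMIntegralCurve_oneParam X).continuous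

theorem hasMFDerivAt_mul_oneParam (g : S) (X : GroupLieAlgebra 𝓘(ℝ, E) S) (t : ℝ) :
    HasMFDerivAt 𝓘(ℝ, ℝ) 𝓘(ℝ, E) (fun t => g * oneParam X t) t
      ((1 : ℝ →L[ℝ] ℝ).smulRight (mulInvariantVectorField X (g * oneParam X t))) :=
  isMIntegralCurve_mul_oneParam g X t

theorem hasDerivAt_comp_mul_oneParam {f : S → ℝ} (g : S) (X : GroupLieAlgebra 𝓘(ℝ, E) S) (t : ℝ)
    (hf : MDifferentiableAt 𝓘(ℝ, E) 𝓘(ℝ, ℝ) f (g * oneParam X t)) :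
    HasDerivAt (fun t => f (g * oneParam X t))
      (directionalDeriv f (g * oneParam X t) (mulInvariantVectorField X (g * oneParam X t))) t := by
  have h := hf.hasMFDerivAt.comp t (hasMFDerivAt_mul_oneParam g X t)
  have h2 : HasMFDerivAt 𝓘(ℝ, ℝ) 𝓘(ℝ, ℝ) (fun t => f (g * oneParam X t)) t
      ((1 : ℝ →L[ℝ] ℝ).smulRight (directionalDeriv f (g * oneParam X t)
        (mulInvariantVectorField X (g * oneParam X t)))) := by
    refine h.congr_mfderiv ?_
    ext
    change mfderiv 𝓘(ℝ, E) 𝓘(ℝ, ℝ) f _ ((1 : ℝ) • mulInvariantVectorField X _)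
      = (1 : ℝ) • directionalDeriv f _ _
    rw [one_smul, one_smul]
    rfl
  exact hasDerivAt_iff_hasFDerivAt.2 h2.hasFDerivAt

/-- An integral curve of a continuous vector field is `C^1`. -/
theorem contMDiff_mul_oneParam (g : S) (X : GroupLieAlgebra 𝓘(ℝ, E) S) :
    ContMDiff 𝓘(ℝ, ℝ) 𝓘(ℝ, E) 1 (fun t => g * oneParam X t) := by
  have := isManifold_of_lieGroup E S 1
  intro t₀
  set γ := fun t => g * oneParam X t with hγdef
  have hγ : IsMIntegralCurve γ (mulInvariantVectorField X) := isMIntegralCurve_mul_oneParam g X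
  have hc : Continuous γ := hγ.continuous
  rw [contMDiffAt_iff]
  refine ⟨hc.continuousAt, ?_⟩
  have hev := (hγ.isMIntegralCurveAt t₀).eventually_hasDerivAt
  have hd : ContDiffAt ℝ 1 (extChartAt 𝓘(ℝ, E) (γ t₀) ∘ γ) t₀ := by
    rw [contDiffAt_one_iff]
    -- The derivative is the vector field along the curve in the tangent coordinates at `γ t₀`; its
    -- continuity comes from that of the field as a section of the tangent bundle.
    refine ⟨fun t => (1 : ℝ →L[ℝ] ℝ).smulRight (tangentCoordChange 𝓘(ℝ, E) (γ t) (γ t₀) (γ t)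
      (mulInvariantVectorField X (γ t))), _, Filter.inter_mem hev
      (hc.continuousAt.preimage_mem_nhds (extChartAt_source_mem_nhds (I := 𝓘(ℝ, E)) (γ t₀))),
      ?_, fun t ht => ht.1.hasFDerivAt⟩
    intro t ht
    have h2 : ContinuousAt (fun t => (⟨γ t, mulInvariantVectorField X (γ t)⟩ :
        TangentBundle 𝓘(ℝ, E) S)) t :=
      ((contMDiff_one_mulInvariantVectorField X).continuous.comp hc).continuousAt
    have hmem : (⟨γ t, mulInvariantVectorField X (γ t)⟩ : TangentBundle 𝓘(ℝ, E) S) ∈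
        (trivializationAt E (TangentSpace 𝓘(ℝ, E)) (γ t₀)).source := by
      rw [Bundle.Trivialization.mem_source]
      simpa using ht.2
    have h3 : ContinuousAt (fun t => trivializationAt E (TangentSpace 𝓘(ℝ, E)) (γ t₀)
        (⟨γ t, mulInvariantVectorField X (γ t)⟩ : TangentBundle 𝓘(ℝ, E) S)) t :=
      Filter.Tendsto.comp ((trivializationAt E (TangentSpace 𝓘(ℝ, E))
        (γ t₀)).toOpenPartialHomeomorph.continuousAt hmem) h2
    have h4 : ContinuousAt (fun t => tangentCoordChange 𝓘(ℝ, E) (γ t) (γ t₀) (γ t)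
      (mulInvariantVectorField X (γ t))) t := h3.snd
    exact ((ContinuousLinearMap.smulRightL ℝ ℝ E 1).continuous.continuousAt.comp
      h4).continuousWithinAt
  change ContDiffWithinAt ℝ 1 (extChartAt 𝓘(ℝ, E) (γ t₀) ∘ γ) (range id) t₀
  exact hd.contDiffWithinAt
end OneParam

/-! ### Characters of simply connected Lie groups -/

section Character

variable {E : Type*} [NormedAddCommGroup E] [NormedSpace ℝ E]

/-- The preferred chart at `x`, read in itself, is the identity. -/
theorem hasMFDerivAt_extChartAt_self {M : Type*} [TopologicalSpace M] [ChartedSpace E M] (x : M) :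
    HasMFDerivAt 𝓘(ℝ, E) 𝓘(ℝ, E) (extChartAt 𝓘(ℝ, E) x) x (ContinuousLinearMap.id ℝ E) := by
  refine ⟨continuousAt_extChartAt x, ?_⟩
  have h : ∀ᶠ u in 𝓝 (extChartAt 𝓘(ℝ, E) x x),
      writtenInExtChartAt 𝓘(ℝ, E) 𝓘(ℝ, E) x (extChartAt 𝓘(ℝ, E) x) u = u := by
    filter_upwards [extChartAt_target_mem_nhds (I := 𝓘(ℝ, E)) x] with u hu
    exact (extChartAt 𝓘(ℝ, E) x).right_inv hu
  exact ((hasFDerivAt_id (𝕜 := ℝ) _).congr_of_eventuallyEq h).hasFDerivWithinAt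

variable {S : Type*} [TopologicalSpace S] [ChartedSpace E S] [Group S] [LieGroup 𝓘(ℝ, E) ∞ S]

variable (S) in
/-- The left Maurer--Cartan form, read in the chart at `1`. -/
def chartMaurerCartan (u : E) : E →L[ℝ] E :=
  fderiv ℝ (fun w => extChartAt 𝓘(ℝ, E) (1 : S) (((extChartAt 𝓘(ℝ, E) (1 : S)).symm u)⁻¹ *
    (extChartAt 𝓘(ℝ, E) (1 : S)).symm w)) u

/-- The outer chart is differentiated at `1`, where its derivative is the identity. -/
theorem chartMaurerCartan_apply {u : E} (hu : u ∈ (extChartAt 𝓘(ℝ, E) (1 : S)).target) (w : E) :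
    chartMaurerCartan S u w = maurerCartan ((extChartAt 𝓘(ℝ, E) (1 : S)).symm u)
      (mfderiv 𝓘(ℝ, E) 𝓘(ℝ, E) (extChartAt 𝓘(ℝ, E) (1 : S)).symm u w) := by
  have := isManifold_of_lieGroup E S 1
  set e := extChartAt 𝓘(ℝ, E) (1 : S) with he
  have h1 := ((contMDiffAt_extChartAt_symm_self (n := 1) hu).mdifferentiableAt
    one_ne_zero).hasMFDerivAt
  have h2 := (mdifferentiable_mul_left_self (E := E) ((e.symm u)⁻¹) (e.symm u)).hasMFDerivAt
  have h3 : HasMFDerivAt 𝓘(ℝ, E) 𝓘(ℝ, E) e ((e.symm u)⁻¹ * e.symm u)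
      (ContinuousLinearMap.id ℝ E) := by
    have h : ∀ k : S, k = 1 → HasMFDerivAt 𝓘(ℝ, E) 𝓘(ℝ, E) e k (ContinuousLinearMap.id ℝ E) := by
      rintro _ rfl
      exact hasMFDerivAt_extChartAt_self (E := E) (1 : S)
    exact h _ (inv_mul_cancel _)
  have h4 := (h3.comp _ h2).comp _ h1
  have h5 := DFunLike.congr_fun h4.mfderiv w
  rw [mfderiv_eq_fderiv] at h5
  exact h5

/-- It is a partial derivative of `(u, w) ↦ g(u)⁻¹ g(w)`, which is jointly smooth near the diagonal.
-/
theorem contDiffAt_chartMaurerCartan {u : E} (hu : u ∈ (extChartAt 𝓘(ℝ, E) (1 : S)).target) :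
    ContDiffAt ℝ ∞ (chartMaurerCartan S) u := by
  have := isManifold_of_lieGroup E S ⊤
  refine ContDiffAt.fderiv (n := ∞) (m := ∞) (g := fun u => u) ?_ contDiffAt_id (by simp)
  set e := extChartAt 𝓘(ℝ, E) (1 : S) with he
  have hs : ContMDiffAt 𝓘(ℝ, E) 𝓘(ℝ, E) ∞ e.symm u := contMDiffAt_extChartAt_symm_self (n := ⊤) hu
  have h1 : ContMDiffAt 𝓘(ℝ, E × E) 𝓘(ℝ, E) ∞
      (fun p : E × E => (e.symm p.1)⁻¹ * e.symm p.2) (u, u) := by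
    apply ContMDiffAt.mul (I := 𝓘(ℝ, E)) (n := ∞)
    · apply ContMDiffAt.inv
      exact ContMDiffAt.comp (f := Prod.fst) (u, u) hs contDiff_fst.contMDiff.contMDiffAt
    · exact ContMDiffAt.comp (f := Prod.snd) (u, u) hs contDiff_snd.contMDiff.contMDiffAt
  have h2 : ContMDiffAt 𝓘(ℝ, E) 𝓘(ℝ, E) ∞ e ((e.symm u)⁻¹ * e.symm u) := by
    rw [inv_mul_cancel]
    exact contMDiffAt_extChartAt
  have h3 := ContMDiffAt.comp
    (f := fun p : E × E => (e.symm p.1)⁻¹ * e.symm p.2) (u, u) h2 h1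
  exact h3.contDiffAt

theorem chartMaurerCartan_chartField {u : E} (hu : u ∈ (extChartAt 𝓘(ℝ, E) (1 : S)).target)
    (X : GroupLieAlgebra 𝓘(ℝ, E) S) :
    chartMaurerCartan S u (chartField (1 : S) (mulInvariantVectorField X) u) = X := by
  have := isManifold_of_lieGroup E S 1
  rw [chartMaurerCartan_apply hu]
  change maurerCartan _ (mfderiv 𝓘(ℝ, E) 𝓘(ℝ, E) _ u ((mfderiv 𝓘(ℝ, E) 𝓘(ℝ, E) _ u).inverse _)) = X
  rw [(isInvertible_mfderiv_extChartAt_symm_self hu).self_apply_inverse,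
    maurerCartan_mulInvariantVectorField]

theorem chartField_chartMaurerCartan {u : E} (hu : u ∈ (extChartAt 𝓘(ℝ, E) (1 : S)).target)
    (w : E) :
    chartField (1 : S) (mulInvariantVectorField (chartMaurerCartan S u w)) u = w := by
  have := isManifold_of_lieGroup E S 1
  rw [chartMaurerCartan_apply hu]
  change (mfderiv 𝓘(ℝ, E) 𝓘(ℝ, E) _ u).inverse (mulInvariantVectorField (maurerCartan _ _) _) = w
  rw [mulInvariantVectorField_maurerCartan]
  exact (isInvertible_mfderiv_extChartAt_symm_self hu).inverse_apply_self _

/-- A left invariant `1`-form which vanishes on brackets is closed. -/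
theorem fderiv_chartMaurerCartan_symm [FiniteDimensional ℝ E]
    {lam : GroupLieAlgebra 𝓘(ℝ, E) S →ₗ[ℝ] ℝ}
    (hlam : ∀ X Y : GroupLieAlgebra 𝓘(ℝ, E) S, lam ⁅X, Y⁆ = 0) {θ : E →L[ℝ] ℝ}
    (hθ : ∀ X : GroupLieAlgebra 𝓘(ℝ, E) S, θ X = lam X) {u : E}
    (hu : u ∈ (extChartAt 𝓘(ℝ, E) (1 : S)).target) (v w : E) :
    fderiv ℝ (fun u => θ.comp (chartMaurerCartan S u)) u v w
      = fderiv ℝ (fun u => θ.comp (chartMaurerCartan S u)) u w v := by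
  have := isManifold_of_lieGroup E S 1
  have := isManifold_of_lieGroup E S 2
  have := lieGroup_minSmoothness E S
  have : CompleteSpace E := FiniteDimensional.complete ℝ E
  -- The vectors `v`, `w` are extended to left invariant fields. The form is constant on each of
  -- them, so the exterior derivative formula reduces to `lam` of their bracket.
  set X : GroupLieAlgebra 𝓘(ℝ, E) S := chartMaurerCartan S u v with hX
  set Y : GroupLieAlgebra 𝓘(ℝ, E) S := chartMaurerCartan S u w with hY
  have htarget : ∀ᶠ u' in 𝓝 u, u' ∈ (extChartAt 𝓘(ℝ, E) (1 : S)).target :=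
    extChartAt_target_mem_nhds' hu
  have dform : DifferentiableAt ℝ (fun u => θ.comp (chartMaurerCartan S u)) u := by
    have h1 := (contDiffAt_chartMaurerCartan (S := S) hu).differentiableAt (by simp)
    fun_prop
  have dX : DifferentiableAt ℝ (chartField (1 : S) (mulInvariantVectorField X)) u :=
    differentiableAt_mpullback_extChartAt_symm hu (mdifferentiable_mulInvariantVectorField_self X _)
  have dY : DifferentiableAt ℝ (chartField (1 : S) (mulInvariantVectorField Y)) u :=
    differentiableAt_mpullback_extChartAt_symm hu (mdifferentiable_mulInvariantVectorField_self Y _)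
  have h := fderiv_form_apply_sub dform dX dY
  have hconst : ∀ Z : GroupLieAlgebra 𝓘(ℝ, E) S, fderiv ℝ (fun u => θ.comp (chartMaurerCartan S u)
      (chartField (1 : S) (mulInvariantVectorField Z) u)) u = 0 := by
    intro Z
    have : (fun u => θ.comp (chartMaurerCartan S u)
      (chartField (1 : S) (mulInvariantVectorField Z) u)) =ᶠ[𝓝 u] fun _ => θ Z := by
      filter_upwards [htarget] with u' hu'
      exact congrArg θ (chartMaurerCartan_chartField hu' Z)
    rw [this.fderiv_eq]
    simp
  rw [hconst, hconst] at h
  have hb : θ.comp (chartMaurerCartan S u) (VectorField.lieBracket ℝ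
      (chartField (1 : S) (mulInvariantVectorField X))
      (chartField (1 : S) (mulInvariantVectorField Y)) u) = 0 := by
    rw [lieBracket_mpullback_extChartAt_symm hu (mdifferentiable_mulInvariantVectorField_self X _)
      (mdifferentiable_mulInvariantVectorField_self Y _), ← mulInvariantVector_mlieBracket]
    have h1 := chartMaurerCartan_chartField hu ⁅X, Y⁆
    exact (congrArg θ h1).trans ((hθ _).trans (hlam X Y))
  rw [hb, hX, hY, chartField_chartMaurerCartan hu, chartField_chartMaurerCartan hu] at h
  simp only [zero_apply, sub_zero, add_zero] at h
  linarith

/-- Poincaré lemma on a ball in the chart at `1`, where the form is closed by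
`fderiv_chartMaurerCartan_symm`. -/
theorem exists_local_primitive [FiniteDimensional ℝ E] {lam : GroupLieAlgebra 𝓘(ℝ, E) S →ₗ[ℝ] ℝ}
    (hlam : ∀ X Y : GroupLieAlgebra 𝓘(ℝ, E) S, lam ⁅X, Y⁆ = 0) :
    ∃ (U : Set S) (f : S → ℝ), IsOpen U ∧ 1 ∈ U ∧ ∀ g ∈ U, ContMDiffAt 𝓘(ℝ, E) 𝓘(ℝ, ℝ) ∞ f g ∧
      ∀ v, directionalDeriv f g v = lam (maurerCartan g v) := by
  have := isManifold_of_lieGroup E S 1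
  have := isManifold_of_lieGroup E S ⊤
  have : CompleteSpace E := FiniteDimensional.complete ℝ E
  obtain ⟨θ, hθ⟩ : ∃ θ : E →L[ℝ] ℝ, ∀ X : GroupLieAlgebra 𝓘(ℝ, E) S, θ X = lam X :=
    ⟨LinearMap.toContinuousLinearMap (show E →ₗ[ℝ] ℝ from lam), fun _ => rfl⟩
  set e := extChartAt 𝓘(ℝ, E) (1 : S) with he
  obtain ⟨r, hr, hball⟩ := Metric.mem_nhds_iff.1 (extChartAt_target_mem_nhds (I := 𝓘(ℝ, E)) (1 : S))
  set D := Metric.ball (e 1) r with hD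
  have hcd : ∀ u ∈ D, ContDiffAt ℝ ∞ (fun u => θ.comp (chartMaurerCartan S u)) u := fun u hu =>
    contDiffAt_const.clm_comp (contDiffAt_chartMaurerCartan (hball hu))
  obtain ⟨G, hG⟩ := (convex_ball (e 1) r).exists_forall_hasFDerivAt_of_fderiv_symmetric
    Metric.isOpen_ball (fun u hu => ((hcd u hu).differentiableAt (by simp)).differentiableWithinAt)
    (fun u hu v w => fderiv_chartMaurerCartan_symm hlam hθ (hball hu) v w)
  have hGs : ContDiffOn ℝ ∞ G D := by
    rw [contDiffOn_infty_iff_fderiv_of_isOpen Metric.isOpen_ball]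
    refine ⟨fun u hu => (hG u hu).differentiableAt.differentiableWithinAt, fun u hu => ?_⟩
    exact ((hcd u hu).contDiffWithinAt).congr (fun y hy => (hG y hy).fderiv) (hG u hu).fderiv
  refine ⟨e.source ∩ e ⁻¹' D, G ∘ e, (continuousOn_extChartAt _).isOpen_inter_preimage
    (isOpen_extChartAt_source _) Metric.isOpen_ball,
    ⟨mem_extChartAt_source _, Metric.mem_ball_self hr⟩, fun g hg => ?_⟩
  have hg1 : g ∈ (chartAt E (1 : S)).source := by simpa [he] using hg.1
  have hGd : ContDiffAt ℝ ∞ G (e g) := hGs.contDiffAt (Metric.isOpen_ball.mem_nhds hg.2)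
  refine ⟨ContMDiffAt.comp g hGd.contMDiffAt (contMDiffAt_extChartAt' hg1), fun v => ?_⟩
  have h1 : MDifferentiableAt 𝓘(ℝ, E) 𝓘(ℝ, E) e g := mdifferentiableAt_extChartAt hg1
  have h2 := (hG _ hg.2).hasMFDerivAt.comp g h1.hasMFDerivAt
  have h3 := DFunLike.congr_fun h2.mfderiv v
  refine h3.trans ((congrArg θ (chartMaurerCartan_apply (e.map_source hg.1) _)).trans ?_)
  have h4 := mfderivWithin_extChartAt_symm_comp_mfderiv_extChartAt' (I := 𝓘(ℝ, E)) hg.1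
  rw [modelWithCornersSelf_coe, range_id, mfderivWithin_univ] at h4
  have h5 : ∀ k, e.symm (e g) = k → ∀ w : E, maurerCartan (e.symm (e g)) w = maurerCartan k w := by
    rintro _ rfl _; rfl
  rw [hθ]
  congr 1
  refine (h5 g (e.left_inv hg.1) _).trans ?_
  exact congrArg (maurerCartan g) (DFunLike.congr_fun h4 v)

theorem maurerCartan_mfderiv_mul_left (g h : S) (v : TangentSpace 𝓘(ℝ, E) h) :
    maurerCartan (g * h) (mfderiv 𝓘(ℝ, E) 𝓘(ℝ, E) (fun x : S => g * x) h v) = maurerCartan h v := by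
  conv_lhs => rw [← mulInvariantVectorField_maurerCartan h v]
  rw [mfderiv_mul_left_mulInvariantVectorField, maurerCartan_mulInvariantVectorField]

variable [FiniteDimensional ℝ E] [SimplyConnectedSpace S]

/-- On a simply connected Lie group, each linear functional on the Lie algebra which vanishes on
brackets is the derivative of a smooth homomorphism to `ℝ`. -/
theorem exists_character {lam : GroupLieAlgebra 𝓘(ℝ, E) S →ₗ[ℝ] ℝ}
    (hlam : ∀ X Y : GroupLieAlgebra 𝓘(ℝ, E) S, lam ⁅X, Y⁆ = 0) :
    ∃ p : S → ℝ, ContMDiff 𝓘(ℝ, E) 𝓘(ℝ, ℝ) ∞ p ∧ (∀ g h, p (g * h) = p g + p h) ∧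
      ∀ g v, directionalDeriv p g v = lam (maurerCartan g v) := by
  have := isManifold_of_lieGroup E S 1
  have : LocallyPathConnectedSpace S := ChartedSpace.locallyPathConnectedSpace E S
  have hcl : ∀ g : S, Continuous (fun x : S => g * x) := fun g =>
    (mdifferentiable_mul_left_self (E := E) g).continuous
  obtain ⟨U, f, hU, h1U, hf⟩ := exists_local_primitive hlam
  have hprim : ∀ (F : S → ℝ) (g x : S), MDifferentiableAt 𝓘(ℝ, E) 𝓘(ℝ, ℝ) F (g * x) →
      (∀ v, directionalDeriv F (g * x) v = lam (maurerCartan (g * x) v)) → ∀ v,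
      directionalDeriv (fun x => F (g * x)) x v = lam (maurerCartan x v) := by
    intro F g x hF hF' v
    have h := (hF.hasMFDerivAt.comp x (mdifferentiable_mul_left_self g x).hasMFDerivAt).mfderiv
    refine (DFunLike.congr_fun h v).trans ?_
    rw [← maurerCartan_mfderiv_mul_left g x v]
    exact hF' _
  have hsub : ∀ (F G : S → ℝ) (x : S), MDifferentiableAt 𝓘(ℝ, E) 𝓘(ℝ, ℝ) F x →
      MDifferentiableAt 𝓘(ℝ, E) 𝓘(ℝ, ℝ) G x →
      (∀ v, directionalDeriv F x v = lam (maurerCartan x v)) →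
      (∀ v, directionalDeriv G x v = lam (maurerCartan x v)) →
      MDifferentiableAt 𝓘(ℝ, E) 𝓘(ℝ, ℝ) (fun y => F y - G y) x ∧
      mfderiv 𝓘(ℝ, E) 𝓘(ℝ, ℝ) (fun y => F y - G y) x = 0 := by
    intro F G x hF hG hF' hG'
    have h := hF.hasMFDerivAt.sub hG.hasMFDerivAt
    refine ⟨h.mdifferentiableAt, h.mfderiv.trans ?_⟩
    ext v
    exact sub_eq_zero.2 ((hF' v).trans (hG' v).symm)
  -- Left translates of the primitive near `1` are again primitives because the form is left
  -- invariant; they cover `S`.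
  set V : S → Set S := fun g => (fun x => g⁻¹ * x) ⁻¹' U with hV
  set φ : S → S → ℝ := fun g x => f (g⁻¹ * x) with hφ
  have hVo : ∀ g, IsOpen (V g) := fun g => hU.preimage (hcl _)
  have hφs : ∀ g, ∀ x ∈ V g, ContMDiffAt 𝓘(ℝ, E) 𝓘(ℝ, ℝ) ∞ (φ g) x := fun g x hx =>
    ContMDiffAt.comp x (hf _ hx).1 (contMDiff_mul_left (I := 𝓘(ℝ, E)) (n := ∞)).contMDiffAt
  have hφd : ∀ g, ∀ x ∈ V g, ∀ v, directionalDeriv (φ g) x v = lam (maurerCartan x v) :=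
    fun g x hx => hprim f g⁻¹ x ((hf _ hx).1.mdifferentiableAt (by simp)) (hf _ hx).2
  obtain ⟨F, hF⟩ := exists_glued_primitive V hVo (fun x => ⟨x, by simpa [hV] using h1U⟩) φ (by
    intro i j x hx
    have hmem : ∀ᶠ y in 𝓝 x, y ∈ V i ∩ V j := ((hVo i).inter (hVo j)).mem_nhds hx
    have hmain := fun y (hy : y ∈ V i ∩ V j) => hsub (φ i) (φ j) y
      ((hφs i y hy.1).mdifferentiableAt (by simp)) ((hφs j y hy.2).mdifferentiableAt (by simp))
      (hφd i y hy.1) (hφd j y hy.2)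
    exact eventually_eq_of_mfderiv_eq_zero (hmem.mono fun y hy => (hmain y hy).1)
      (hmem.mono fun y hy => (hmain y hy).2))
  have hself : ∀ x, x ∈ V x := fun x => by simpa [hV] using h1U
  have hFeq : ∀ x, F =ᶠ[𝓝 x] fun y => φ x y + (F x - φ x x) := fun x => by
    filter_upwards [hF x x (hself x)] with y hy
    linarith
  have hFs : ContMDiff 𝓘(ℝ, E) 𝓘(ℝ, ℝ) ∞ F := fun x =>
    ((hφs x x (hself x)).add contMDiffAt_const).congr_of_eventuallyEq (hFeq x)
  have hFd : ∀ x v, directionalDeriv F x v = lam (maurerCartan x v) := by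
    intro x v
    have h1 := (((hφs x x (hself x)).mdifferentiableAt (by simp)).hasMFDerivAt.add
      (hasMFDerivAt_const (I := 𝓘(ℝ, E)) (F x - φ x x) x)).congr_of_eventuallyEq (hFeq x)
    exact (DFunLike.congr_fun h1.mfderiv v).trans
      ((add_zero (directionalDeriv (φ x) x v)).trans (hφd x x (hself x) v))
  have hFm : MDifferentiable 𝓘(ℝ, E) 𝓘(ℝ, ℝ) F := hFs.mdifferentiable (by simp)
  refine ⟨fun x => F x - F 1, hFs.sub contMDiff_const, fun g h => ?_, fun x v => ?_⟩
  -- Both `F(g x)` and `F x` are primitives of the same form, so their difference is constant;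
  -- normalizing at `1` gives additivity.
  · have hc := eq_of_mfderiv_eq_zero (E := E) (f := fun x => F (g * x) - F x)
      (fun x => (hsub (fun x => F (g * x)) F x ((hFm _).comp x (mdifferentiable_mul_left_self g x))
        (hFm x) (hprim F g x (hFm _) (hFd _)) (hFd x)).1)
      (fun x => (hsub (fun x => F (g * x)) F x ((hFm _).comp x (mdifferentiable_mul_left_self g x))
        (hFm x) (hprim F g x (hFm _) (hFd _)) (hFd x)).2) h 1
    simp only [mul_one] at hc
    linarith
  · have h1 := (hFm x).hasMFDerivAt.sub (hasMFDerivAt_const (I := 𝓘(ℝ, E)) (F 1) x)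
    exact (DFunLike.congr_fun h1.mfderiv v).trans
      ((sub_zero (directionalDeriv F x v)).trans (hFd x v))

end Character

/-! ### Coordinates of the second kind -/

section SecondKind

variable {E : Type*} [NormedAddCommGroup E] [NormedSpace ℝ E] [FiniteDimensional ℝ E]
  {S : Type*} [TopologicalSpace S] [ChartedSpace E S] [Group S] [LieGroup 𝓘(ℝ, E) ∞ S] [T2Space S]

theorem contMDiff_oneParam (X : GroupLieAlgebra 𝓘(ℝ, E) S) :
    ContMDiff 𝓘(ℝ, ℝ) 𝓘(ℝ, E) 1 (oneParam X) := by
  simpa using contMDiff_mul_oneParam 1 X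

/-- The product of the `exp (t i • b i)`, in increasing order of `i`. -/
def secondKind : {n : ℕ} → (Fin n → GroupLieAlgebra 𝓘(ℝ, E) S) → (Fin n → ℝ) → S
  | 0, _, _ => 1
  | _ + 1, b, t => oneParam (b 0) (t 0) * secondKind (Fin.tail b) (Fin.tail t)

theorem secondKind_zero {n : ℕ} (b : Fin n → GroupLieAlgebra 𝓘(ℝ, E) S) :
    secondKind b 0 = 1 := by
  induction n with
  | zero => rfl
  | succ n ih =>
    have h : Fin.tail (0 : Fin (n + 1) → ℝ) = 0 := rfl
    rw [secondKind, h, ih, Pi.zero_apply, oneParam_zero, one_mul]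

theorem secondKind_single {n : ℕ} (b : Fin n → GroupLieAlgebra 𝓘(ℝ, E) S) (i : Fin n) (s : ℝ) :
    secondKind b (Pi.single i s) = oneParam (b i) s := by
  induction n with
  | zero => exact i.elim0
  | succ n ih =>
    rw [secondKind]
    refine Fin.cases ?_ (fun j => ?_) i
    · have h : Fin.tail (Pi.single 0 s : Fin (n + 1) → ℝ) = 0 := by
        ext j; simp [Fin.tail]
      rw [h, secondKind_zero, Pi.single_eq_same, mul_one]
    · have h : Fin.tail (Pi.single j.succ s : Fin (n + 1) → ℝ) = Pi.single j s := by
        ext k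
        rw [Fin.tail]
        by_cases hk : k = j
        · subst hk; simp
        · rw [Pi.single_eq_of_ne hk, Pi.single_eq_of_ne (fun h => hk (Fin.succ_injective _ h))]
      rw [h, ih, Pi.single_eq_of_ne (Fin.succ_ne_zero j).symm, oneParam_zero, one_mul]
      rfl

theorem contMDiff_secondKind {n : ℕ} (b : Fin n → GroupLieAlgebra 𝓘(ℝ, E) S) :
    ContMDiff 𝓘(ℝ, Fin n → ℝ) 𝓘(ℝ, E) 1 (secondKind b) := by
  have := lieGroup_of_le_infty E S (n := 1)
  induction n with
  | zero => exact contMDiff_const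
  | succ n ih =>
    have h1 : ContMDiff 𝓘(ℝ, Fin (n + 1) → ℝ) 𝓘(ℝ, ℝ) 1 (fun t : Fin (n + 1) → ℝ => t 0) :=
      (contDiff_apply ℝ ℝ 0).contMDiff
    have h2 : ContMDiff 𝓘(ℝ, Fin (n + 1) → ℝ) 𝓘(ℝ, Fin n → ℝ) 1
        (fun t : Fin (n + 1) → ℝ => Fin.tail t) :=
      ContDiff.contMDiff (contDiff_pi.2 fun i : Fin n => contDiff_apply ℝ ℝ (Fin.succ i))
    exact ContMDiff.mul (I := 𝓘(ℝ, E)) (n := 1) ((contMDiff_oneParam (b 0)).comp h1)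
      ((ih (Fin.tail b)).comp h2)

/-- A homomorphism to a vector space does not see the order of the factors, so it returns the linear
value of the sum of exponents. -/
theorem map_secondKind {A : Type*} [AddCommGroup A] [Module ℝ A] {P : S → A}
    (hmul : ∀ g h, P (g * h) = P g + P h) {L : GroupLieAlgebra 𝓘(ℝ, E) S →ₗ[ℝ] A}
    (hL : ∀ X t, P (oneParam X t) = t • L X) {n : ℕ} (b : Fin n → GroupLieAlgebra 𝓘(ℝ, E) S)
    (t : Fin n → ℝ) : P (secondKind b t) = L (∑ i, t i • b i) := by
  induction n with
  | zero =>
    have h := hmul 1 1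
    rw [mul_one] at h
    simpa [secondKind] using h
  | succ n ih =>
    rw [secondKind, hmul, hL, ih, Fin.sum_univ_succ, map_add, map_smul]
    rfl

theorem secondKind_mem {K : Subgroup S} {n : ℕ} (b : Fin n → GroupLieAlgebra 𝓘(ℝ, E) S)
    (t : Fin n → ℝ) (h : ∀ i, oneParam (b i) (t i) ∈ K) : secondKind b t ∈ K := by
  induction n with
  | zero => exact K.one_mem
  | succ n ih => exact K.mul_mem (h 0) (ih _ _ fun i => h i.succ)

/-- Coordinates of the second kind cover a neighborhood of `1`. -/
theorem eventually_exists_secondKind {n : ℕ} {b : Fin n → GroupLieAlgebra 𝓘(ℝ, E) S}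
    (hb : ∀ X, ∃ t : Fin n → ℝ, ∑ i, t i • b i = X) :
    ∀ᶠ g in 𝓝 (1 : S), ∃ t, secondKind b t = g := by
  have := isManifold_of_lieGroup E S 1
  have : CompleteSpace E := FiniteDimensional.complete ℝ E
  set e := extChartAt 𝓘(ℝ, E) (1 : S) with he
  have h0 : e (secondKind b 0) = e 1 := by rw [secondKind_zero]
  have hG : ContDiffAt ℝ 1 (e ∘ secondKind b) 0 := by
    have h1 : ContMDiffAt 𝓘(ℝ, E) 𝓘(ℝ, E) 1 e (secondKind b 0) := by
      rw [secondKind_zero]; exact contMDiffAt_extChartAt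
    exact (h1.comp 0 (contMDiff_secondKind b).contMDiffAt).contDiffAt
  have hstrict := hG.hasStrictFDerivAt one_ne_zero
  set D : (Fin n → ℝ) →L[ℝ] E := fderiv ℝ (e ∘ secondKind b) 0 with hD
  -- On the `i`-th axis the coordinates reduce to the one-parameter subgroup of `b i`, with velocity
  -- `b i` at `1`.
  have hsingle : ∀ i, D (Pi.single i 1) = b i := by
    intro i
    have h1 : HasDerivAt (fun s : ℝ => (e ∘ secondKind b) (Pi.single i s))
        (D (Pi.single i 1)) 0 := by
      have h2 : HasDerivAt (fun s : ℝ => (Pi.single i s : Fin n → ℝ)) (Pi.single i 1) 0 := by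
        rw [hasDerivAt_pi]
        intro j
        by_cases hj : j = i
        · subst hj
          simp only [Pi.single_eq_same]
          exact hasDerivAt_id' 0
        · simpa [Pi.single_eq_of_ne hj] using hasDerivAt_const (0 : ℝ) (0 : ℝ)
      exact HasFDerivAt.comp_hasDerivAt (0 : ℝ) (l := e ∘ secondKind b)
        (f := fun s => (Pi.single i s : Fin n → ℝ))
        (by rw [Pi.single_zero]; exact hstrict.hasFDerivAt) h2
    have h3 : HasMFDerivAt 𝓘(ℝ, ℝ) 𝓘(ℝ, E) (fun s : ℝ => e (1 * oneParam (b i) s)) 0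
        ((1 : ℝ →L[ℝ] ℝ).smulRight (show E from b i)) := by
      have h4 : HasMFDerivAt 𝓘(ℝ, E) 𝓘(ℝ, E) e (1 * oneParam (b i) 0)
          (ContinuousLinearMap.id ℝ E) := by
        have h : ∀ k : S, k = 1 →
            HasMFDerivAt 𝓘(ℝ, E) 𝓘(ℝ, E) e k (ContinuousLinearMap.id ℝ E) := by
          rintro _ rfl
          exact hasMFDerivAt_extChartAt_self (E := E) (1 : S)
        exact h _ (by rw [oneParam_zero, one_mul])
      refine (h4.comp (0 : ℝ) (hasMFDerivAt_mul_oneParam 1 (b i) 0)).congr_mfderiv ?_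
      ext
      have h5 : ∀ k : S, k = 1 → (show E from mulInvariantVectorField (b i) k) = b i := by
        rintro _ rfl
        have h6 := maurerCartan_mulInvariantVectorField (b i) (1 : S)
        have h7 : (fun x : S => (1 : S)⁻¹ * x) = id := by ext x; simp
        have h8 : mfderiv 𝓘(ℝ, E) 𝓘(ℝ, E) (fun x : S => (1 : S)⁻¹ * x) 1
          = ContinuousLinearMap.id ℝ E := by rw [h7]; exact mfderiv_id
        exact (DFunLike.congr_fun h8 _).symm.trans h6
      exact congrArg (fun v : E => (1 : ℝ) • v) (h5 _ (by rw [oneParam_zero, one_mul]))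
    have h9 : HasDerivAt (fun s : ℝ => e (oneParam (b i) s)) (show E from b i) 0 := by
      have h11 : HasFDerivAt (fun s : ℝ => e (1 * oneParam (b i) s))
        ((1 : ℝ →L[ℝ] ℝ).smulRight (show E from b i)) 0 := h3.hasFDerivAt
      have h12 := h11.hasDerivAt
      simp only [one_mul] at h12
      exact h12.congr_deriv (one_smul ℝ (show E from b i))
    have h10 : (fun s : ℝ => (e ∘ secondKind b) (Pi.single i s)) = fun s => e (oneParam (b i) s) := by
      ext s; simp [secondKind_single]
    rw [h10] at h1
    exact h1.unique h9
  have hsurj : (D : (Fin n → ℝ) →ₗ[ℝ] E).range = ⊤ := by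
    rw [LinearMap.range_eq_top]
    intro X
    obtain ⟨t, ht⟩ := hb X
    refine ⟨t, ?_⟩
    have h1 : t = ∑ i, t i • (Pi.single i (1 : ℝ) : Fin n → ℝ) := by
      ext j; simp [Finset.sum_apply, Pi.single_apply]
    change D t = X
    rw [h1, map_sum, ← ht]
    exact Finset.sum_congr rfl fun i _ => by rw [map_smul, hsingle i]; rfl
  -- A map with surjective strict derivative is open at the point, so a spanning family is enough.
  have hmap := hstrict.map_nhds_eq_of_surj hsurj
  rw [Function.comp_apply, h0] at hmap
  have hsrc : secondKind b ⁻¹' e.source ∈ 𝓝 (0 : Fin n → ℝ) := by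
    apply (contMDiff_secondKind b).continuous.continuousAt.preimage_mem_nhds
    rw [secondKind_zero]
    exact extChartAt_source_mem_nhds (1 : S)
  have himg := Filter.image_mem_map (m := e ∘ secondKind b) hsrc
  rw [hmap] at himg
  filter_upwards [(continuousAt_extChartAt (I := 𝓘(ℝ, E)) (1 : S)).preimage_mem_nhds himg,
    extChartAt_source_mem_nhds (I := 𝓘(ℝ, E)) (1 : S)] with g hg hg'
  obtain ⟨t, ht, hgt⟩ := hg
  exact ⟨t, e.injOn ht hg' hgt⟩

/-- A basis adapted to a subspace, indexed by some `Fin n`. -/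
theorem exists_adapted_family {V : Type*} [AddCommGroup V] [Module ℝ V] [FiniteDimensional ℝ V]
    (W : Submodule ℝ V) : ∃ (n : ℕ) (b : Fin n → V), (∀ X, ∃ t : Fin n → ℝ, ∑ i, t i • b i = X) ∧
      ∀ t : Fin n → ℝ, ∑ i, t i • b i ∈ W → ∀ i, t i • b i ∈ W := by
  obtain ⟨C, hC⟩ := W.exists_isCompl
  let bW := Module.finBasis ℝ W
  let bC := Module.finBasis ℝ C
  refine ⟨_, Fin.append (fun i => (bW i : V)) (fun i => (bC i : V)), fun X => ?_, fun t ht => ?_⟩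
  · obtain ⟨u, hu, v, hv, rfl⟩ := Submodule.mem_sup.1 (hC.sup_eq_top ▸ Submodule.mem_top : X ∈ W ⊔ C)
    refine ⟨Fin.append (fun i => bW.repr ⟨u, hu⟩ i) (fun i => bC.repr ⟨v, hv⟩ i), ?_⟩
    rw [Fin.sum_univ_add]
    simp only [Fin.append_left, Fin.append_right]
    congr 1
    · have := congrArg W.subtype (bW.sum_repr ⟨u, hu⟩)
      rw [map_sum] at this
      exact this
    · have := congrArg C.subtype (bC.sum_repr ⟨v, hv⟩)
      rw [map_sum] at this
      exact this
  · rw [Fin.sum_univ_add] at ht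
    simp only [Fin.append_left, Fin.append_right] at ht
    have h1 : ∑ i, t (Fin.castAdd _ i) • (bW i : V) ∈ W :=
      W.sum_mem fun i _ => W.smul_mem _ (bW i).2
    have h2 : ∑ i, t (Fin.natAdd _ i) • (bC i : V) ∈ C :=
      C.sum_mem fun i _ => C.smul_mem _ (bC i).2
    have h3 : ∑ i, t (Fin.natAdd _ i) • (bC i : V) = 0 :=
      Submodule.disjoint_def.1 hC.disjoint _ ((W.add_mem_iff_right h1).1 ht) h2
    have h4 : ∑ i, t (Fin.natAdd _ i) • bC i = 0 := by
      apply C.subtype_injective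
      simpa using h3
    have h5 := Fintype.linearIndependent_iff.1 bC.linearIndependent _ h4
    intro i
    refine Fin.addCases (fun j => ?_) (fun j => ?_) i
    · rw [Fin.append_left]; exact W.smul_mem _ (bW j).2
    · rw [h5 j, zero_smul]; exact W.zero_mem

end SecondKind

/-! ### The quotient of a simply connected group by an ideal containing the brackets -/

section Quotient

variable {E : Type*} [NormedAddCommGroup E] [NormedSpace ℝ E] [FiniteDimensional ℝ E]
  {S : Type*} [TopologicalSpace S] [ChartedSpace E S] [Group S] [LieGroup 𝓘(ℝ, E) ∞ S] [T2Space S]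

variable (E S) in
theorem finiteDimensional_groupLieAlgebra : FiniteDimensional ℝ (GroupLieAlgebra 𝓘(ℝ, E) S) :=
  inferInstanceAs (FiniteDimensional ℝ E)

/-- `P` is the homomorphism `S → 𝔰 ⧸ 𝔨` with derivative `𝔰 → 𝔰 ⧸ 𝔨` at `1`. -/
structure IsQuotientHom (𝔨 : Submodule ℝ (GroupLieAlgebra 𝓘(ℝ, E) S))
    (P : S → GroupLieAlgebra 𝓘(ℝ, E) S ⧸ 𝔨) : Prop where
  map_mul : ∀ g h, P (g * h) = P g + P h
  map_oneParam : ∀ X t, P (oneParam X t) = t • 𝔨.mkQ X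
  continuous : Continuous P
  contMDiff : ∀ l : Module.Dual ℝ (GroupLieAlgebra 𝓘(ℝ, E) S ⧸ 𝔨),
    ContMDiff 𝓘(ℝ, E) 𝓘(ℝ, ℝ) ∞ (fun g => l (P g))
  deriv : ∀ (l : Module.Dual ℝ (GroupLieAlgebra 𝓘(ℝ, E) S ⧸ 𝔨)) (g : S)
    (v : TangentSpace 𝓘(ℝ, E) g),
    directionalDeriv (fun g => l (P g)) g v = l (𝔨.mkQ (maurerCartan g v))

/-- Along `exp(tX)` the form has the constant value `lam X`, so the character is linear in `t`. -/
theorem character_oneParam {lam : GroupLieAlgebra 𝓘(ℝ, E) S →ₗ[ℝ] ℝ} {p : S → ℝ}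
    (hp : ContMDiff 𝓘(ℝ, E) 𝓘(ℝ, ℝ) ∞ p) (hmul : ∀ g h, p (g * h) = p g + p h)
    (hd : ∀ g v, directionalDeriv p g v = lam (maurerCartan g v))
    (X : GroupLieAlgebra 𝓘(ℝ, E) S) (t : ℝ) : p (oneParam X t) = t * lam X := by
  have hp1 : p 1 = 0 := by simpa using hmul 1 1
  have h : ∀ t, HasDerivAt (fun t => p (1 * oneParam X t) - t * lam X) 0 t := by
    intro t
    have h1 := hasDerivAt_comp_mul_oneParam 1 X t (hp.mdifferentiable (by simp) _)
    rw [hd, maurerCartan_mulInvariantVectorField] at h1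
    exact (h1.sub ((hasDerivAt_id' t).mul_const (lam X))).congr_deriv (by simp)
  have h2 := is_const_of_deriv_eq_zero (fun t => (h t).differentiableAt) (fun t => (h t).deriv) t 0
  simp only [one_mul, oneParam_zero, hp1, zero_mul, sub_zero] at h2
  exact sub_eq_zero.1 h2

/-- Each coordinate functional of a basis of `𝔰 ⧸ 𝔨` kills brackets and integrates to a character;
these characters are the coordinates of `P`. -/
theorem exists_isQuotientHom [SimplyConnectedSpace S]
    {𝔨 : Submodule ℝ (GroupLieAlgebra 𝓘(ℝ, E) S)}
    (h𝔨 : ∀ X Y : GroupLieAlgebra 𝓘(ℝ, E) S, ⁅X, Y⁆ ∈ 𝔨) : ∃ P, IsQuotientHom 𝔨 P := by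
  have := finiteDimensional_groupLieAlgebra E S
  let B := Module.finBasis ℝ (GroupLieAlgebra 𝓘(ℝ, E) S ⧸ 𝔨)
  have hex : ∀ i, ∃ p : S → ℝ, ContMDiff 𝓘(ℝ, E) 𝓘(ℝ, ℝ) ∞ p ∧ (∀ g h, p (g * h) = p g + p h) ∧
      ∀ g v, directionalDeriv p g v = (B.coord i ∘ₗ 𝔨.mkQ) (maurerCartan g v) := fun i =>
    exists_character fun X Y => by
      have h : 𝔨.mkQ ⁅X, Y⁆ = 0 := (Submodule.Quotient.mk_eq_zero 𝔨).2 (h𝔨 X Y)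
      rw [LinearMap.comp_apply, h, map_zero]
  choose p hp hmul hd using hex
  have hlP : ∀ l : Module.Dual ℝ (GroupLieAlgebra 𝓘(ℝ, E) S ⧸ 𝔨),
      ContMDiff 𝓘(ℝ, E) 𝓘(ℝ, ℝ) ∞ (fun g => l (∑ i, p i g • B i)) := by
    intro l
    have : (fun g => l (∑ i, p i g • B i)) = fun g => ∑ i, p i g * l (B i) := by
      ext g; simp
    rw [this]
    exact contMDiff_finsetSum fun i _ => (hp i).mul contMDiff_const
  have hone : ∀ X t, ∑ i, p i (oneParam X t) • B i = t • 𝔨.mkQ X := by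
    intro X t
    conv_rhs => rw [← B.sum_repr (𝔨.mkQ X)]
    rw [Finset.smul_sum]
    refine Finset.sum_congr rfl fun i _ => ?_
    rw [character_oneParam (hp i) (hmul i) (hd i), smul_smul]
    rfl
  have hmul' : ∀ g h, ∑ i, p i (g * h) • B i = ∑ i, p i g • B i + ∑ i, p i h • B i := by
    intro g h
    rw [← Finset.sum_add_distrib]
    exact Finset.sum_congr rfl fun i _ => by rw [hmul, add_smul]
  refine ⟨fun g => ∑ i, p i g • B i, hmul', hone, ?_, hlP, fun l g v => ?_⟩
  · exact continuous_finsetSum _ fun i _ => (hp i).continuous.smul continuous_const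
  · obtain ⟨X, rfl⟩ : ∃ X, v = mulInvariantVectorField X g :=
      ⟨_, (mulInvariantVectorField_maurerCartan g v).symm⟩
    rw [maurerCartan_mulInvariantVectorField]
    -- Along `g exp(tX)` the homomorphism property makes the function affine in `t`, which gives its
    -- derivative at `g`.
    have h1 := hasDerivAt_comp_mul_oneParam g X 0 ((hlP l).mdifferentiable (by simp) _)
    have h2 : ∀ k, k = g → directionalDeriv (fun g => l (∑ i, p i g • B i)) k
        (mulInvariantVectorField X k) = directionalDeriv (fun g => l (∑ i, p i g • B i)) g
        (mulInvariantVectorField X g) := by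
      rintro _ rfl; rfl
    rw [h2 _ (by rw [oneParam_zero, mul_one])] at h1
    refine h1.unique ?_
    simp only [hmul', hone, map_add, map_smul, smul_eq_mul]
    simpa using ((hasDerivAt_id' (0 : ℝ)).mul_const (l (𝔨.mkQ X))).const_add
      (l (∑ i, p i g • B i))

namespace IsQuotientHom

variable {𝔨 : Submodule ℝ (GroupLieAlgebra 𝓘(ℝ, E) S)} {P : S → GroupLieAlgebra 𝓘(ℝ, E) S ⧸ 𝔨}
  (hP : IsQuotientHom 𝔨 P)
include hP

theorem map_one : P 1 = 0 := by simpa using hP.map_mul 1 1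

theorem map_inv (g : S) : P g⁻¹ = -P g := by
  rw [eq_neg_iff_add_eq_zero, ← hP.map_mul, inv_mul_cancel, hP.map_one]

theorem map_lieExp (X : GroupLieAlgebra 𝓘(ℝ, E) S) : P (lieExp X) = 𝔨.mkQ X := by
  rw [lieExp_eq_oneParam, hP.map_oneParam, one_smul]

theorem map_eq_zero_of_mem {g : S} (hg : g ∈ connectedLieSubgroup 𝔨) : P g = 0 := by
  induction hg using Subgroup.closure_induction with
  | mem x hx =>
    obtain ⟨X, hX, rfl⟩ := hx
    rw [hP.map_lieExp]
    exact (Submodule.Quotient.mk_eq_zero 𝔨).2 hX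
  | one => exact hP.map_one
  | mul x y _ _ hx hy => rw [hP.map_mul, hx, hy, add_zero]
  | inv x _ hx => rw [hP.map_inv, hx, neg_zero]

/-- A continuous section of the quotient homomorphism, which retracts `S` to the kernel. -/
theorem exists_section : ∃ σ : GroupLieAlgebra 𝓘(ℝ, E) S ⧸ 𝔨 → S, Continuous σ ∧ σ 0 = 1 ∧
    (∀ v, P (σ v) = v) ∧ ∀ᶠ g in 𝓝 (1 : S), P g = 0 → g ∈ connectedLieSubgroup 𝔨 := by
  have := finiteDimensional_groupLieAlgebra E S
  obtain ⟨n, b, hb, hb𝔨⟩ := exists_adapted_family 𝔨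
  let T : (Fin n → ℝ) →ₗ[ℝ] GroupLieAlgebra 𝓘(ℝ, E) S ⧸ 𝔨 :=
    𝔨.mkQ ∘ₗ Fintype.linearCombination ℝ b
  have hT : Function.Surjective T := by
    intro v
    obtain ⟨X, rfl⟩ := 𝔨.mkQ_surjective v
    obtain ⟨t, rfl⟩ := hb X
    exact ⟨t, by simp [T, Fintype.linearCombination_apply]⟩
  obtain ⟨c, hc⟩ := T.exists_rightInverse_of_surjective (LinearMap.range_eq_top.2 hT)
  -- The quotient carries the quotient topology, so it suffices that the composite with `mkQ` is
  -- linear on a finite dimensional space.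
  have hc' : Continuous c := by
    have h2 : T2Space (GroupLieAlgebra 𝓘(ℝ, E) S) := inferInstanceAs (T2Space E)
    have h1 : Continuous (c ∘ₗ 𝔨.mkQ) := LinearMap.continuous_of_finiteDimensional _
    exact (Submodule.isQuotientMap_mkQ 𝔨).continuous_iff.2 h1
  have hPs : ∀ t, P (secondKind b t) = T t := by
    intro t
    rw [map_secondKind hP.map_mul hP.map_oneParam]
    rfl
  refine ⟨fun v => secondKind b (c v), (contMDiff_secondKind b).continuous.comp hc', ?_,
    fun v => ?_, ?_⟩
  · simp only [map_zero]; exact secondKind_zero b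
  · rw [hPs]; exact LinearMap.congr_fun hc v
  · filter_upwards [eventually_exists_secondKind hb] with g hg hPg
    obtain ⟨t, rfl⟩ := hg
    -- Adaptedness: if the whole sum lies in `𝔨` then so does each term, hence every factor of the
    -- product is in `exp 𝔨`.
    have h1 := hb𝔨 t ((Submodule.Quotient.mk_eq_zero 𝔨).1 ((hPs t).symm.trans hPg))
    refine secondKind_mem b t fun i => ?_
    rw [oneParam_eq_lieExp]
    exact Subgroup.subset_closure ⟨_, h1 i, rfl⟩

/-- The map `g ↦ g σ(P g)⁻¹` retracts the connected `S` onto `ker P`. Since elements of `ker P` near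
`1` lie in the subgroup `K`, its class modulo `K` is locally constant, hence trivial. -/
theorem mem_connectedLieSubgroup_iff [ConnectedSpace S] {g : S} :
    g ∈ connectedLieSubgroup 𝔨 ↔ P g = 0 := by
  refine ⟨hP.map_eq_zero_of_mem, fun hg => ?_⟩
  have := lieGroup_of_le_infty E S (n := 1)
  have : IsTopologicalGroup S := topologicalGroup_of_lieGroup 𝓘(ℝ, E) 1
  obtain ⟨σ, hσ, hσ0, hPσ, hnear⟩ := hP.exists_section
  set r : S → S := fun g => g * (σ (P g))⁻¹ with hr
  have hrc : Continuous r := continuous_id.mul (hσ.comp hP.continuous).inv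
  have hPr : ∀ g, P (r g) = 0 := fun g => by
    rw [hr, hP.map_mul, hP.map_inv, hPσ, add_neg_cancel]
  have hconst : IsLocallyConstant fun g => (r g : S ⧸ connectedLieSubgroup 𝔨) := by
    rw [IsLocallyConstant.iff_eventually_eq]
    intro g₀
    have h1 : Filter.Tendsto (fun g => (r g₀)⁻¹ * r g) (𝓝 g₀) (𝓝 1) := by
      have h2 : Continuous (fun g => (r g₀)⁻¹ * r g) := continuous_const.mul hrc
      simpa using h2.tendsto g₀
    filter_upwards [h1.eventually hnear] with g hg
    refine (QuotientGroup.eq.2 (hg ?_)).symm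
    rw [hP.map_mul, hP.map_inv, hPr, hPr, neg_zero, add_zero]
  -- The retraction fixes both `1` and `g`, since `P` vanishes on them.
  have h := hconst.apply_eq_of_preconnectedSpace 1 g
  simp only [hr, hg, hP.map_one, hσ0, inv_one, mul_one] at h
  have h3 := QuotientGroup.eq.1 h
  simpa using h3

theorem mk_eq_mk_iff [ConnectedSpace S] {g g' : S} :
    (g : S ⧸ connectedLieSubgroup 𝔨) = g' ↔ P g = P g' := by
  rw [QuotientGroup.eq, hP.mem_connectedLieSubgroup_iff, hP.map_mul, hP.map_inv,
    neg_add_eq_zero]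

/-- The section `σ` induces the homeomorphism and `P` induces its inverse; the agreement with `exp`
follows by applying `P`. -/
theorem exists_isVectorGroupExp [ConnectedSpace S] :
    ∃ e : (GroupLieAlgebra 𝓘(ℝ, E) S ⧸ 𝔨) ≃ₜ (S ⧸ connectedLieSubgroup 𝔨),
      IsVectorGroupExp 𝔨 e ∧ ∀ g : S, e.symm (g : S ⧸ connectedLieSubgroup 𝔨) = P g := by
  obtain ⟨σ, hσ, hσ0, hPσ, -⟩ := hP.exists_section
  let e : (GroupLieAlgebra 𝓘(ℝ, E) S ⧸ 𝔨) ≃ₜ (S ⧸ connectedLieSubgroup 𝔨) :=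
    { toFun := fun v => (σ v : S ⧸ connectedLieSubgroup 𝔨)
      invFun := Quotient.lift P fun g g' h => hP.mk_eq_mk_iff.1 (Quotient.sound h)
      left_inv := hPσ
      right_inv := by
        rintro ⟨g⟩
        exact hP.mk_eq_mk_iff.2 (hPσ (P g))
      continuous_toFun := continuous_quotient_mk'.comp hσ
      continuous_invFun := hP.continuous.quotient_lift _ }
  have he : ∀ g : S, e.symm (g : S ⧸ connectedLieSubgroup 𝔨) = P g := fun g => rfl
  have he' : ∀ v (g : S), e v = (g : S ⧸ connectedLieSubgroup 𝔨) ↔ v = P g := fun v g => by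
    rw [← he, Homeomorph.eq_symm_apply e]
  refine ⟨e, ⟨⟨fun n hn g => ?_⟩, fun X => ?_, fun v w g g' hv hw => ?_⟩, he⟩
  · rw [hP.mem_connectedLieSubgroup_iff] at hn ⊢
    rw [hP.map_mul, hP.map_mul, hn, hP.map_inv]
    abel
  · rw [he', hP.map_lieExp]
  · rw [he'] at hv hw ⊢
    rw [hP.map_mul, hv, hw]

end IsQuotientHom

end Quotient

/-! ### Left invariant distances -/

section InnerNorm

variable {E : Type*} [NormedAddCommGroup E] [NormedSpace ℝ E]
  {S : Type*} [TopologicalSpace S] [ChartedSpace E S] [Group S]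
  (c : InnerProductSpace.Core ℝ (GroupLieAlgebra 𝓘(ℝ, E) S))
  (𝔨 : Submodule ℝ (GroupLieAlgebra 𝓘(ℝ, E) S))

theorem innerNorm_nonneg (X : GroupLieAlgebra 𝓘(ℝ, E) S) : 0 ≤ innerNorm c X := Real.sqrt_nonneg _

theorem innerNorm_add_le (X Y : GroupLieAlgebra 𝓘(ℝ, E) S) :
    innerNorm c (X + Y) ≤ innerNorm c X + innerNorm c Y :=
  @norm_add_le _ (@InnerProductSpace.Core.toNormedAddCommGroup ℝ _ _ _ _
    c).toNormedAddGroup.toSeminormedAddGroup X Y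

theorem quotientNorm_le (X : GroupLieAlgebra 𝓘(ℝ, E) S) {Y : GroupLieAlgebra 𝓘(ℝ, E) S}
    (hY : Y ∈ 𝔨) : quotientNorm c 𝔨 X ≤ innerNorm c (X + Y) :=
  ciInf_le (f := fun Y : 𝔨 => innerNorm c (X + Y))
    ⟨0, by rintro _ ⟨Y, rfl⟩; exact innerNorm_nonneg c _⟩ ⟨Y, hY⟩

theorem exists_innerNorm_lt {X : GroupLieAlgebra 𝓘(ℝ, E) S} {r : ℝ} (h : quotientNorm c 𝔨 X < r) :
    ∃ Y ∈ 𝔨, innerNorm c (X + Y) < r := by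
  obtain ⟨Y, hY⟩ := exists_lt_of_ciInf_lt h
  exact ⟨Y, Y.2, hY⟩

theorem quotientNorm_nonneg (X : GroupLieAlgebra 𝓘(ℝ, E) S) : 0 ≤ quotientNorm c 𝔨 X :=
  le_ciInf fun _ => innerNorm_nonneg c _

theorem quotientNorm_le_innerNorm (X : GroupLieAlgebra 𝓘(ℝ, E) S) :
    quotientNorm c 𝔨 X ≤ innerNorm c X := by
  simpa using quotientNorm_le c 𝔨 X 𝔨.zero_mem

theorem quotientNorm_add_le (X Y : GroupLieAlgebra 𝓘(ℝ, E) S) :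
    quotientNorm c 𝔨 (X + Y) ≤ quotientNorm c 𝔨 X + quotientNorm c 𝔨 Y := by
  refine le_of_forall_pos_lt_add fun ε hε => ?_
  obtain ⟨X', hX', h1⟩ := exists_innerNorm_lt c 𝔨 (X := X) (lt_add_of_pos_right _ (half_pos hε))
  obtain ⟨Y', hY', h2⟩ := exists_innerNorm_lt c 𝔨 (X := Y) (lt_add_of_pos_right _ (half_pos hε))
  have h3 := quotientNorm_le c 𝔨 (X + Y) (𝔨.add_mem hX' hY')
  rw [add_add_add_comm] at h3
  have h4 := innerNorm_add_le c (X + X') (Y + Y')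
  linarith

theorem quotientNorm_of_mem {X : GroupLieAlgebra 𝓘(ℝ, E) S} (hX : X ∈ 𝔨) :
    quotientNorm c 𝔨 X = 0 := by
  refine le_antisymm ?_ (quotientNorm_nonneg c 𝔨 X)
  have h := quotientNorm_le c 𝔨 X (𝔨.neg_mem hX)
  rw [add_neg_cancel] at h
  have h0 := innerNorm_smul c 0 0
  rw [zero_smul, abs_zero, zero_mul] at h0
  exact h.trans h0.le

theorem quotientNorm_smul (r : ℝ) (X : GroupLieAlgebra 𝓘(ℝ, E) S) :
    quotientNorm c 𝔨 (r • X) = |r| * quotientNorm c 𝔨 X := by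
  have key : ∀ (r : ℝ) (X : GroupLieAlgebra 𝓘(ℝ, E) S),
      quotientNorm c 𝔨 (r • X) ≤ |r| * quotientNorm c 𝔨 X := by
    intro r X
    unfold quotientNorm
    rw [Real.mul_iInf_of_nonneg (abs_nonneg r)]
    refine le_ciInf fun Y => ?_
    rw [← innerNorm_smul, smul_add]
    exact quotientNorm_le c 𝔨 (r • X) (𝔨.smul_mem r Y.2)
  refine le_antisymm (key r X) ?_
  rcases eq_or_ne r 0 with rfl | hr
  · simp [quotientNorm_nonneg]
  · have h := key r⁻¹ (r • X)
    rw [smul_smul, inv_mul_cancel₀ hr, one_smul, abs_inv] at h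
    have hr' : 0 < |r| := abs_pos.2 hr
    calc |r| * quotientNorm c 𝔨 X ≤ |r| * (|r|⁻¹ * quotientNorm c 𝔨 (r • X)) := by gcongr
      _ = _ := by field_simp

theorem quotientNorm_congr {X Y : GroupLieAlgebra 𝓘(ℝ, E) S} (h : 𝔨.mkQ X = 𝔨.mkQ Y) :
    quotientNorm c 𝔨 X = quotientNorm c 𝔨 Y := by
  have key : ∀ {X Y : GroupLieAlgebra 𝓘(ℝ, E) S}, 𝔨.mkQ X = 𝔨.mkQ Y →
      quotientNorm c 𝔨 X ≤ quotientNorm c 𝔨 Y := by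
    intro X Y h
    have h1 := quotientNorm_add_le c 𝔨 Y (X - Y)
    rwa [add_sub_cancel, quotientNorm_of_mem c 𝔨 ((Submodule.Quotient.eq 𝔨).1 h), add_zero] at h1
  exact le_antisymm (key h) (key h.symm)

/-- A norming functional for the quotient norm. -/
theorem exists_dual_le_quotientNorm (X : GroupLieAlgebra 𝓘(ℝ, E) S) :
    ∃ l : Module.Dual ℝ (GroupLieAlgebra 𝓘(ℝ, E) S ⧸ 𝔨), l (𝔨.mkQ X) = quotientNorm c 𝔨 X ∧
      ∀ Y, |l (𝔨.mkQ Y)| ≤ quotientNorm c 𝔨 Y := by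
  obtain ⟨g, hg, hgX⟩ : ∃ g : GroupLieAlgebra 𝓘(ℝ, E) S →ₗ[ℝ] ℝ,
      (∀ Y, g Y ≤ quotientNorm c 𝔨 Y) ∧ g X = quotientNorm c 𝔨 X := by
    rcases eq_or_ne X 0 with rfl | hX
    · exact ⟨0, fun Y => quotientNorm_nonneg c 𝔨 Y,
        (quotientNorm_of_mem c 𝔨 𝔨.zero_mem).symm⟩
    · obtain ⟨g, h1, h2⟩ := exists_extension_of_le_sublinear
        (LinearPMap.mkSpanSingleton X (quotientNorm c 𝔨 X) hX) (quotientNorm c 𝔨)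
        (fun r hr Y => by rw [quotientNorm_smul, abs_of_pos hr]) (quotientNorm_add_le c 𝔨) (by
          rintro ⟨y, hy⟩
          obtain ⟨r, rfl⟩ := Submodule.mem_span_singleton.1 hy
          have h : LinearPMap.mkSpanSingleton (K := ℝ) X (quotientNorm c 𝔨 X) hX ⟨r • X, hy⟩
            = r • quotientNorm c 𝔨 X := LinearPMap.mkSpanSingleton'_apply X _ _ r hy
          rw [h, quotientNorm_smul, smul_eq_mul]
          exact mul_le_mul_of_nonneg_right (le_abs_self r) (quotientNorm_nonneg c 𝔨 X))
      refine ⟨g, h2, ?_⟩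
      have h3 := h1 ⟨X, Submodule.mem_span_singleton_self X⟩
      exact h3.trans (LinearPMap.mkSpanSingleton_apply ℝ ℝ hX _)
  have habs : ∀ Y, |g Y| ≤ quotientNorm c 𝔨 Y := by
    intro Y
    rw [abs_le]
    refine ⟨?_, hg Y⟩
    have h := hg ((-1 : ℝ) • Y)
    rw [quotientNorm_smul, abs_neg, abs_one, one_mul, map_smul, smul_eq_mul] at h
    linarith
  -- The quotient norm vanishes on `𝔨`, so a functional dominated by it descends to `𝔰 ⧸ 𝔨`.
  have hker : 𝔨 ≤ LinearMap.ker g := fun Y hY => by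
    have h := habs Y
    rw [quotientNorm_of_mem c 𝔨 hY] at h
    exact abs_nonpos_iff.1 h
  exact ⟨𝔨.liftQ g hker, hgX, habs⟩

end InnerNorm

/-! ### Lengths of paths and Lipschitz estimates -/

section LeftInvariant

variable {E : Type*} [NormedAddCommGroup E] [NormedSpace ℝ E]
  {S : Type*} [TopologicalSpace S] [ChartedSpace E S] [Group S]
  {N : GroupLieAlgebra 𝓘(ℝ, E) S → ℝ}

/-- The logarithmic derivative of a path in a Lie group. -/
def logarithmicDeriv (γ : ℝ → S) (t : ℝ) : GroupLieAlgebra 𝓘(ℝ, E) S :=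
  maurerCartan (γ t) (mfderiv 𝓘(ℝ, ℝ) 𝓘(ℝ, E) γ t (1 : ℝ))

theorem exists_path_of_leftInvariantEDist_lt {x y : S} {r : ℝ≥0∞}
    (h : leftInvariantEDist N x y < r) : ∃ γ : ℝ → S, γ 0 = x ∧ γ 1 = y ∧
      ContMDiffOn 𝓘(ℝ, ℝ) 𝓘(ℝ, E) 1 γ (Icc 0 1) ∧
      ∫⁻ t in Ioo (0 : ℝ) 1, ENNReal.ofReal (N (logarithmicDeriv γ t)) < r := by
  let _ : ∀ g : S, ENorm (TangentSpace 𝓘(ℝ, E) g) := leftInvariantENorm N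
  obtain ⟨γ, h0, h1, hγ, hl⟩ := Manifold.exists_lt_of_riemannianEDist_lt h
  rw [Manifold.pathELength_eq_lintegral_mfderiv_Ioo] at hl
  exact ⟨γ, h0, h1, hγ, hl⟩

theorem maurerCartan_smul (g : S) (r : ℝ) (v : TangentSpace 𝓘(ℝ, E) g) :
    maurerCartan g (r • v) = r • maurerCartan g v := by
  unfold maurerCartan
  exact map_smul _ r v

variable [IsManifold 𝓘(ℝ, E) 1 S]

theorem leftInvariantEDist_le_lintegral (hN : ∀ (r : ℝ) X, N (r • X) = |r| * N X) {γ : ℝ → S}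
    (hγ : ContMDiffOn 𝓘(ℝ, ℝ) 𝓘(ℝ, E) 1 γ (Icc 0 1)) :
    leftInvariantEDist N (γ 0) (γ 1)
      ≤ ∫⁻ t in Ioo (0 : ℝ) 1, ENNReal.ofReal (N (logarithmicDeriv γ t)) := by
  let _ : ∀ g : S, ENorm (TangentSpace 𝓘(ℝ, E) g) := leftInvariantENorm N
  have : ∀ g : S, ENormSMulClass ℝ (TangentSpace 𝓘(ℝ, E) g) := fun g => ⟨fun r v => by
    change ENNReal.ofReal (N (maurerCartan g (r • v)))
      = ‖r‖ₑ * ENNReal.ofReal (N (maurerCartan g v))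
    rw [maurerCartan_smul, hN, ENNReal.ofReal_mul (abs_nonneg r), Real.enorm_eq_ofReal_abs]⟩
  have h := Manifold.riemannianEDist_le_pathELength hγ rfl rfl zero_le_one
  rw [Manifold.pathELength_eq_lintegral_mfderiv_Ioo] at h
  exact h

/-- A bound `C` on the left trivialized derivative multiplies lengths of paths by at most `C`. Two
different norms are allowed so that `f = id` also compares distances. -/
theorem leftInvariantEDist_map_le {N' : GroupLieAlgebra 𝓘(ℝ, E) S → ℝ}
    (hN : ∀ (r : ℝ) X, N' (r • X) = |r| * N' X) {f : S → S}
    (hf : ContMDiff 𝓘(ℝ, E) 𝓘(ℝ, E) 1 f) {C : ℝ≥0} (hC0 : C ≠ 0)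
    (hC : ∀ g v, N' (maurerCartan (f g) (mfderiv 𝓘(ℝ, E) 𝓘(ℝ, E) f g v))
      ≤ C * N (maurerCartan g v)) (x y : S) :
    leftInvariantEDist N' (f x) (f y) ≤ C * leftInvariantEDist N x y := by
  have key : ∀ r, leftInvariantEDist N x y < r → leftInvariantEDist N' (f x) (f y) ≤ C * r := by
    intro r hr
    obtain ⟨γ, rfl, rfl, hγ, hl⟩ := exists_path_of_leftInvariantEDist_lt hr
    have h1 : ContMDiffOn 𝓘(ℝ, ℝ) 𝓘(ℝ, E) 1 (f ∘ γ) (Icc 0 1) := hf.comp_contMDiffOn hγ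
    refine (leftInvariantEDist_le_lintegral hN h1).trans ?_
    calc ∫⁻ t in Ioo (0 : ℝ) 1, ENNReal.ofReal (N' (logarithmicDeriv (f ∘ γ) t))
        ≤ ∫⁻ t in Ioo (0 : ℝ) 1, C * ENNReal.ofReal (N (logarithmicDeriv γ t)) := by
          refine MeasureTheory.setLIntegral_mono' measurableSet_Ioo fun t ht => ?_
          have hd : MDifferentiableAt 𝓘(ℝ, ℝ) 𝓘(ℝ, E) γ t :=
            (hγ.contMDiffAt (Icc_mem_nhds ht.1 ht.2)).mdifferentiableAt one_ne_zero
          have h2 : mfderiv 𝓘(ℝ, ℝ) 𝓘(ℝ, E) (f ∘ γ) t (1 : ℝ)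
              = mfderiv 𝓘(ℝ, E) 𝓘(ℝ, E) f (γ t) (mfderiv 𝓘(ℝ, ℝ) 𝓘(ℝ, E) γ t (1 : ℝ)) :=
            DFunLike.congr_fun (mfderiv_comp t (hf.mdifferentiable one_ne_zero _) hd) (1 : ℝ)
          have h3 := hC (γ t) (mfderiv 𝓘(ℝ, ℝ) 𝓘(ℝ, E) γ t (1 : ℝ))
          have h4 : logarithmicDeriv (f ∘ γ) t = maurerCartan (f (γ t))
            (mfderiv 𝓘(ℝ, E) 𝓘(ℝ, E) f (γ t) (mfderiv 𝓘(ℝ, ℝ) 𝓘(ℝ, E) γ t (1 : ℝ))) :=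
            congrArg (maurerCartan (f (γ t))) h2
          rw [h4]
          refine (ENNReal.ofReal_le_ofReal h3).trans ?_
          exact ((ENNReal.ofReal_mul (NNReal.coe_nonneg C)).trans (congrArg
            (· * ENNReal.ofReal (N (logarithmicDeriv γ t))) ENNReal.ofReal_coe_nnreal)).le
      _ = C * ∫⁻ t in Ioo (0 : ℝ) 1, ENNReal.ofReal (N (logarithmicDeriv γ t)) :=
          MeasureTheory.lintegral_const_mul' _ _ ENNReal.coe_ne_top
      _ ≤ C * r := by gcongr
  -- At infinite distance, `C ≠ 0` makes the bound infinite; otherwise `r` decreases to the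
  -- distance.
  rcases eq_or_ne (leftInvariantEDist N x y) ⊤ with htop | htop
  · rw [htop, ENNReal.mul_top (by exact_mod_cast hC0)]; exact le_top
  · have h : Filter.Tendsto (fun r : ℝ≥0∞ => C * r) (𝓝[>] (leftInvariantEDist N x y))
        (𝓝 (C * leftInvariantEDist N x y)) :=
      ((ENNReal.continuous_const_mul ENNReal.coe_ne_top).tendsto _).mono_left nhdsWithin_le_nhds
    have : (𝓝[>] (leftInvariantEDist N x y)).NeBot := nhdsGT_neBot_of_exists_gt ⟨⊤, htop.lt_top⟩
    refine ge_of_tendsto h ?_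
    filter_upwards [self_mem_nhdsWithin] with r hr using key r hr

theorem leftInvariantEDist_mono {N' : GroupLieAlgebra 𝓘(ℝ, E) S → ℝ}
    (hN : ∀ (r : ℝ) X, N' (r • X) = |r| * N' X)
    (h : ∀ X, N' X ≤ N X) (x y : S) : leftInvariantEDist N' x y ≤ leftInvariantEDist N x y := by
  refine (leftInvariantEDist_map_le (N := N) (N' := N') hN contMDiff_id
    one_ne_zero (fun g v => ?_) x y).trans (by simp)
  have h1 : mfderiv 𝓘(ℝ, E) 𝓘(ℝ, E) (id : S → S) g v = v := DFunLike.congr_fun mfderiv_id v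
  have h2 := h (maurerCartan g v)
  rw [NNReal.coe_one, one_mul]
  exact (congrArg (fun w => N' (maurerCartan g w)) h1).le.trans h2

/-- The path `g exp(tX)` has constant logarithmic derivative `X`, hence length `N X`. -/
theorem leftInvariantEDist_mul_lieExp_le [FiniteDimensional ℝ E] [LieGroup 𝓘(ℝ, E) ∞ S] [T2Space S]
    (hN : ∀ (r : ℝ) X, N (r • X) = |r| * N X) (g : S) (X : GroupLieAlgebra 𝓘(ℝ, E) S) :
    leftInvariantEDist N g (g * lieExp X) ≤ ENNReal.ofReal (N X) := by
  have h := leftInvariantEDist_le_lintegral hN (contMDiff_mul_oneParam g X).contMDiffOn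
  rw [oneParam_zero, mul_one, ← lieExp_eq_oneParam] at h
  refine h.trans_eq ?_
  have h1 : ∀ t, logarithmicDeriv (fun t => g * oneParam X t) t = X := by
    intro t
    have h2 := DFunLike.congr_fun (hasMFDerivAt_mul_oneParam g X t).mfderiv (1 : ℝ)
    have h3 : mfderiv 𝓘(ℝ, ℝ) 𝓘(ℝ, E) (fun t => g * oneParam X t) t (1 : ℝ)
        = mulInvariantVectorField X (g * oneParam X t) :=
      h2.trans (one_smul ℝ (mulInvariantVectorField X (g * oneParam X t)))
    exact (congrArg (maurerCartan (g * oneParam X t)) h3).trans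
      (maurerCartan_mulInvariantVectorField X _)
  simp [h1]

/-- A function whose derivative is dominated by the norm is `1`-Lipschitz. -/
theorem abs_sub_le_leftInvariantEDist {f : S → ℝ} (hf : ContMDiff 𝓘(ℝ, E) 𝓘(ℝ, ℝ) 1 f)
    (h : ∀ g v, |directionalDeriv f g v| ≤ N (maurerCartan g v)) (x y : S) :
    ENNReal.ofReal |f y - f x| ≤ leftInvariantEDist N x y := by
  refine le_of_forall_gt fun r hr => ?_
  obtain ⟨γ, rfl, rfl, hγ, hl⟩ := exists_path_of_leftInvariantEDist_lt hr
  refine lt_of_le_of_lt ?_ hl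
  have h1 : ContDiffOn ℝ 1 (f ∘ γ) (Icc 0 1) := (hf.comp_contMDiffOn hγ).contDiffOn
  have h2 := enorm_sub_le_lintegral_deriv_of_contDiffOn_Icc h1 zero_le_one
  rw [← MeasureTheory.restrict_Ioo_eq_restrict_Icc, Real.enorm_eq_ofReal_abs] at h2
  refine h2.trans (MeasureTheory.setLIntegral_mono' measurableSet_Ioo fun t ht => ?_)
  have hd : MDifferentiableAt 𝓘(ℝ, ℝ) 𝓘(ℝ, E) γ t :=
    (hγ.contMDiffAt (Icc_mem_nhds ht.1 ht.2)).mdifferentiableAt one_ne_zero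
  have h3 : deriv (f ∘ γ) t = directionalDeriv f (γ t) (mfderiv 𝓘(ℝ, ℝ) 𝓘(ℝ, E) γ t (1 : ℝ)) := by
    rw [← fderiv_apply_one_eq_deriv, ← mfderiv_eq_fderiv]
    exact DFunLike.congr_fun (mfderiv_comp t (hf.mdifferentiable one_ne_zero _) hd) (1 : ℝ)
  rw [h3, Real.enorm_eq_ofReal_abs]
  exact ENNReal.ofReal_le_ofReal (h _ _)

end LeftInvariant

/-! ### Distances between fibers of the quotient map -/

namespace IsQuotientHom

variable {E : Type*} [NormedAddCommGroup E] [NormedSpace ℝ E] [FiniteDimensional ℝ E]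
  {S : Type*} [TopologicalSpace S] [ChartedSpace E S] [Group S] [LieGroup 𝓘(ℝ, E) ∞ S] [T2Space S]
  {𝔨 : Submodule ℝ (GroupLieAlgebra 𝓘(ℝ, E) S)} {P : S → GroupLieAlgebra 𝓘(ℝ, E) S ⧸ 𝔨}
  (hP : IsQuotientHom 𝔨 P) (c : InnerProductSpace.Core ℝ (GroupLieAlgebra 𝓘(ℝ, E) S))
include hP

/-- Composing `P` with a norming functional for `X` gives a `1`-Lipschitz function whose values at
`g` and `g'` differ by the norm of `X`. -/
theorem quotientNorm_le_leftInvariantEDist {g g' : S} {X : GroupLieAlgebra 𝓘(ℝ, E) S}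
    (h : P g' = P g + 𝔨.mkQ X) :
    ENNReal.ofReal (quotientNorm c 𝔨 X) ≤ leftInvariantEDist (quotientNorm c 𝔨) g g' := by
  obtain ⟨l, hl, hl'⟩ := exists_dual_le_quotientNorm c 𝔨 X
  have h1 := abs_sub_le_leftInvariantEDist (N := quotientNorm c 𝔨)
    ((hP.contMDiff l).of_le (by simp)) (fun g v => by rw [hP.deriv]; exact hl' _) g g'
  rwa [h, map_add, add_sub_cancel_left, hl, abs_of_nonneg (quotientNorm_nonneg c 𝔨 X)] at h1

theorem quotientNorm_le_edist {g g' : S} {X : GroupLieAlgebra 𝓘(ℝ, E) S}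
    (h : P g' = P g + 𝔨.mkQ X) :
    ENNReal.ofReal (quotientNorm c 𝔨 X) ≤ leftInvariantEDist (innerNorm c) g g' := by
  have := isManifold_of_lieGroup E S 1
  exact (hP.quotientNorm_le_leftInvariantEDist c h).trans
    (leftInvariantEDist_mono (quotientNorm_smul c 𝔨) (quotientNorm_le_innerNorm c 𝔨) g g')

/-- Moving from `g` along `exp(X + Y)`, with `Y ∈ 𝔨` almost minimizing the norm of `X + Y`, reaches
the required fiber at almost the quotient norm. -/
theorem exists_edist_lt (g : S) (X : GroupLieAlgebra 𝓘(ℝ, E) S) {r : ℝ}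
    (hr : quotientNorm c 𝔨 X < r) : ∃ g', P g' = P g + 𝔨.mkQ X ∧
      leftInvariantEDist (innerNorm c) g g' < ENNReal.ofReal r := by
  have := isManifold_of_lieGroup E S 1
  obtain ⟨Y, hY, hlt⟩ := exists_innerNorm_lt c 𝔨 hr
  refine ⟨g * lieExp (X + Y), ?_, ?_⟩
  · have h0 : 𝔨.mkQ Y = 0 := (Submodule.Quotient.mk_eq_zero 𝔨).2 hY
    rw [hP.map_mul, hP.map_lieExp, map_add, h0, add_zero]
  · refine (leftInvariantEDist_mul_lieExp_le (innerNorm_smul c) g (X + Y)).trans_lt ?_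
    exact (ENNReal.ofReal_lt_ofReal_iff ((innerNorm_nonneg c _).trans_lt hlt)).2 hlt

variable [ConnectedSpace S]

theorem quotientEDist_eq {g g' : S} {X : GroupLieAlgebra 𝓘(ℝ, E) S} (h : P g' = P g + 𝔨.mkQ X) :
    (quotientEDist c 𝔨).edist (g : S ⧸ connectedLieSubgroup 𝔨) g'
      = ENNReal.ofReal (quotientNorm c 𝔨 X) := by
  have := isManifold_of_lieGroup E S 1
  apply le_antisymm
  · refine ENNReal.le_of_forall_pos_le_add fun ε hε _ => ?_
    obtain ⟨k, hk, hlt⟩ := hP.exists_edist_lt c g X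
      (lt_add_of_pos_right (quotientNorm c 𝔨 X) (NNReal.coe_pos.2 hε))
    have hle : (quotientEDist c 𝔨).edist (g : S ⧸ connectedLieSubgroup 𝔨) g'
        ≤ leftInvariantEDist (quotientNorm c 𝔨) g k :=
      iInf₂_le_of_le g rfl (iInf₂_le k (hP.mk_eq_mk_iff.2 (hk.trans h.symm)))
    refine hle.trans ((leftInvariantEDist_mono (quotientNorm_smul c 𝔨)
      (quotientNorm_le_innerNorm c 𝔨) g k).trans (hlt.le.trans ?_))
    rw [ENNReal.ofReal_add (quotientNorm_nonneg c 𝔨 X) ε.coe_nonneg, ENNReal.ofReal_coe_nnreal]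
  · refine le_iInf₂ fun k hk => le_iInf₂ fun k' hk' => ?_
    refine hP.quotientNorm_le_leftInvariantEDist c ?_
    rw [hP.mk_eq_mk_iff.1 hk, hP.mk_eq_mk_iff.1 hk', h]

/-- Every point of either fiber lies at infimum distance exactly the quotient norm of `X` from the
other fiber, so the infimum and the Hausdorff distance coincide. -/
theorem isDistanceRespectingProjection [IsManifold 𝓘(ℝ, E) 1 S] :
    @IsDistanceRespectingProjection S (S ⧸ connectedLieSubgroup 𝔨) (leftInvariantMetric c)
      (quotientEDist c 𝔨) (fun s => (s : S ⧸ connectedLieSubgroup 𝔨)) := by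
  let _ := leftInvariantMetric (E := E) (S := S) c
  refine ⟨Quotient.mk_surjective, ?_⟩
  rintro ⟨g⟩ ⟨g'⟩
  obtain ⟨X, hX⟩ : ∃ X, P g' = P g + 𝔨.mkQ X := by
    obtain ⟨X, hX⟩ := 𝔨.mkQ_surjective (P g' - P g)
    exact ⟨X, by rw [hX, add_sub_cancel]⟩
  have hedist : (quotientEDist c 𝔨).edist (g : S ⧸ connectedLieSubgroup 𝔨) g'
      = ENNReal.ofReal (quotientNorm c 𝔨 X) := hP.quotientEDist_eq c hX
  have hpre : ∀ k g : S, k ∈ (fun s : S => (s : S ⧸ connectedLieSubgroup 𝔨)) ⁻¹' {(g : S ⧸ connectedLieSubgroup 𝔨)}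
      ↔ P k = P g := fun k g => hP.mk_eq_mk_iff
  have hnear : ∀ (g g' : S) (X : GroupLieAlgebra 𝓘(ℝ, E) S), P g' = P g + 𝔨.mkQ X →
      Metric.infEDist g ((fun s : S => (s : S ⧸ connectedLieSubgroup 𝔨)) ⁻¹'
        {(g' : S ⧸ connectedLieSubgroup 𝔨)}) ≤ ENNReal.ofReal (quotientNorm c 𝔨 X) := by
    intro g g' X hX
    refine ENNReal.le_of_forall_pos_le_add fun ε hε _ => ?_
    obtain ⟨k, hk, hlt⟩ := hP.exists_edist_lt c g X
      (lt_add_of_pos_right (quotientNorm c 𝔨 X) (NNReal.coe_pos.2 hε))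
    refine (Metric.infEDist_le_edist_of_mem ((hpre k g').2 (hk.trans hX.symm))).trans
      (hlt.le.trans ?_)
    rw [ENNReal.ofReal_add (quotientNorm_nonneg c 𝔨 X) ε.coe_nonneg, ENNReal.ofReal_coe_nnreal]
  have hfar : ∀ x y : S, P x = P g → P y = P g' →
      ENNReal.ofReal (quotientNorm c 𝔨 X) ≤ edist x y := fun x y hx hy =>
    hP.quotientNorm_le_edist c (by rw [hx, hy, hX])
  have hXneg : quotientNorm c 𝔨 (-X) = quotientNorm c 𝔨 X := by
    have h := quotientNorm_smul c 𝔨 (-1) X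
    rwa [neg_smul, one_smul, abs_neg, abs_one, one_mul] at h
  constructor
  · refine hedist.trans (le_antisymm ?_ ?_)
    · exact le_iInf₂ fun x hx => le_iInf₂ fun y hy => hfar x y ((hpre x g).1 hx) ((hpre y g').1 hy)
    · exact iInf₂_le_of_le g ((hpre g g).2 rfl) (hnear g g' X hX)
  · refine hedist.trans (le_antisymm ?_ ?_)
    · refine le_trans ?_ (Metric.infEDist_le_hausdorffEDist_of_mem ((hpre g g).2 rfl))
      exact Metric.le_infEDist.2 fun y hy => hfar g y rfl ((hpre y g').1 hy)
    · refine Metric.hausdorffEDist_le_of_infEDist (fun x hx => ?_) fun y hy => ?_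
      · exact hnear x g' X (by rw [hX, (hpre x g).1 hx])
      · rw [← hXneg]
        exact hnear y g (-X) (by rw [(hpre y g').1 hy, hX, map_neg, add_neg_cancel_right])

end IsQuotientHom

/-- A family in `𝔰 ⧸ 𝔨` whose coordinates are bounded is bounded for the quotient norm. -/
theorem exists_quotientNorm_le {E : Type*} [NormedAddCommGroup E] [NormedSpace ℝ E]
    [FiniteDimensional ℝ E] {S : Type*} [TopologicalSpace S] [ChartedSpace E S] [Group S]
    (c : InnerProductSpace.Core ℝ (GroupLieAlgebra 𝓘(ℝ, E) S))
    (𝔨 : Submodule ℝ (GroupLieAlgebra 𝓘(ℝ, E) S)) {ι : Type*}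
    {f : ι → GroupLieAlgebra 𝓘(ℝ, E) S ⧸ 𝔨}
    (hf : ∀ l : Module.Dual ℝ (GroupLieAlgebra 𝓘(ℝ, E) S ⧸ 𝔨), ∃ C, ∀ i, |l (f i)| ≤ C) :
    ∃ C, ∀ i X, 𝔨.mkQ X = f i → quotientNorm c 𝔨 X ≤ C := by
  have : FiniteDimensional ℝ (GroupLieAlgebra 𝓘(ℝ, E) S) := inferInstanceAs (FiniteDimensional ℝ E)
  let B := Module.finBasis ℝ (GroupLieAlgebra 𝓘(ℝ, E) S ⧸ 𝔨)
  choose C hC using fun j => hf (B.coord j)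
  choose Y hY using fun j => 𝔨.mkQ_surjective (B j)
  have hsum : ∀ (s : Finset _) (r : _ → ℝ), quotientNorm c 𝔨 (∑ j ∈ s, r j • Y j)
      ≤ ∑ j ∈ s, |r j| * quotientNorm c 𝔨 (Y j) := by
    intro s r
    refine (Finset.le_sum_of_subadditive _ (quotientNorm_of_mem c 𝔨 𝔨.zero_mem).le
      (quotientNorm_add_le c 𝔨) s _).trans_eq ?_
    exact Finset.sum_congr rfl fun j _ => quotientNorm_smul c 𝔨 _ _
  refine ⟨∑ j, C j * quotientNorm c 𝔨 (Y j), fun i X hX => ?_⟩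
  have h : 𝔨.mkQ X = 𝔨.mkQ (∑ j, B.coord j (f i) • Y j) := by
    rw [map_sum, hX]
    simp only [map_smul, hY]
    exact (B.sum_repr (f i)).symm
  rw [quotientNorm_congr c 𝔨 h]
  refine (hsum _ _).trans (Finset.sum_le_sum fun j _ => ?_)
  exact mul_le_mul_of_nonneg_right (hC j i) (quotientNorm_nonneg c 𝔨 _)

/-! ### Locally free actions -/

section ActionBasics

variable {E F S M : Type*}
  [NormedAddCommGroup E] [NormedSpace ℝ E]
  [NormedAddCommGroup F] [NormedSpace ℝ F]
  [TopologicalSpace S] [ChartedSpace E S] [Group S] [LieGroup 𝓘(ℝ, E) ∞ S]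
  [TopologicalSpace M] [ChartedSpace F M]

namespace LocallyFreeAction

variable (ρ : LocallyFreeAction E F S M)

theorem contMDiff_act (x : M) : ContMDiff 𝓘(ℝ, E) 𝓘(ℝ, F) ∞ (ρ.act x) :=
  ρ.smooth.comp (contMDiff_const.prodMk contMDiff_id)

theorem contMDiff_act_left (s : S) : ContMDiff 𝓘(ℝ, F) 𝓘(ℝ, F) ∞ (fun x => ρ.act x s) :=
  ρ.smooth.comp (contMDiff_id.prodMk contMDiff_const)

theorem mdifferentiable_act (x : M) : MDifferentiable 𝓘(ℝ, E) 𝓘(ℝ, F) (ρ.act x) :=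
  (ρ.contMDiff_act x).mdifferentiable (by simp)

theorem act_inv_act (x : M) (s : S) : ρ.act (ρ.act x s) s⁻¹ = x := by
  rw [← ρ.act_mul, mul_inv_cancel, ρ.act_one]

/-- The isotropy group of a point. -/
def isotropy (x : M) : Subgroup S where
  carrier := {s | ρ.act x s = x}
  one_mem' := ρ.act_one x
  mul_mem' {a b} ha hb := by
    change ρ.act x (a * b) = x
    rw [ρ.act_mul, ha, hb]
  inv_mem' {a} ha := by
    change ρ.act x a⁻¹ = x
    conv_lhs => rw [← show ρ.act x a = x from ha]
    exact ρ.act_inv_act x a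

theorem mem_isotropy {x : M} {s : S} : s ∈ ρ.isotropy x ↔ ρ.act x s = x := Iff.rfl

theorem act_eq_act_iff {x : M} {s t : S} : ρ.act x s = ρ.act x t ↔ s * t⁻¹ ∈ ρ.isotropy x := by
  rw [mem_isotropy, ρ.act_mul]
  constructor
  · intro h; rw [h, act_inv_act]
  · intro h
    conv_rhs => rw [← h]
    rw [← ρ.act_mul, inv_mul_cancel, ρ.act_one]

/-- Differentiate `ρ(x, s) = ρ(ρ(x, g), g⁻¹ s)` at `s = g`. -/
theorem mfderiv_act (x : M) (g : S) (v : TangentSpace 𝓘(ℝ, E) g) :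
    mfderiv 𝓘(ℝ, E) 𝓘(ℝ, F) (ρ.act x) g v = ρ.field (ρ.act x g) (maurerCartan g v) := by
  have h1 : ρ.act x = ρ.act (ρ.act x g) ∘ fun s => g⁻¹ * s := by
    ext s
    rw [Function.comp_apply, ← ρ.act_mul, mul_inv_cancel_left]
  have h2 : HasMFDerivAt 𝓘(ℝ, E) 𝓘(ℝ, F) (ρ.act (ρ.act x g)) (g⁻¹ * g)
      (show E →L[ℝ] F from mfderiv 𝓘(ℝ, E) 𝓘(ℝ, F) (ρ.act (ρ.act x g)) 1) := by
    have : ∀ k : S, k = 1 → HasMFDerivAt 𝓘(ℝ, E) 𝓘(ℝ, F) (ρ.act (ρ.act x g)) k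
        (show E →L[ℝ] F from mfderiv 𝓘(ℝ, E) 𝓘(ℝ, F) (ρ.act (ρ.act x g)) 1) := by
      rintro _ rfl
      exact (ρ.mdifferentiable_act _ _).hasMFDerivAt
    exact this _ (inv_mul_cancel g)
  have h3 := h2.comp g (mdifferentiable_mul_left_self g⁻¹ g).hasMFDerivAt
  have h4 := DFunLike.congr_fun (h3.congr_of_eventuallyEq
    (Filter.Eventually.of_forall fun s => congrFun h1 s)).mfderiv v
  exact h4

theorem directionalDeriv_comp_act {f : M → ℝ} (x : M) (g : S) (v : TangentSpace 𝓘(ℝ, E) g)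
    (hf : MDifferentiableAt 𝓘(ℝ, F) 𝓘(ℝ, ℝ) f (ρ.act x g)) :
    directionalDeriv (fun s => f (ρ.act x s)) g v
      = directionalDeriv f (ρ.act x g) (ρ.field (ρ.act x g) (maurerCartan g v)) := by
  have h := DFunLike.congr_fun (mfderiv_comp g hf (ρ.mdifferentiable_act x g)) v
  exact h.trans (congrArg (mfderiv 𝓘(ℝ, F) 𝓘(ℝ, ℝ) f (ρ.act x g)) (ρ.mfderiv_act x g v))

variable [FiniteDimensional ℝ E] [T2Space S] [IsManifold 𝓘(ℝ, F) ∞ M]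

/-- The curve `ρ(x, exp tX)` near time `s` is its germ at time `0` moved by the smooth map `ρ(·, exp
sX)`. Zero velocity at `0` thus gives zero velocity always. -/
theorem act_oneParam_eq {x : M} {X : GroupLieAlgebra 𝓘(ℝ, E) S} (hX : ρ.field x X = 0) (t : ℝ) :
    ρ.act x (oneParam X t) = ρ.act x (oneParam X 0) := by
  have := IsManifold.of_le (I := 𝓘(ℝ, F)) (M := M) (m := 1) (n := ∞) (by simp)
  have h0 : HasMFDerivAt 𝓘(ℝ, ℝ) 𝓘(ℝ, F) (fun t => ρ.act x (oneParam X t)) 0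
      (0 : ℝ →L[ℝ] F) := by
    have h1 : HasMFDerivAt 𝓘(ℝ, ℝ) 𝓘(ℝ, F) (fun t => ρ.act x (1 * oneParam X t)) 0
      (0 : ℝ →L[ℝ] F) := by
      refine ((ρ.mdifferentiable_act x _).hasMFDerivAt.comp (0 : ℝ)
        (hasMFDerivAt_mul_oneParam 1 X 0)).congr_mfderiv ?_
      ext
      change mfderiv 𝓘(ℝ, E) 𝓘(ℝ, F) (ρ.act x) (1 * oneParam X 0)
        ((1 : ℝ) • mulInvariantVectorField X (1 * oneParam X 0)) = 0
      rw [one_smul]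
      refine (ρ.mfderiv_act x _ _).trans ?_
      rw [maurerCartan_mulInvariantVectorField]
      have : ∀ y : M, y = x → (show F from ρ.field y X) = 0 := by
        rintro _ rfl; exact hX
      exact this _ (by rw [oneParam_zero, one_mul, ρ.act_one])
    exact h1.congr_of_eventuallyEq (Filter.Eventually.of_forall fun t => by
      change ρ.act x (oneParam X t) = ρ.act x (1 * oneParam X t); rw [one_mul])
  have hs : ∀ s, HasMFDerivAt 𝓘(ℝ, ℝ) 𝓘(ℝ, F) (fun t => ρ.act x (oneParam X t)) s
      (0 : ℝ →L[ℝ] F) := by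
    intro s
    have h1 : (fun t => ρ.act x (oneParam X t)) = (fun y => ρ.act y (oneParam X s)) ∘
        (fun t => ρ.act x (oneParam X t)) ∘ fun t => t - s := by
      ext t
      simp only [Function.comp_apply]
      rw [← ρ.act_mul, ← oneParam_add, sub_add_cancel]
    have h2 : HasMFDerivAt 𝓘(ℝ, ℝ) 𝓘(ℝ, ℝ) (fun t : ℝ => t - s) s
        (ContinuousLinearMap.id ℝ ℝ) :=
      ((hasFDerivAt_id s).sub_const s).hasMFDerivAt
    have h3 : HasMFDerivAt 𝓘(ℝ, ℝ) 𝓘(ℝ, F) (fun t => ρ.act x (oneParam X t)) (s - s)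
        (0 : ℝ →L[ℝ] F) := by rw [sub_self]; exact h0
    have h4 := HasMFDerivAt.comp (f := fun t : ℝ => t - s) s
      (((ρ.contMDiff_act_left (oneParam X s)).mdifferentiable (by simp) _).hasMFDerivAt.comp _ h3) h2
    refine (h4.congr_of_eventuallyEq
      (Filter.Eventually.of_forall fun s => congrFun h1 s)).congr_mfderiv ?_
    ext
    exact map_zero (mfderiv 𝓘(ℝ, F) 𝓘(ℝ, F) (fun y => ρ.act y (oneParam X s)) _)
  exact eq_of_mfderiv_eq_zero (fun s => (hs s).mdifferentiableAt) (fun s => (hs s).mfderiv) t 0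

/-- If `X` induces the zero vector at `x`, then `exp(tX)` stays in the discrete isotropy group. It
is then constantly `1`, and `X = 0`. -/
theorem field_injective (x : M) : Function.Injective (ρ.field x) := by
  rw [injective_iff_map_eq_zero]
  intro X hX
  have := ρ.locallyFree x
  let f : ℝ → {s : S | ρ.act x s = x} := fun t => ⟨oneParam X t, by
    rw [mem_ofPred_eq, ρ.act_oneParam_eq hX, oneParam_zero, ρ.act_one]⟩
  have hf : Continuous f := (continuous_oneParam X).subtype_mk _
  have hc : ∀ t, oneParam X t = 1 := fun t => by
    have h : f t = f 0 := PreconnectedSpace.constant inferInstance hf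
    rw [← oneParam_zero X]
    exact congrArg Subtype.val h
  have h1 : HasMFDerivAt 𝓘(ℝ, ℝ) 𝓘(ℝ, E) (fun t => 1 * oneParam X t) 0
      (0 : ℝ →L[ℝ] E) :=
    (hasMFDerivAt_const (1 : S) (0 : ℝ)).congr_of_eventuallyEq
      (Filter.Eventually.of_forall fun t => by
        change 1 * oneParam X t = 1; rw [one_mul, hc])
  have h2 := DFunLike.congr_fun
    ((hasMFDerivAt_mul_oneParam 1 X 0).mfderiv.symm.trans h1.mfderiv) (1 : ℝ)
  have h3 : mulInvariantVectorField X (1 * oneParam X 0) = 0 :=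
    (one_smul ℝ (mulInvariantVectorField X (1 * oneParam X 0))).symm.trans h2
  rw [← maurerCartan_mulInvariantVectorField X (1 * oneParam X 0), h3]
  have h4 := maurerCartan_smul (1 * oneParam X 0) 0 (0 : TangentSpace 𝓘(ℝ, E) (1 * oneParam X 0))
  rwa [zero_smul, zero_smul] at h4

end LocallyFreeAction

end ActionBasics

/-! ### Flow boxes -/

theorem hasMFDerivAt_extChartAt_symm_self {E M : Type*} [NormedAddCommGroup E] [NormedSpace ℝ E]
    [TopologicalSpace M] [ChartedSpace E M] [IsManifold 𝓘(ℝ, E) ∞ M] (x : M) :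
    HasMFDerivAt 𝓘(ℝ, E) 𝓘(ℝ, E) (extChartAt 𝓘(ℝ, E) x).symm (extChartAt 𝓘(ℝ, E) x x)
      (ContinuousLinearMap.id ℝ E) := by
  have h1 : HasMFDerivAt 𝓘(ℝ, E) 𝓘(ℝ, E) (extChartAt 𝓘(ℝ, E) x).symm (extChartAt 𝓘(ℝ, E) x x)
      (show E →L[ℝ] E from mfderiv 𝓘(ℝ, E) 𝓘(ℝ, E) (extChartAt 𝓘(ℝ, E) x).symm
        (extChartAt 𝓘(ℝ, E) x x)) :=
    ((contMDiffAt_extChartAt_symm_self (n := ⊤)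
      (mem_extChartAt_target x)).mdifferentiableAt (by simp)).hasMFDerivAt
  have h2 : HasMFDerivAt 𝓘(ℝ, E) 𝓘(ℝ, E) (extChartAt 𝓘(ℝ, E) x)
      ((extChartAt 𝓘(ℝ, E) x).symm (extChartAt 𝓘(ℝ, E) x x)) (ContinuousLinearMap.id ℝ E) := by
    have : ∀ k, k = x → HasMFDerivAt 𝓘(ℝ, E) 𝓘(ℝ, E) (extChartAt 𝓘(ℝ, E) x) k
        (ContinuousLinearMap.id ℝ E) := by
      rintro _ rfl
      exact hasMFDerivAt_extChartAt_self _
    exact this _ (extChartAt_to_inv x)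
  have h3 := h2.comp _ h1
  have h4 : HasMFDerivAt 𝓘(ℝ, E) 𝓘(ℝ, E) (extChartAt 𝓘(ℝ, E) x ∘ (extChartAt 𝓘(ℝ, E) x).symm)
      (extChartAt 𝓘(ℝ, E) x x) (ContinuousLinearMap.id ℝ E) := by
    refine (hasMFDerivAt_id (extChartAt 𝓘(ℝ, E) x x)).congr_of_eventuallyEq ?_
    filter_upwards [extChartAt_target_mem_nhds (I := 𝓘(ℝ, E)) x] with u hu
    exact (extChartAt 𝓘(ℝ, E) x).right_inv hu
  refine h1.congr_mfderiv ?_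
  ext v
  exact DFunLike.congr_fun (h3.mfderiv.symm.trans h4.mfderiv) v

section FlowBox

variable {E F S M : Type*}
  [NormedAddCommGroup E] [NormedSpace ℝ E] [FiniteDimensional ℝ E]
  [NormedAddCommGroup F] [NormedSpace ℝ F] [FiniteDimensional ℝ F]
  [TopologicalSpace S] [ChartedSpace E S] [Group S] [LieGroup 𝓘(ℝ, E) ∞ S] [T2Space S]
  [TopologicalSpace M] [ChartedSpace F M] [IsManifold 𝓘(ℝ, F) ∞ M]

/-- Around each point there are a transverse coordinate `t`, constant on plaques, and a coordinate
`d` along the orbits with values in the group. -/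
theorem LocallyFreeAction.exists_flowBox (ρ : LocallyFreeAction E F S M) (x₀ : M) :
    ∃ (t : M → F) (d : M → S) (τ : F → M) (U : Set M), IsOpen U ∧ x₀ ∈ U ∧ ContinuousOn t U ∧
      ContinuousOn d U ∧ ContMDiffAt 𝓘(ℝ, F) 𝓘(ℝ, E) ∞ d x₀ ∧
      (∀ y ∈ U, ρ.act (τ (t y)) (d y) = y) ∧
      ∀ y ∈ U, ∀ᶠ s in 𝓝 (1 : S), t (ρ.act y s) = t y := by
  have := isManifold_of_lieGroup E S ⊤
  have := lieGroup_of_le_infty E S (n := 1)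
  have : IsTopologicalGroup S := topologicalGroup_of_lieGroup 𝓘(ℝ, E) 1
  set φ := extChartAt 𝓘(ℝ, F) x₀ with hφ
  set ψ := extChartAt 𝓘(ℝ, E) (1 : S) with hψ
  let D : E →L[ℝ] F := mfderiv 𝓘(ℝ, E) 𝓘(ℝ, F) (ρ.act x₀) 1
  have hD : Function.Injective D := ρ.field_injective x₀
  -- `C` is a transversal to the orbit at `x₀`; its directions will be the plaque coordinates.
  obtain ⟨C, hC⟩ := (LinearMap.range (D : E →ₗ[ℝ] F)).exists_isCompl
  let L₀ : (C × E) →L[ℝ] F := (C.subtypeL).coprod D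
  have hL₀ : Function.Bijective L₀ := by
    constructor
    · rw [injective_iff_map_eq_zero]
      rintro ⟨w, e⟩ h
      have h1 : (w : F) + D e = 0 := h
      have h2 : (w : F) = 0 := by
        refine Submodule.disjoint_def.1 hC.disjoint _ ?_ w.2
        rw [eq_neg_of_add_eq_zero_left h1]
        exact Submodule.neg_mem _ ⟨e, rfl⟩
      rw [h2, zero_add] at h1
      have h3 : e = 0 := hD (h1.trans (map_zero D).symm)
      exact Prod.ext (Subtype.ext h2) h3
    · intro y
      obtain ⟨_, ⟨e, rfl⟩, w, hw, rfl⟩ := Submodule.mem_sup.1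
        (hC.sup_eq_top ▸ Submodule.mem_top : y ∈ LinearMap.range (D : E →ₗ[ℝ] F) ⊔ C)
      exact ⟨(⟨w, hw⟩, e), add_comm _ _⟩
  let L : (C × E) ≃L[ℝ] F := (LinearEquiv.ofBijective (L₀ : (C × E) →ₗ[ℝ] F)
    hL₀).toContinuousLinearEquiv
  let A : Set (C × E) := {z | φ x₀ + z.1 ∈ φ.target ∧ ψ 1 + z.2 ∈ ψ.target}
  have hA : IsOpen A := by
    have h1 : Continuous fun z : C × E => φ x₀ + (z.1 : F) := by fun_prop
    have h2 : Continuous fun z : C × E => ψ 1 + z.2 := by fun_prop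
    exact ((isOpen_extChartAt_target (I := 𝓘(ℝ, F)) x₀).preimage h1).inter
      ((isOpen_extChartAt_target (I := 𝓘(ℝ, E)) (1 : S)).preimage h2)
  have hA0 : (0 : C × E) ∈ A := by
    constructor
    · change φ x₀ + 0 ∈ φ.target
      rw [add_zero]
      exact mem_extChartAt_target x₀
    · change ψ 1 + 0 ∈ ψ.target
      rw [add_zero]
      exact mem_extChartAt_target 1
  -- Start at a point of the transversal and act by a group element near `1`. At `0` the derivative,
  -- read in the chart, is the inclusion of `C` plus the derivative of the orbit map, which is
  -- invertible.
  let Ψ : C × E → M := fun z => ρ.act (φ.symm (φ x₀ + z.1)) (ψ.symm (ψ 1 + z.2))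
  have hΨ : ∀ z ∈ A, ContMDiffAt 𝓘(ℝ, C × E) 𝓘(ℝ, F) ∞ Ψ z := by
    intro z hz
    have h1 : ContMDiffAt 𝓘(ℝ, C × E) 𝓘(ℝ, F) ∞ (fun z : C × E => φ x₀ + (z.1 : F)) z :=
      ContDiffAt.contMDiffAt (contDiffAt_const.add (C.subtypeL.contDiff.contDiffAt.comp z contDiffAt_fst))
    have h2 : ContMDiffAt 𝓘(ℝ, C × E) 𝓘(ℝ, E) ∞ (fun z : C × E => ψ 1 + z.2) z :=
      ContDiffAt.contMDiffAt (contDiffAt_const.add contDiffAt_snd)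
    have h3 := (contMDiffAt_extChartAt_symm_self (n := ⊤) hz.1).comp z h1
    have h4 := (contMDiffAt_extChartAt_symm_self (n := ⊤) hz.2).comp z h2
    exact ρ.smooth.contMDiffAt.comp z (h3.prodMk h4)
  have hΨ0 : Ψ 0 = x₀ := by
    change ρ.act (φ.symm (φ x₀ + 0)) (ψ.symm (ψ 1 + 0)) = x₀
    rw [add_zero, add_zero, extChartAt_to_inv, extChartAt_to_inv, ρ.act_one]
  have hg : ContDiffAt ℝ ∞ (φ ∘ Ψ) 0 := by
    have h1 : ContMDiffAt 𝓘(ℝ, F) 𝓘(ℝ, F) ∞ φ (Ψ 0) := by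
      rw [hΨ0]; exact contMDiffAt_extChartAt
    exact (h1.comp 0 (hΨ 0 hA0)).contDiffAt
  have hfd : HasFDerivAt (φ ∘ Ψ) (L : (C × E) →L[ℝ] F) 0 := by
    have h0 := (hg.differentiableAt (by simp)).hasFDerivAt
    refine h0.congr_fderiv ?_
    have hw : ∀ w : C, fderiv ℝ (φ ∘ Ψ) 0 (w, 0) = w := by
      intro w
      have h1 : HasFDerivAt (fun w : C => (φ ∘ Ψ) (w, 0))
          ((fderiv ℝ (φ ∘ Ψ) 0).comp (ContinuousLinearMap.inl ℝ C E)) 0 :=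
        HasFDerivAt.comp (g := φ ∘ Ψ) (f := fun w : C => (w, (0 : E))) (0 : C) h0
          (ContinuousLinearMap.inl ℝ C E).hasFDerivAt
      have h2 : HasFDerivAt (fun w : C => (φ ∘ Ψ) (w, 0)) C.subtypeL 0 := by
        have h3 : HasFDerivAt (fun w : C => φ x₀ + (w : F)) C.subtypeL 0 :=
          C.subtypeL.hasFDerivAt.const_add _
        refine h3.congr_of_eventuallyEq ?_
        have h4 : Continuous fun w : C => φ x₀ + (w : F) := by fun_prop
        have h5 : φ.target ∈ 𝓝 (φ x₀ + ((0 : C) : F)) := by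
          rw [ZeroMemClass.coe_zero, add_zero]
          exact extChartAt_target_mem_nhds x₀
        filter_upwards [h4.continuousAt.preimage_mem_nhds h5] with w hw
        change φ (ρ.act (φ.symm (φ x₀ + w)) (ψ.symm (ψ 1 + 0))) = _
        rw [add_zero, extChartAt_to_inv, ρ.act_one]
        exact φ.right_inv hw
      exact DFunLike.congr_fun (h1.unique h2) w
    have he : ∀ e : E, fderiv ℝ (φ ∘ Ψ) 0 (0, e) = D e := by
      intro e
      have h1 : HasFDerivAt (fun e : E => (φ ∘ Ψ) (0, e))
          ((fderiv ℝ (φ ∘ Ψ) 0).comp (ContinuousLinearMap.inr ℝ C E)) 0 :=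
        HasFDerivAt.comp (g := φ ∘ Ψ) (f := fun e : E => ((0 : C), e)) (0 : E) h0
          (ContinuousLinearMap.inr ℝ C E).hasFDerivAt
      have h2 : HasMFDerivAt 𝓘(ℝ, E) 𝓘(ℝ, F) (fun e : E => φ (ρ.act x₀ (ψ.symm (ψ 1 + e)))) 0 D := by
        have h3 : HasMFDerivAt 𝓘(ℝ, E) 𝓘(ℝ, E) (fun e : E => ψ 1 + e) 0
            (ContinuousLinearMap.id ℝ E) := ((hasFDerivAt_id (0 : E)).const_add _).hasMFDerivAt
        have h4 : ∀ k, k = ψ 1 → HasMFDerivAt 𝓘(ℝ, E) 𝓘(ℝ, E) ψ.symm k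
            (ContinuousLinearMap.id ℝ E) := by
          rintro _ rfl; exact hasMFDerivAt_extChartAt_symm_self (1 : S)
        have h5 : ∀ k, k = (1 : S) → HasMFDerivAt 𝓘(ℝ, E) 𝓘(ℝ, F) (ρ.act x₀) k D := by
          rintro _ rfl; exact (ρ.mdifferentiable_act x₀ 1).hasMFDerivAt
        have h6 : ∀ y, y = x₀ → HasMFDerivAt 𝓘(ℝ, F) 𝓘(ℝ, F) φ y (ContinuousLinearMap.id ℝ F) := by
          rintro _ rfl; exact hasMFDerivAt_extChartAt_self _
        have h7 : ψ.symm (ψ 1 + 0) = 1 := by rw [add_zero]; exact extChartAt_to_inv _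
        have h8 := (h4 _ (add_zero _)).comp (0 : E) h3
        have h9 := (h5 _ h7).comp (0 : E) h8
        exact (h6 _ (by
          rw [h7, ρ.act_one])).comp (0 : E) h9
      have h3 : HasFDerivAt (fun e : E => (φ ∘ Ψ) (0, e)) D 0 := by
        refine h2.hasFDerivAt.congr_of_eventuallyEq (Filter.Eventually.of_forall fun e => ?_)
        change φ (ρ.act (φ.symm (φ x₀ + 0)) (ψ.symm (ψ 1 + e))) = _
        rw [add_zero, extChartAt_to_inv]
      exact DFunLike.congr_fun (h1.unique h3) e
    ext z
    · exact (hw z).trans (show (z : F) = L₀ (z, 0) by simp [L₀])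
    · exact (he z).trans (show D z = L₀ (0, z) by simp [L₀])
  set G := hg.toOpenPartialHomeomorph (φ ∘ Ψ) hfd (by simp) with hG
  have hGcoe : ∀ z, G z = φ (Ψ z) := fun z =>
    congrFun (hg.toOpenPartialHomeomorph_coe hfd (by simp)) z
  have hG0 : (0 : C × E) ∈ G.source := hg.mem_toOpenPartialHomeomorph_source hfd (by simp)
  let O : Set (C × E) := A ∩ Ψ ⁻¹' φ.source
  have hO : IsOpen O := ContinuousOn.isOpen_inter_preimage
    (fun z hz => (hΨ z hz).continuousAt.continuousWithinAt) hA (isOpen_extChartAt_source x₀)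
  have hO0 : (0 : C × E) ∈ O := ⟨hA0, by
    change Ψ 0 ∈ φ.source
    rw [hΨ0]; exact mem_extChartAt_source x₀⟩
  let κ : M → C × E := fun y => G.symm (φ y)
  let U : Set M := φ.source ∩ φ ⁻¹' (G.target ∩ G.symm ⁻¹' O)
  have hU : IsOpen U := (continuousOn_extChartAt x₀).isOpen_inter_preimage
    (isOpen_extChartAt_source x₀) (G.symm.isOpen_inter_preimage hO)
  have hG0' : G 0 = φ x₀ := by rw [hGcoe, hΨ0]
  have hsymm0 : G.symm (φ x₀) = 0 := by rw [← hG0', G.left_inv hG0]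
  have hx₀ : x₀ ∈ U := by
    refine ⟨mem_extChartAt_source x₀, ?_, ?_⟩
    · rw [← hG0']; exact G.map_source hG0
    · change G.symm (φ x₀) ∈ O
      rw [hsymm0]; exact hO0
  have hκ : ContinuousOn κ U :=
    G.symm.continuousOn.comp ((continuousOn_extChartAt x₀).mono inter_subset_left)
      fun y hy => hy.2.1
  have hΨκ : ∀ y ∈ U, Ψ (κ y) = y := fun y hy => by
    refine φ.injOn hy.2.2.2 hy.1 ?_
    rw [← hGcoe]
    exact G.right_inv hy.2.1
  have hκΨ : ∀ z ∈ G.source, κ (Ψ z) = z := fun z hz => by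
    change G.symm (φ (Ψ z)) = z
    rw [← hGcoe, G.left_inv hz]
  refine ⟨fun y => (κ y).1, fun y => ψ.symm (ψ 1 + (κ y).2), fun w => φ.symm (φ x₀ + w), U, hU, hx₀,
    ?_, ?_, ?_, hΨκ, ?_⟩
  · exact continuous_subtype_val.comp_continuousOn (continuous_fst.comp_continuousOn hκ)
  · refine (continuousOn_extChartAt_symm (I := 𝓘(ℝ, E)) (1 : S)).comp
      (continuousOn_const.add (continuous_snd.comp_continuousOn hκ)) fun y hy => hy.2.2.1.2
  · have h1 : ContMDiffAt 𝓘(ℝ, F) 𝓘(ℝ, F) ∞ φ x₀ := contMDiffAt_extChartAt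
    have h2 : ContDiffAt ℝ ∞ G.symm (φ x₀) := by
      have h := hg.to_localInverse hfd (by simp)
      rw [Function.comp_apply, hΨ0] at h
      exact h
    have h3 : ContMDiffAt 𝓘(ℝ, F) 𝓘(ℝ, E) ∞ (fun y => ψ 1 + (κ y).2) x₀ :=
      ContMDiffAt.comp (g := fun u : F => ψ 1 + (G.symm u).2) x₀
        (contDiffAt_const.add (contDiffAt_snd.comp _ h2)).contMDiffAt h1
    refine ContMDiffAt.comp (g := ψ.symm) x₀ ?_ h3
    exact contMDiffAt_extChartAt_symm_self (n := ⊤) hx₀.2.2.1.2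
  · intro y hy
    obtain ⟨⟨w, e⟩, hz⟩ : ∃ z, z = κ y := ⟨_, rfl⟩
    have hzG : (w, e) ∈ G.source := hz ▸ G.map_target hy.2.1
    have hzO : (w, e) ∈ O := hz ▸ hy.2.2
    let b : S := ψ.symm (ψ 1 + e)
    have hb : b ∈ ψ.source := ψ.map_target hzO.1.2
    have hbs : Filter.Tendsto (fun s => b * s) (𝓝 1) (𝓝 b) := by
      have h : Continuous fun s => b * s := continuous_const.mul continuous_id
      simpa using h.tendsto 1
    -- Acting by a small `s` replaces the group coordinate `b` by `b s` and leaves the transverse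
    -- coordinate `w` unchanged.
    have h1 : Filter.Tendsto (fun s => (w, ψ (b * s) - ψ 1)) (𝓝 1) (𝓝 (w, e)) := by
      refine tendsto_const_nhds.prodMk_nhds ?_
      have h2 : Filter.Tendsto (fun s => ψ (b * s) - ψ 1) (𝓝 1) (𝓝 (ψ b - ψ 1)) :=
        (((continuousAt_extChartAt' hb).tendsto.comp hbs).sub_const _)
      have h3 : ψ b = ψ 1 + e := ψ.right_inv hzO.1.2
      rwa [h3, add_sub_cancel_left] at h2
    filter_upwards [h1.eventually (G.open_source.mem_nhds hzG),
      hbs.eventually (extChartAt_source_mem_nhds' hb)] with s hs hs'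
    have h2 : Ψ (w, ψ (b * s) - ψ 1) = ρ.act y s := by
      change ρ.act (φ.symm (φ x₀ + w)) (ψ.symm (ψ 1 + (ψ (b * s) - ψ 1))) = _
      rw [add_sub_cancel, ψ.left_inv hs', ρ.act_mul]
      have h3 : Ψ (w, e) = y := hz ▸ hΨκ y hy
      rw [← h3]
    have h3 := hκΨ _ hs
    rw [h2] at h3
    rw [h3, ← hz]

end FlowBox

/-! ### Construction of the transition cocycle -/

section Separable

variable (E : Type*) {S : Type*} [NormedAddCommGroup E] [NormedSpace ℝ E] [FiniteDimensional ℝ E]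
  [TopologicalSpace S] [ChartedSpace E S] [Group S] [IsTopologicalGroup S]

theorem Subgroup.countable_closure {G : Type*} [Group G] {s : Set G} (hs : s.Countable) :
    (Subgroup.closure s : Set G).Countable := by
  have : Countable s := hs
  have : Countable (FreeGroup s) := Quot.mk_surjective.countable
  have h : Subgroup.closure s = (FreeGroup.lift ((↑) : s → G)).range := by
    rw [FreeGroup.range_lift_eq_closure, Subtype.range_coe]
  rw [h]
  exact countable_range _

include E in
-- Generate a countable subgroup by a countable dense subset of a chart at `1`. Its closure contains
-- a neighborhood of `1`, so it is an open and closed subgroup, hence all of `S`.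
theorem separableSpace_of_connected [ConnectedSpace S] : TopologicalSpace.SeparableSpace S := by
  set ψ := extChartAt 𝓘(ℝ, E) (1 : S) with hψ
  obtain ⟨D, hDc, hDd⟩ := TopologicalSpace.exists_countable_dense E
  set T := Subgroup.closure (ψ.symm '' (ψ.target ∩ D)) with hT
  have hsrc : ψ.source ⊆ T.topologicalClosure := by
    intro x hx
    have h1 : ψ x ∈ closure (ψ.target ∩ D) :=
      hDd.open_subset_closure_inter (isOpen_extChartAt_target (I := 𝓘(ℝ, E)) (1 : S))
        (ψ.map_source hx)
    have h2 : ContinuousWithinAt ψ.symm (ψ.target ∩ D) (ψ x) :=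
      ((continuousOn_extChartAt_symm (I := 𝓘(ℝ, E)) (1 : S)) _ (ψ.map_source hx)).mono
        inter_subset_left
    have h3 := h2.mem_closure_image h1
    rw [ψ.left_inv hx] at h3
    exact closure_mono Subgroup.subset_closure h3
  have hopen : IsOpen (T.topologicalClosure : Set S) :=
    T.topologicalClosure.isOpen_of_mem_nhds
      (Filter.mem_of_superset (extChartAt_source_mem_nhds (I := 𝓘(ℝ, E)) (1 : S)) hsrc)
  have huniv : (T.topologicalClosure : Set S) = univ :=
    IsClopen.eq_univ ⟨T.isClosed_topologicalClosure, hopen⟩ ⟨1, T.topologicalClosure.one_mem⟩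
  exact ⟨T, Subgroup.countable_closure ((hDc.mono inter_subset_right).image _),
    dense_iff_closure_eq.2 huniv⟩

end Separable

/-! ### Lifting along orbits -/

section Cocycle

variable {E F S M : Type*}
  [NormedAddCommGroup E] [NormedSpace ℝ E] [FiniteDimensional ℝ E]
  [NormedAddCommGroup F] [NormedSpace ℝ F] [FiniteDimensional ℝ F]
  [TopologicalSpace S] [ChartedSpace E S] [Group S] [LieGroup 𝓘(ℝ, E) ∞ S] [T2Space S]
  [TopologicalSpace M] [ChartedSpace F M] [IsManifold 𝓘(ℝ, F) ∞ M]

/-- A connected piece of an orbit inside a flow box lies in one plaque. -/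
theorem LocallyFreeAction.eq_of_mem_orbit [ConnectedSpace S] (ρ : LocallyFreeAction E F S M)
    {t : M → F} {U : Set M} (hU : IsOpen U) (ht : ContinuousOn t U)
    (hloc : ∀ y ∈ U, ∀ᶠ s in 𝓝 (1 : S), t (ρ.act y s) = t y) {x : M} {f : S → M} {V : Set S}
    (hV : IsPreconnected V) (hf : ContinuousOn f V) (hfU : MapsTo f V U)
    (hfx : MapsTo f V (range (ρ.act x))) {s s' : S} (hs : s ∈ V) (hs' : s' ∈ V) :
    t (f s) = t (f s') := by
  have := lieGroup_of_le_infty E S (n := 1)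
  have : IsTopologicalGroup S := topologicalGroup_of_lieGroup 𝓘(ℝ, E) 1
  have := separableSpace_of_connected E (S := S)
  have hcount : (t '' (U ∩ range (ρ.act x))).Countable := by
    -- The parameters landing in the different plaques form disjoint nonempty open subsets of the
    -- separable group, so only countably many plaques meet the orbit.
    refine Set.PairwiseDisjoint.countable_of_isOpen
      (s := fun v => {s : S | ρ.act x s ∈ U ∧ t (ρ.act x s) = v}) ?_ ?_ ?_
    · intro v _ w _ hvw
      refine Set.disjoint_left.2 fun s hs hs' => hvw ?_
      exact hs.2.symm.trans hs'.2
    · intro v _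
      rw [isOpen_iff_mem_nhds]
      rintro s ⟨hsU, rfl⟩
      have h1 : Filter.Tendsto (fun s' => s⁻¹ * s') (𝓝 s) (𝓝 1) := by
        have h : Continuous fun s' => s⁻¹ * s' := continuous_const.mul continuous_id
        simpa using h.tendsto s
      filter_upwards [(ρ.contMDiff_act x).continuous.continuousAt.preimage_mem_nhds
        (hU.mem_nhds hsU), h1.eventually (hloc _ hsU)] with s' h2 h3
      rw [← ρ.act_mul, mul_inv_cancel_left] at h3
      exact ⟨h2, h3⟩
    · rintro _ ⟨_, ⟨hy, s, rfl⟩, rfl⟩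
      exact ⟨s, hy, rfl⟩
  have hpre : IsPreconnected ((t ∘ f) '' V) := hV.image _ (ht.comp hf hfU)
  have hsub : (t ∘ f) '' V ⊆ t '' (U ∩ range (ρ.act x)) := by
    rintro _ ⟨s, hs, rfl⟩
    exact ⟨f s, ⟨hfU hs, hfx hs⟩, rfl⟩
  -- A countable subset of `F` is totally disconnected, so the connected image of `V` is one point.
  exact (hcount.mono hsub).isTotallyDisconnected _ subset_rfl hpre ⟨s, hs, rfl⟩ ⟨s', hs', rfl⟩

/-- For `s` near `1`, the points `x` and `ρ₀(x, s)` lie in one plaque of a flow box for `ρ`, so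
`d(x)⁻¹ d(ρ₀(x, s))` carries the first to the second. The set `V` does not depend on `x ∈ O`, as the
smoothness argument requires. -/
theorem SameOrbitFoliation.exists_local_cocycle [ConnectedSpace S]
    {ρ₀ ρ : LocallyFreeAction E F S M} (hρ : SameOrbitFoliation ρ₀ ρ) (x₀ : M) :
    ∃ α : M → S → S,
      ContMDiffAt (𝓘(ℝ, F).prod 𝓘(ℝ, E)) 𝓘(ℝ, E) ∞ (fun p : M × S => α p.1 p.2) (x₀, 1) ∧
      ∃ O ∈ 𝓝 x₀, ∃ V : Set S, IsOpen V ∧ 1 ∈ V ∧ IsPreconnected V ∧ ∀ x ∈ O, α x 1 = 1 ∧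
        ContinuousOn (α x) V ∧ ∀ s ∈ V, ρ₀.act x s = ρ.act x (α x s) := by
  have := lieGroup_of_le_infty E S (n := ⊤)
  have : IsTopologicalGroup S := topologicalGroup_of_lieGroup 𝓘(ℝ, E) ∞
  have := ChartedSpace.locallyConnectedSpace E S
  obtain ⟨t, d, τ, U, hU, hx₀, ht, hd, hds, hτ, hloc⟩ := ρ.exists_flowBox x₀
  have hact : (fun p : M × S => ρ₀.act p.1 p.2) ⁻¹' U ∈ 𝓝 (x₀, (1 : S)) :=
    ρ₀.smooth.continuous.continuousAt.preimage_mem_nhds (hU.mem_nhds (by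
      change ρ₀.act x₀ 1 ∈ U; rwa [ρ₀.act_one]))
  rw [nhds_prod_eq] at hact
  obtain ⟨O, hO, W, hW, hOW⟩ := Filter.mem_prod_iff.1 hact
  obtain ⟨V, hVW, hVo, hV1, hVc⟩ :=
    locallyConnectedSpace_iff_subsets_isOpen_isConnected.1 this 1 W hW
  refine ⟨fun x s => (d x)⁻¹ * d (ρ₀.act x s), ?_, O, hO, V, hVo, hV1, hVc.isPreconnected,
    fun x hx => ?_⟩
  · have h1 : ContMDiffAt (𝓘(ℝ, F).prod 𝓘(ℝ, E)) 𝓘(ℝ, E) ∞ (fun p : M × S => d p.1) (x₀, 1) :=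
      ContMDiffAt.comp (g := d) (x₀, (1 : S)) hds contMDiffAt_fst
    have h2 : ContMDiffAt (𝓘(ℝ, F).prod 𝓘(ℝ, E)) 𝓘(ℝ, E) ∞
        (fun p : M × S => d (ρ₀.act p.1 p.2)) (x₀, 1) :=
      ContMDiffAt.comp (g := d) (x₀, (1 : S)) (by
        change ContMDiffAt 𝓘(ℝ, F) 𝓘(ℝ, E) ∞ d (ρ₀.act x₀ 1)
        rwa [ρ₀.act_one]) ρ₀.smooth.contMDiffAt
    exact h1.inv.mul h2
  · have hmaps : MapsTo (ρ₀.act x) V U := fun s hs =>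
      hOW (mk_mem_prod hx (hVW hs) : (x, s) ∈ O ×ˢ W)
    have hcont : ContinuousOn (ρ₀.act x) V := (ρ₀.contMDiff_act x).continuous.continuousOn
    have hxU : x ∈ U := by simpa [ρ₀.act_one] using hmaps hV1
    refine ⟨by simp [ρ₀.act_one], continuousOn_const.mul (hd.comp hcont hmaps), fun s hs => ?_⟩
    have h1 := ρ.eq_of_mem_orbit hU ht hloc hVc.isPreconnected hcont hmaps
      (fun s _ => (hρ x).symm ▸ mem_range_self s : MapsTo (ρ₀.act x) V (range (ρ.act x))) hs hV1
    rw [ρ₀.act_one] at h1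
    have h2 := hτ x hxU
    have h3 := hτ _ (hmaps hs)
    rw [h1] at h3
    have h4 : ρ.act x (d x)⁻¹ = τ (t x) :=
      calc ρ.act x (d x)⁻¹ = ρ.act (ρ.act (τ (t x)) (d x)) (d x)⁻¹ := by rw [h2]
        _ = τ (t x) := ρ.act_inv_act _ _
    rw [ρ.act_mul, h4, h3]

/-- Two continuous lifts of the same map to an orbit which agree at a point agree. -/
theorem LocallyFreeAction.eqOn_of_act_eq (ρ : LocallyFreeAction E F S M) {x : M} {b b' : S → S}
    {V : Set S} (hV : IsPreconnected V) (hb : ContinuousOn b V) (hb' : ContinuousOn b' V)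
    (h : ∀ s ∈ V, ρ.act x (b s) = ρ.act x (b' s)) {s₀ : S} (hs₀ : s₀ ∈ V) (h₀ : b s₀ = b' s₀) :
    EqOn b b' V := by
  have := lieGroup_of_le_infty E S (n := ⊤)
  have : IsTopologicalGroup S := topologicalGroup_of_lieGroup 𝓘(ℝ, E) ∞
  have := ρ.locallyFree x
  have := isPreconnected_iff_preconnectedSpace.1 hV
  -- The quotient of the two lifts takes values in the discrete isotropy group, so it is constant on
  -- the connected `V`.
  let f : V → {s : S | ρ.act x s = x} := fun s =>
    ⟨b s * (b' s)⁻¹, ρ.act_eq_act_iff.1 (h s s.2)⟩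
  have hf : Continuous f :=
    ((continuousOn_iff_continuous_domRestrict.1 hb).mul
      (continuousOn_iff_continuous_domRestrict.1 hb').inv).subtype_mk _
  intro s hs
  have h1 : f ⟨s, hs⟩ = f ⟨s₀, hs₀⟩ := PreconnectedSpace.constant inferInstance hf
  have h2 : b s * (b' s)⁻¹ = b s₀ * (b' s₀)⁻¹ := congrArg Subtype.val h1
  rwa [h₀, mul_inv_cancel, mul_inv_eq_one] at h2

theorem LocallyFreeAction.eq_of_act_eq [ConnectedSpace S] (ρ : LocallyFreeAction E F S M) {x : M}
    {b b' : S → S} (hb : Continuous b) (hb' : Continuous b')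
    (h : ∀ s, ρ.act x (b s) = ρ.act x (b' s)) {s₀ : S} (h₀ : b s₀ = b' s₀) : b = b' :=
  funext fun s => ρ.eqOn_of_act_eq isPreconnected_univ hb.continuousOn hb'.continuousOn
    (fun s _ => h s) (mem_univ s₀) h₀ (mem_univ s)

variable [SimplyConnectedSpace S]

/-- The local cocycle makes the orbit map continuous into `S` modulo the isotropy group, and it
lifts to the covering space `S`. -/
theorem SameOrbitFoliation.exists_cocycle_at {ρ₀ ρ : LocallyFreeAction E F S M}
    (hρ : SameOrbitFoliation ρ₀ ρ) (x : M) : ∃ b : S → S, Continuous b ∧ b 1 = 1 ∧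
      ∀ s, ρ₀.act x s = ρ.act x (b s) := by
  have := lieGroup_of_le_infty E S (n := ⊤)
  have : IsTopologicalGroup S := topologicalGroup_of_lieGroup 𝓘(ℝ, E) ∞
  have := ChartedSpace.locallyPathConnectedSpace E S
  have hdisc : IsDiscrete (ρ.isotropy x : Set S) := ⟨ρ.locallyFree x⟩
  have hex : ∀ s, ∃ u, ρ.act x u = ρ₀.act x s := fun s =>
    ((hρ x).symm ▸ mem_range_self s : ρ₀.act x s ∈ range (ρ.act x))
  choose u hu using hex
  -- Points of the orbit are right cosets of the isotropy group, whereas the quotient is by left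
  -- cosets; inverses exchange the two.
  have hmk : ∀ b b' : S, ρ.act x b = ρ.act x b' ↔
      ((b⁻¹ : S) : S ⧸ ρ.isotropy x) = ((b'⁻¹ : S) : S ⧸ ρ.isotropy x) := by
    intro b b'
    rw [QuotientGroup.eq, inv_inv, ρ.act_eq_act_iff]
  let f : S → S ⧸ ρ.isotropy x := fun s => (((u s)⁻¹ : S) : S ⧸ ρ.isotropy x)
  have hf : Continuous f := by
    rw [continuous_iff_continuousAt]
    intro s₀
    obtain ⟨α, -, O, hO, V, hVo, hV1, -, hα⟩ := hρ.exists_local_cocycle (ρ₀.act x s₀)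
    obtain ⟨-, hαc, hαa⟩ := hα _ (mem_of_mem_nhds hO)
    have h1 : Filter.Tendsto (fun s => s₀⁻¹ * s) (𝓝 s₀) (𝓝 1) := by
      have h : Continuous fun s => s₀⁻¹ * s := continuous_const.mul continuous_id
      simpa using h.tendsto s₀
    have h2 : ContinuousAt (fun s => (((u s₀ * α (ρ₀.act x s₀) (s₀⁻¹ * s))⁻¹ : S) :
        S ⧸ ρ.isotropy x)) s₀ := by
      have h3 : ContinuousAt (α (ρ₀.act x s₀)) (s₀⁻¹ * s₀) := by
        rw [inv_mul_cancel]; exact hαc.continuousAt (hVo.mem_nhds hV1)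
      have h4 : ContinuousAt (fun s => α (ρ₀.act x s₀) (s₀⁻¹ * s)) s₀ :=
        ContinuousAt.comp (f := fun s => s₀⁻¹ * s) h3
          (continuous_const.mul continuous_id).continuousAt
      exact continuous_quotient_mk'.continuousAt.comp (continuousAt_const.mul h4).inv
    refine h2.congr ?_
    filter_upwards [h1.eventually (hVo.mem_nhds hV1)] with s hs
    refine (hmk _ _).1 ?_
    rw [ρ.act_mul, hu, hu, ← hαa _ hs, ← ρ₀.act_mul, mul_inv_cancel_left]
  have hcov : IsCoveringMap ((↑) : S → S ⧸ ρ.isotropy x) :=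
    ((ρ.isotropy x).isQuotientCoveringMap hdisc).isCoveringMap
  obtain ⟨Φ, ⟨hΦ1, hΦ⟩, -⟩ := hcov.existsUnique_continuousMap_lifts ⟨f, hf⟩ 1 1 (by
    change ((1 : S) : S ⧸ ρ.isotropy x) = (((u 1)⁻¹ : S) : S ⧸ ρ.isotropy x)
    have h := (hmk 1 (u 1)).1 (by rw [hu, ρ.act_one, ρ₀.act_one])
    rwa [inv_one] at h)
  refine ⟨fun s => (Φ s)⁻¹, Φ.continuous.inv, by simp [hΦ1], fun s => ?_⟩
  rw [← hu, hmk, inv_inv]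
  exact (congrFun hΦ s).symm

/-- As functions of `t`, both sides lift the same orbit map and agree at `t = 1`. -/
theorem cocycle_mul {ρ₀ ρ : LocallyFreeAction E F S M} {a : M → S → S}
    (hc : ∀ x, Continuous (a x)) (h1 : ∀ x, a x 1 = 1)
    (ha : ∀ x s, ρ₀.act x s = ρ.act x (a x s)) (x : M) (s t : S) :
    a x (s * t) = a x s * a (ρ₀.act x s) t := by
  have := lieGroup_of_le_infty E S (n := ⊤)
  have : IsTopologicalGroup S := topologicalGroup_of_lieGroup 𝓘(ℝ, E) ∞
  refine congrFun (ρ.eq_of_act_eq (x := x) (b := fun t => a x (s * t))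
    (b' := fun t => a x s * a (ρ₀.act x s) t) ((hc x).comp (continuous_const.mul continuous_id))
    (continuous_const.mul (hc _)) (fun t => ?_) (s₀ := 1) ?_) t
  · rw [← ha, ρ.act_mul, ← ha, ← ha, ρ₀.act_mul]
  · simp [h1]

/-- A pointwise continuous transition cocycle is smooth. -/
theorem SameOrbitFoliation.contMDiff_cocycle [CompactSpace M] {ρ₀ ρ : LocallyFreeAction E F S M}
    (hρ : SameOrbitFoliation ρ₀ ρ) {a : M → S → S} (hc : ∀ x, Continuous (a x))
    (h1 : ∀ x, a x 1 = 1) (ha : ∀ x s, ρ₀.act x s = ρ.act x (a x s)) :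
    ContMDiff (𝓘(ℝ, F).prod 𝓘(ℝ, E)) 𝓘(ℝ, E) ∞ (fun p : M × S => a p.1 p.2) := by
  rw [contMDiff_infty]
  -- At a finite order the set of points of differentiability is open, which the argument needs.
  intro n
  have := lieGroup_of_le_infty E S (n := n)
  have : IsTopologicalGroup S := topologicalGroup_of_lieGroup 𝓘(ℝ, E) (n : ℕ∞)
  have := isManifold_of_lieGroup E S n
  have := IsManifold.of_le (I := 𝓘(ℝ, F)) (M := M) (m := n) (n := ∞) (by exact_mod_cast le_top)
  let G : Set (M × S) :=
    {p | ContMDiffAt (𝓘(ℝ, F).prod 𝓘(ℝ, E)) 𝓘(ℝ, E) n (fun p : M × S => a p.1 p.2) p}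
  have hGo : IsOpen G := by
    rw [isOpen_iff_mem_nhds]
    intro p hp
    exact (contMDiffAt_iff_contMDiffAt_nhds (by simp)).1 hp
  have hG1 : univ ×ˢ {(1 : S)} ⊆ G := by
    rintro ⟨x₀, s⟩ ⟨-, rfl⟩
    obtain ⟨α, hα, O, hO, V, hVo, hV1, hVc, hαV⟩ := hρ.exists_local_cocycle x₀
    refine (hα.of_le (by exact_mod_cast le_top)).congr_of_eventuallyEq ?_
    filter_upwards [prod_mem_nhds hO (hVo.mem_nhds hV1)] with p hp
    obtain ⟨hα1, hαc, hαa⟩ := hαV p.1 hp.1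
    exact ρ.eqOn_of_act_eq hVc (hc p.1).continuousOn hαc
      (fun s hs => by rw [← ha, ← hαa s hs]) hV1 ((h1 _).trans hα1.symm) hp.2
  -- Compactness of `M` gives one neighborhood `V` of `1` that works for all `x`.
  obtain ⟨u, V, -, hVo, hu, hV1, huV⟩ := generalized_tube_lemma isCompact_univ
    isCompact_singleton hGo hG1
  have hstep : ∀ s v, (∀ x, (x, s) ∈ G) → v ∈ V → ∀ x, (x, s * v) ∈ G := by
    intro s v hs hv x
    have h2 : (fun p : M × S => a p.1 p.2) =
        fun p : M × S => a p.1 s * a (ρ₀.act p.1 s) (s⁻¹ * p.2) := by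
      ext p
      rw [← cocycle_mul hc h1 ha, mul_inv_cancel_left]
    change ContMDiffAt (𝓘(ℝ, F).prod 𝓘(ℝ, E)) 𝓘(ℝ, E) n (fun p : M × S => a p.1 p.2) (x, s * v)
    rw [h2]
    have h3 : ContMDiffAt (𝓘(ℝ, F).prod 𝓘(ℝ, E)) 𝓘(ℝ, E) n (fun p : M × S => a p.1 s)
        (x, s * v) :=
      ContMDiffAt.comp (g := fun p : M × S => a p.1 p.2) (f := fun p : M × S => (p.1, s))
        (x, s * v) (hs x) (contMDiffAt_fst.prodMk contMDiffAt_const)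
    have h4 : ContMDiffAt (𝓘(ℝ, F).prod 𝓘(ℝ, E)) (𝓘(ℝ, F).prod 𝓘(ℝ, E)) n
        (fun p : M × S => (ρ₀.act p.1 s, s⁻¹ * p.2)) (x, s * v) := by
      refine ContMDiffAt.prodMk ?_ ?_
      · exact ContMDiffAt.comp (g := fun y => ρ₀.act y s) (x, s * v)
          ((ρ₀.contMDiff_act_left s).contMDiffAt.of_le (by exact_mod_cast le_top)) contMDiffAt_fst
      · exact contMDiffAt_const.mul contMDiffAt_snd
    have h5 : ContMDiffAt (𝓘(ℝ, F).prod 𝓘(ℝ, E)) 𝓘(ℝ, E) n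
        (fun p : M × S => a (ρ₀.act p.1 s) (s⁻¹ * p.2)) (x, s * v) := by
      refine ContMDiffAt.comp (g := fun p : M × S => a p.1 p.2)
        (f := fun p : M × S => (ρ₀.act p.1 s, s⁻¹ * p.2)) (x, s * v) ?_ h4
      change ContMDiffAt (𝓘(ℝ, F).prod 𝓘(ℝ, E)) 𝓘(ℝ, E) n (fun p : M × S => a p.1 p.2)
        (ρ₀.act x s, s⁻¹ * (s * v))
      rw [inv_mul_cancel_left]
      exact huV ⟨hu (mem_univ _), hv⟩
    exact h3.mul h5
  let T : Set S := {s | ∀ x, (x, s) ∈ G}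
  have hT1 : (1 : S) ∈ T := fun x => hG1 ⟨mem_univ _, rfl⟩
  -- Steps of uniform size `V` make `T` open, and also closed, since a step from a nearby point of
  -- `T` reaches any limit point.
  have hclopen : IsClopen T := by
    constructor
    · rw [← isOpen_compl_iff, isOpen_iff_mem_nhds]
      intro s hs
      have h2 : ∀ᶠ s' in 𝓝 s, s'⁻¹ * s ∈ V := by
        have h : Continuous fun s' => s'⁻¹ * s := continuous_inv.mul continuous_const
        exact h.continuousAt.preimage_mem_nhds (by
          rw [inv_mul_cancel]; exact hVo.mem_nhds (hV1 rfl))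
      filter_upwards [h2] with s' hs' hsT
      refine hs fun x => ?_
      have := hstep s' _ hsT hs' x
      rwa [mul_inv_cancel_left] at this
    · rw [isOpen_iff_mem_nhds]
      intro s hs
      have h2 : ∀ᶠ s' in 𝓝 s, s⁻¹ * s' ∈ V := by
        have h : Continuous fun s' => s⁻¹ * s' := continuous_const.mul continuous_id
        exact h.continuousAt.preimage_mem_nhds (by
          rw [inv_mul_cancel]; exact hVo.mem_nhds (hV1 rfl))
      filter_upwards [h2] with s' hs' x
      have := hstep s _ hs hs' x
      rwa [mul_inv_cancel_left] at this
  have hTu := hclopen.eq_univ ⟨1, hT1⟩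
  intro p
  exact (hTu ▸ mem_univ p.2 : p.2 ∈ T) p.1

theorem IsTransitionCocycle.contMDiff_right {ρ₀ ρ : LocallyFreeAction E F S M} {a : M → S → S}
    (h : IsTransitionCocycle ρ₀ ρ a) (x : M) : ContMDiff 𝓘(ℝ, E) 𝓘(ℝ, E) ∞ (a x) :=
  h.smooth.comp (contMDiff_const.prodMk contMDiff_id)

theorem SameOrbitFoliation.existsUnique_isTransitionCocycle [CompactSpace M]
    {ρ₀ ρ : LocallyFreeAction E F S M} (hρ : SameOrbitFoliation ρ₀ ρ) :
    ∃! a : M → S → S, IsTransitionCocycle ρ₀ ρ a := by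
  choose a hc h1 ha using fun x => hρ.exists_cocycle_at x
  refine ⟨a, ⟨hρ.contMDiff_cocycle hc h1 ha, h1, ha⟩, fun b hb => funext fun x => ?_⟩
  exact ρ.eq_of_act_eq (hb.contMDiff_right x).continuous (hc x)
    (fun s => by rw [← ha, ← hb.act_eq]) ((hb.map_one x).trans (h1 x).symm)

theorem IsTransitionCocycle.map_mul {ρ₀ ρ : LocallyFreeAction E F S M} {a : M → S → S}
    (h : IsTransitionCocycle ρ₀ ρ a) (x : M) (s t : S) :
    a x (s * t) = a x s * a (ρ₀.act x s) t :=
  cocycle_mul (fun x => (h.contMDiff_right x).continuous) h.map_one h.act_eq x s t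

/-- Both `b(x, a(x, ·))` and the identity lift `ρ₀(x, ·)` through `ρ₀(x, ·)` itself, starting at
`1`. -/
theorem IsTransitionCocycle.leftInverse {ρ₀ ρ : LocallyFreeAction E F S M} {a b : M → S → S}
    (ha : IsTransitionCocycle ρ₀ ρ a) (hb : IsTransitionCocycle ρ ρ₀ b) (x : M) :
    Function.LeftInverse (b x) (a x) :=
  congrFun (ρ₀.eq_of_act_eq (x := x) (b := fun s => b x (a x s)) (b' := id)
    ((hb.contMDiff_right x).continuous.comp (ha.contMDiff_right x).continuous) continuous_id
    (fun s => by rw [← hb.act_eq, ← ha.act_eq]; rfl) (s₀ := 1)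
    (by rw [ha.map_one, hb.map_one]; rfl))

end Cocycle

/-! ### The derivative of a transition cocycle -/

section CocycleDeriv

variable {E F S M : Type*}
  [NormedAddCommGroup E] [NormedSpace ℝ E] [FiniteDimensional ℝ E]
  [NormedAddCommGroup F] [NormedSpace ℝ F] [FiniteDimensional ℝ F]
  [TopologicalSpace S] [ChartedSpace E S] [Group S] [LieGroup 𝓘(ℝ, E) ∞ S] [T2Space S]
  [TopologicalSpace M] [ChartedSpace F M] [IsManifold 𝓘(ℝ, F) ∞ M]

omit [FiniteDimensional ℝ E] [T2Space S] [LieGroup 𝓘(ℝ, E) ∞ S] in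
theorem maurerCartan_one (v : GroupLieAlgebra 𝓘(ℝ, E) S) : maurerCartan (1 : S) v = v := by
  have h1 : (fun x : S => (1 : S)⁻¹ * x) = id := by ext x; simp
  have h2 : mfderiv 𝓘(ℝ, E) 𝓘(ℝ, E) (fun x : S => (1 : S)⁻¹ * x) 1 = ContinuousLinearMap.id ℝ E := by
    rw [h1]; exact mfderiv_id
  exact DFunLike.congr_fun h2 v

/-- The norm of the model space and the norm of an inner product are equivalent. -/
theorem exists_innerNorm_le_norm (c : InnerProductSpace.Core ℝ (GroupLieAlgebra 𝓘(ℝ, E) S)) :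
    ∃ C₁ > 0, ∃ C₂ > 0, (∀ v : E, innerNorm c v ≤ C₁ * ‖v‖) ∧ ∀ v : E, ‖v‖ ≤ C₂ * innerNorm c v := by
  have key : ∀ {V W : Type _} [NormedAddCommGroup V] [NormedSpace ℝ V] [FiniteDimensional ℝ V]
      [NormedAddCommGroup W] [NormedSpace ℝ W] (f : V →ₗ[ℝ] W),
      ∃ C > 0, ∀ v, ‖f v‖ ≤ C * ‖v‖ := fun f => f.toContinuousLinearMap.bound
  let i₁ : NormedAddCommGroup (GroupLieAlgebra 𝓘(ℝ, E) S) :=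
    @InnerProductSpace.Core.toNormedAddCommGroup ℝ _ _ _ _ c
  let i₂ : NormedSpace ℝ (GroupLieAlgebra 𝓘(ℝ, E) S) :=
    @InnerProductSpace.Core.toNormedSpace ℝ _ _ _ _ c.toCore
  obtain ⟨C₁, hC₁, h₁⟩ : ∃ C > 0, ∀ v : E, innerNorm c v ≤ C * ‖v‖ :=
    @key E (GroupLieAlgebra 𝓘(ℝ, E) S) _ _ _ i₁ i₂ LinearMap.id
  obtain ⟨C₂, hC₂, h₂⟩ : ∃ C > 0, ∀ v : E, ‖v‖ ≤ C * innerNorm c v :=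
    @key (GroupLieAlgebra 𝓘(ℝ, E) S) E i₁ i₂ (finiteDimensional_groupLieAlgebra E S) _ _
      LinearMap.id
  exact ⟨C₁, hC₁, C₂, hC₂, h₁, h₂⟩

variable (E) in
/-- The derivative at `1` of `a(y, ·)`. -/
def cocycleDeriv (a : M → S → S) (y : M) : E →L[ℝ] E := mfderiv 𝓘(ℝ, E) 𝓘(ℝ, E) (a y) 1

namespace IsTransitionCocycle

variable [SimplyConnectedSpace S] {ρ₀ ρ : LocallyFreeAction E F S M} {a : M → S → S} (h : IsTransitionCocycle ρ₀ ρ a)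
include h

theorem mdifferentiable_right (x : M) : MDifferentiable 𝓘(ℝ, E) 𝓘(ℝ, E) (a x) :=
  (h.contMDiff_right x).mdifferentiable (by simp)

/-- As `a(y, 1) = 1`, all these derivatives are endomorphisms of one tangent space, and the change
of tangent coordinates is the identity. -/
theorem contMDiff_cocycleDeriv : ContMDiff 𝓘(ℝ, F) 𝓘(ℝ, E →L[ℝ] E) ∞ (cocycleDeriv E a) := by
  have := isManifold_of_lieGroup E S 1
  have := IsManifold.of_le (I := 𝓘(ℝ, F)) (M := M) (m := 1) (n := ∞) (by simp)
  intro y₀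
  have h1 : ContMDiffAt 𝓘(ℝ, F) 𝓘(ℝ, E →L[ℝ] E) ∞ (inTangentCoordinates 𝓘(ℝ, E) 𝓘(ℝ, E)
      (fun _ : M => (1 : S)) (fun y => a y 1) (cocycleDeriv E a) y₀) y₀ :=
    ContMDiffAt.mfderiv (I := 𝓘(ℝ, E)) (I' := 𝓘(ℝ, E)) (n := ∞) (m := ∞) a (fun _ => (1 : S))
      h.smooth.contMDiffAt contMDiffAt_const (by simp)
  have h2 : (fun y => a y 1) = fun _ : M => (1 : S) := funext h.map_one
  rw [h2] at h1
  refine h1.congr_of_eventuallyEq (Filter.Eventually.of_forall fun y => ?_)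
  rw [inTangentCoordinates_eq (fun _ : M => (1 : S)) (fun _ : M => (1 : S)) _
    (mem_chart_source E (1 : S)) (mem_chart_source E (1 : S))]
  ext v
  have h3 : ∀ w : E, (tangentBundleCore 𝓘(ℝ, E) S).coordChange (achart E (1 : S))
      (achart E (1 : S)) 1 w = w := fun w =>
    (tangentBundleCore 𝓘(ℝ, E) S).coordChange_self _ _ (mem_chart_source E (1 : S)) w
  simp only [ContinuousLinearMap.comp_apply]
  rw [h3, h3]

/-- By the cocycle identity, `a(x, ·)` near `g` is `a(ρ₀(x, g), ·)` near `1`, composed with left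
translations on both sides. -/
theorem maurerCartan_mfderiv (x : M) (g : S) (v : TangentSpace 𝓘(ℝ, E) g) :
    maurerCartan (a x g) (mfderiv 𝓘(ℝ, E) 𝓘(ℝ, E) (a x) g v)
      = cocycleDeriv E a (ρ₀.act x g) (maurerCartan g v) := by
  have h1 : a x = (fun s => a x g * s) ∘ a (ρ₀.act x g) ∘ fun s => g⁻¹ * s := by
    ext s
    rw [Function.comp_apply, Function.comp_apply, ← h.map_mul, mul_inv_cancel_left]
  have h2 : ∀ k : S, k = 1 → HasMFDerivAt 𝓘(ℝ, E) 𝓘(ℝ, E) (a (ρ₀.act x g)) k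
      (cocycleDeriv E a (ρ₀.act x g)) := by
    rintro _ rfl
    exact (h.mdifferentiable_right _ _).hasMFDerivAt
  let B : E →L[ℝ] E := mfderiv 𝓘(ℝ, E) 𝓘(ℝ, E) (fun s => a x g * s) 1
  have h3 : ∀ k : S, k = 1 → HasMFDerivAt 𝓘(ℝ, E) 𝓘(ℝ, E) (fun s => a x g * s) k B := by
    rintro _ rfl
    exact (mdifferentiable_mul_left_self _ _).hasMFDerivAt
  have h4 := (h2 _ (inv_mul_cancel g)).comp g (mdifferentiable_mul_left_self g⁻¹ g).hasMFDerivAt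
  have h5 := (h3 _ (by rw [Function.comp_apply, inv_mul_cancel, h.map_one])).comp g h4
  have h6 : mfderiv 𝓘(ℝ, E) 𝓘(ℝ, E) (a x) g v
      = B (cocycleDeriv E a (ρ₀.act x g) (maurerCartan g v)) :=
    DFunLike.congr_fun (h5.congr_of_eventuallyEq
      (Filter.Eventually.of_forall fun s => congrFun h1 s)).mfderiv v
  have h7 : ∀ k, k = a x g * 1 → ∀ w : E, maurerCartan k (B w) = w := by
    rintro _ rfl w
    exact (maurerCartan_mfderiv_mul_left (a x g) 1 w).trans (maurerCartan_one w)
  exact (congrArg (maurerCartan (a x g)) h6).trans (h7 _ (mul_one _).symm _)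

theorem field_eq (y : M) (X : GroupLieAlgebra 𝓘(ℝ, E) S) :
    ρ₀.field y X = ρ.field y (cocycleDeriv E a y X) := by
  have h1 : ρ₀.act y = ρ.act y ∘ a y := funext fun s => h.act_eq y s
  have h2 : ∀ k : S, k = 1 → HasMFDerivAt 𝓘(ℝ, E) 𝓘(ℝ, F) (ρ.act y) k
      (show E →L[ℝ] F from mfderiv 𝓘(ℝ, E) 𝓘(ℝ, F) (ρ.act y) 1) := by
    rintro _ rfl
    exact (ρ.mdifferentiable_act y 1).hasMFDerivAt
  have h3 := (h2 _ (h.map_one y)).comp 1 (h.mdifferentiable_right y 1).hasMFDerivAt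
  exact DFunLike.congr_fun (h3.congr_of_eventuallyEq
      (Filter.Eventually.of_forall fun s => congrFun h1 s)).mfderiv X

/-- Differentiating `ρ₀(y, s) = ρ(y, a(y, s))` at `s = 1` identifies `ω` on the frame of `ρ₀`. -/
theorem canonicalForm_field (y : M) (X : GroupLieAlgebra 𝓘(ℝ, E) S) :
    ρ.canonicalForm y (ρ₀.field y X) = cocycleDeriv E a y X := by
  rw [h.field_eq]
  exact Function.leftInverse_invFun (ρ.field_injective y) _

variable [CompactSpace M]

theorem exists_innerNorm_cocycleDeriv_le
    (c : InnerProductSpace.Core ℝ (GroupLieAlgebra 𝓘(ℝ, E) S)) :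
    ∃ C : ℝ≥0, C ≠ 0 ∧ ∀ (y : M) (X : GroupLieAlgebra 𝓘(ℝ, E) S),
      innerNorm c (cocycleDeriv E a y X) ≤ C * innerNorm c X := by
  obtain ⟨C₁, hC₁, C₂, hC₂, h₁, h₂⟩ := exists_innerNorm_le_norm c
  obtain ⟨K, hK⟩ := isCompact_univ.exists_bound_of_continuousOn
    h.contMDiff_cocycleDeriv.continuous.continuousOn
  have hR : 0 < C₁ * ((|K| + 1) * C₂) := by positivity
  refine ⟨Real.toNNReal (C₁ * ((|K| + 1) * C₂)), (Real.toNNReal_pos.2 hR).ne', fun y X => ?_⟩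
  · rw [Real.coe_toNNReal _ hR.le]
    have h3 : ‖cocycleDeriv E a y X‖ ≤ (|K| + 1) * ‖(show E from X)‖ :=
      ((cocycleDeriv E a y).le_opNorm X).trans (mul_le_mul_of_nonneg_right
        ((hK y (mem_univ y)).trans ((le_abs_self K).trans (lt_add_one |K|).le)) (norm_nonneg _))
    calc innerNorm c (cocycleDeriv E a y X) ≤ C₁ * ‖cocycleDeriv E a y X‖ := h₁ _
      _ ≤ C₁ * ((|K| + 1) * (C₂ * innerNorm c X)) := by
        gcongr
        exact h3.trans (mul_le_mul_of_nonneg_left (h₂ X) (by positivity))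
      _ = _ := by ring

/-- The left trivialized derivatives are values of a continuous function on the compact `M`, so one
constant serves all `x`. -/
theorem exists_lipschitz (c : InnerProductSpace.Core ℝ (GroupLieAlgebra 𝓘(ℝ, E) S)) :
    ∃ C : ℝ≥0, ∀ x s t, leftInvariantEDist (innerNorm c) (a x s) (a x t)
      ≤ C * leftInvariantEDist (innerNorm c) s t := by
  have := isManifold_of_lieGroup E S 1
  obtain ⟨C, hC0, hC⟩ := h.exists_innerNorm_cocycleDeriv_le c
  refine ⟨C, fun x s t => leftInvariantEDist_map_le (innerNorm_smul c)
    ((h.contMDiff_right x).of_le (by simp)) hC0 (fun g v => ?_) s t⟩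
  rw [h.maurerCartan_mfderiv]
  exact hC _ _

omit [CompactSpace M] in
theorem exists_diffeomorph {b : M → S → S} (hb : IsTransitionCocycle ρ ρ₀ b) (x : M) :
    ∃ Φ : Diffeomorph 𝓘(ℝ, E) 𝓘(ℝ, E) S S ∞, ∀ s, Φ s = a x s :=
  ⟨{ toFun := a x
     invFun := b x
     left_inv := h.leftInverse hb x
     right_inv := hb.leftInverse h x
     contMDiff_toFun := h.contMDiff_right x
     contMDiff_invFun := hb.contMDiff_right x }, fun _ => rfl⟩

theorem isBiLipschitz {b : M → S → S} (hb : IsTransitionCocycle ρ ρ₀ b) (x : M)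
    [IsManifold 𝓘(ℝ, E) 1 S] (c : InnerProductSpace.Core ℝ (GroupLieAlgebra 𝓘(ℝ, E) S)) :
    @IsBiLipschitz S S (leftInvariantMetric c) (leftInvariantMetric c) (a x) := by
  let _ := leftInvariantMetric (E := E) (S := S) c
  obtain ⟨C, hC⟩ := h.exists_lipschitz c
  obtain ⟨C', hC'⟩ := hb.exists_lipschitz c
  refine ⟨max C C', fun s t => (hC x s t).trans ?_, fun s t => ?_⟩
  · exact mul_le_mul_left (by exact_mod_cast le_max_left C C') _
  · have h1 := hC' x (a x s) (a x t)
    rw [h.leftInverse hb x s, h.leftInverse hb x t] at h1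
    exact h1.trans (mul_le_mul_left (by exact_mod_cast le_max_right C C') _)

end IsTransitionCocycle

end CocycleDeriv

/-! ### The characteristic map -/

section Characteristic

variable {E F S M : Type*}
  [NormedAddCommGroup E] [NormedSpace ℝ E] [FiniteDimensional ℝ E]
  [NormedAddCommGroup F] [NormedSpace ℝ F] [FiniteDimensional ℝ F]
  [TopologicalSpace S] [ChartedSpace E S] [Group S] [LieGroup 𝓘(ℝ, E) ∞ S] [T2Space S]
  [TopologicalSpace M] [ChartedSpace F M] [IsManifold 𝓘(ℝ, F) ∞ M]
  [SimplyConnectedSpace S]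
  {𝔥 : Submodule ℝ (GroupLieAlgebra 𝓘(ℝ, E) S)}

theorem LocallyFreeAction.canonicalForm_field (ρ : LocallyFreeAction E F S M) (x : M)
    (X : GroupLieAlgebra 𝓘(ℝ, E) S) : ρ.canonicalForm x (ρ.field x X) = X :=
  Function.leftInverse_invFun (ρ.field_injective x) X

namespace IsTransitionCocycle

variable {ρ₀ ρ : LocallyFreeAction E F S M} {a : M → S → S} (h : IsTransitionCocycle ρ₀ ρ a)
include h

theorem directionalDeriv_comp {P : S → GroupLieAlgebra 𝓘(ℝ, E) S ⧸ 𝔥} (hP : IsQuotientHom 𝔥 P)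
    (l : Module.Dual ℝ (GroupLieAlgebra 𝓘(ℝ, E) S ⧸ 𝔥)) (x : M) (g : S)
    (v : TangentSpace 𝓘(ℝ, E) g) : directionalDeriv (fun s => l (P (a x s))) g v
      = l (𝔥.mkQ (cocycleDeriv E a (ρ₀.act x g) (maurerCartan g v))) := by
  have h1 := DFunLike.congr_fun (mfderiv_comp (f := a x) (g := fun s => l (P s)) g
    ((hP.contMDiff l).mdifferentiable (by simp) _) (h.mdifferentiable_right x g)) v
  exact (h1.trans (hP.deriv l (a x g) _)).trans
    (congrArg (fun X => l (𝔥.mkQ X)) (h.maurerCartan_mfderiv x g v))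

theorem contMDiff_dual_cocycleDeriv (m : GroupLieAlgebra 𝓘(ℝ, E) S →ₗ[ℝ] ℝ)
    (X : GroupLieAlgebra 𝓘(ℝ, E) S) :
    ContMDiff 𝓘(ℝ, F) 𝓘(ℝ, ℝ) ∞ (fun y => m (cocycleDeriv E a y X)) := by
  let m' : E →L[ℝ] ℝ := LinearMap.toContinuousLinearMap (show E →ₗ[ℝ] ℝ from m)
  exact (m'.comp (ContinuousLinearMap.apply ℝ E (show E from X))).contMDiff.comp
    h.contMDiff_cocycleDeriv

variable (𝔥) in
/-- The leafwise form `ω mod 𝔥`. -/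
def canonicalFormMod : LeafwiseOneForm ρ₀ (GroupLieAlgebra 𝓘(ℝ, E) S ⧸ 𝔥) where
  toFun x :=
    { toFun := fun v => 𝔥.mkQ (ρ.canonicalForm x v)
      map_add' := by
        rintro ⟨_, X, rfl⟩ ⟨_, Y, rfl⟩
        change 𝔥.mkQ (ρ.canonicalForm x (ρ₀.field x X + ρ₀.field x Y)) = _
        rw [← map_add, h.canonicalForm_field, h.canonicalForm_field, h.canonicalForm_field]
        exact (congrArg 𝔥.mkQ (map_add (cocycleDeriv E a x) X Y)).trans (map_add 𝔥.mkQ _ _)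
      map_smul' := by
        rintro r ⟨_, X, rfl⟩
        change 𝔥.mkQ (ρ.canonicalForm x (r • ρ₀.field x X)) = _
        rw [← map_smul, h.canonicalForm_field, h.canonicalForm_field]
        exact (congrArg 𝔥.mkQ (map_smul (cocycleDeriv E a x) r X)).trans (map_smul 𝔥.mkQ _ _) }
  smooth X l := by
    have h1 := h.contMDiff_dual_cocycleDeriv (l ∘ₗ 𝔥.mkQ) X
    have h2 : (fun y => (l ∘ₗ 𝔥.mkQ) (cocycleDeriv E a y X))
        = fun y => l (𝔥.mkQ (ρ.canonicalForm y (ρ₀.field y X))) := by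
      ext y; rw [h.canonicalForm_field]; rfl
    rw [h2] at h1
    exact h1

theorem canonicalFormMod_eval (X : GroupLieAlgebra 𝓘(ℝ, E) S) (y : M) :
    (h.canonicalFormMod 𝔥).eval X y = 𝔥.mkQ (cocycleDeriv E a y X) :=
  congrArg 𝔥.mkQ (h.canonicalForm_field y X)

/-- Along the orbit of `x`, the form pulls back to the differential of `s ↦ P(a(x, s))`, so the
commutator formula at `s = 1` is the closedness equation at `x`. -/
theorem isClosed_canonicalFormMod (h𝔥 : ∀ X Y : GroupLieAlgebra 𝓘(ℝ, E) S, ⁅X, Y⁆ ∈ 𝔥) :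
    (h.canonicalFormMod 𝔥).IsClosed := by
  have : CompleteSpace E := FiniteDimensional.complete ℝ E
  have := isManifold_of_lieGroup E S ⊤
  intro X Y l x
  simp only [h.canonicalFormMod_eval]
  obtain ⟨P, hP⟩ := exists_isQuotientHom h𝔥
  have hf : ContMDiff 𝓘(ℝ, E) 𝓘(ℝ, ℝ) ∞ (fun s => l (P (a x s))) :=
    (hP.contMDiff l).comp (h.contMDiff_right x)
  have h1 := directionalDeriv_mlieBracket (x := (1 : S)) (hf.of_le ENat.LEInfty.out)
    (mdifferentiable_mulInvariantVectorField_self X) (mdifferentiable_mulInvariantVectorField_self Y)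
  have h2 : ∀ Z : GroupLieAlgebra 𝓘(ℝ, E) S,
      (fun g => directionalDeriv (fun s => l (P (a x s))) g (mulInvariantVectorField Z g))
        = fun g => l (𝔥.mkQ (cocycleDeriv E a (ρ₀.act x g) Z)) := by
    intro Z
    ext g
    rw [h.directionalDeriv_comp hP, maurerCartan_mulInvariantVectorField]
  have h3 : ∀ Z W : GroupLieAlgebra 𝓘(ℝ, E) S,
      directionalDeriv (fun g => l (𝔥.mkQ (cocycleDeriv E a (ρ₀.act x g) Z))) (1 : S)
        (mulInvariantVectorField W (1 : S))
      = directionalDeriv (fun y => l (𝔥.mkQ (cocycleDeriv E a y Z))) x (ρ₀.field x W) := by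
    intro Z W
    have hd := (h.contMDiff_dual_cocycleDeriv (l ∘ₗ 𝔥.mkQ) Z).mdifferentiable (by simp)
    have h4 := ρ₀.directionalDeriv_comp_act (f := fun y => l (𝔥.mkQ (cocycleDeriv E a y Z))) x 1
      (mulInvariantVectorField W (1 : S)) (hd _)
    rw [maurerCartan_mulInvariantVectorField] at h4
    have h5 : ∀ y, y = x → directionalDeriv (fun y => l (𝔥.mkQ (cocycleDeriv E a y Z))) y
        (ρ₀.field y W)
        = directionalDeriv (fun y => l (𝔥.mkQ (cocycleDeriv E a y Z))) x (ρ₀.field x W) := by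
      rintro _ rfl; rfl
    exact h4.trans (h5 _ (ρ₀.act_one x))
  rw [h2, h2, h3, h3, h.directionalDeriv_comp hP, ρ₀.act_one] at h1
  exact h1.trans (congrArg (fun Z => l (𝔥.mkQ (cocycleDeriv E a x Z))) (maurerCartan_one _))

theorem exists_isCharacteristicMap (h𝔥 : ∀ X Y : GroupLieAlgebra 𝓘(ℝ, E) S, ⁅X, Y⁆ ∈ 𝔥)
    (hH : LeafwiseH1EqLieH1 ρ₀ (GroupLieAlgebra 𝓘(ℝ, E) S ⧸ 𝔥)) :
    ∃ φ, IsCharacteristicMap ρ₀ ρ 𝔥 φ :=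
  hH _ (h.isClosed_canonicalFormMod h𝔥)

/-- Modulo `𝔥`, the cocycle is the linear map given by the characteristic map, up to a
coboundary. -/
theorem exists_coboundary {φ : GroupLieAlgebra 𝓘(ℝ, E) S →ₗ[ℝ] (GroupLieAlgebra 𝓘(ℝ, E) S ⧸ 𝔥)}
    (hφ : IsCharacteristicMap ρ₀ ρ 𝔥 φ) {P : S → GroupLieAlgebra 𝓘(ℝ, E) S ⧸ 𝔥}
    (hP : IsQuotientHom 𝔥 P) {Q : S → GroupLieAlgebra 𝓘(ℝ, E) S ⧸ LinearMap.ker φ}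
    (hQ : IsQuotientHom (LinearMap.ker φ) Q) :
    ∃ k : M → GroupLieAlgebra 𝓘(ℝ, E) S ⧸ 𝔥, IsSmoothVectorMap F k ∧
      ∀ (l : Module.Dual ℝ (GroupLieAlgebra 𝓘(ℝ, E) S ⧸ 𝔥)) (x : M) (s : S), l (P (a x s))
        = l ((LinearMap.ker φ).liftQ φ le_rfl (Q s)) + (l (k (ρ₀.act x s)) - l (k x)) := by
  have := isManifold_of_lieGroup E S 1
  obtain ⟨-, k, hk, hkφ⟩ := hφ
  refine ⟨k, hk, fun l x s => ?_⟩
  let l' : Module.Dual ℝ (GroupLieAlgebra 𝓘(ℝ, E) S ⧸ LinearMap.ker φ) :=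
    l ∘ₗ (LinearMap.ker φ).liftQ φ le_rfl
  have hf : ContMDiff 𝓘(ℝ, E) 𝓘(ℝ, ℝ) ∞ (fun s => l (P (a x s))) :=
    (hP.contMDiff l).comp (h.contMDiff_right x)
  have hkx : ContMDiff 𝓘(ℝ, E) 𝓘(ℝ, ℝ) ∞ (fun s => l (k (ρ₀.act x s))) :=
    (hk l).comp (ρ₀.contMDiff_act x)
  have hd : ∀ {f : S → ℝ}, ContMDiff 𝓘(ℝ, E) 𝓘(ℝ, ℝ) ∞ f → ∀ g,
      HasMFDerivAt 𝓘(ℝ, E) 𝓘(ℝ, ℝ) f g (mfderiv 𝓘(ℝ, E) 𝓘(ℝ, ℝ) f g) := fun hf g =>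
    (hf.mdifferentiable (by simp) g).hasMFDerivAt
  -- The three derivatives at `g` are the three terms of the equation for `φ` at `ρ₀(x, g)`,
  -- evaluated on the vector induced by `maurerCartan g v`; the remaining constant is fixed at `s =
  -- 1`.
  have hzero : ∀ g, HasMFDerivAt 𝓘(ℝ, E) 𝓘(ℝ, ℝ)
      ((fun s => l (P (a x s))) - (fun s => l' (Q s)) - fun s => l (k (ρ₀.act x s))) g
      (0 : E →L[ℝ] ℝ) := by
    intro g
    refine (((hd hf g).sub (hd (hQ.contMDiff l') g)).sub (hd hkx g)).congr_mfderiv ?_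
    ext v
    change directionalDeriv (fun s => l (P (a x s))) g v - directionalDeriv (fun s => l' (Q s)) g v
      - directionalDeriv (fun s => l (k (ρ₀.act x s))) g v = 0
    have h1 := h.directionalDeriv_comp hP l x g v
    have h2 := hQ.deriv l' g v
    have h3 := ρ₀.directionalDeriv_comp_act (f := fun y => l (k y)) x g v
      ((hk l).mdifferentiable (by simp) _)
    have h4 := hkφ (ρ₀.act x g) ⟨ρ₀.field (ρ₀.act x g) (maurerCartan g v),
      LinearMap.mem_range_self _ _⟩ l
    have h5 := h.canonicalForm_field (ρ₀.act x g) (maurerCartan g v)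
    have h6 := ρ₀.canonicalForm_field (ρ₀.act x g) (maurerCartan g v)
    have h7 : l' ((LinearMap.ker φ).mkQ (maurerCartan g v)) = l (φ (maurerCartan g v)) := rfl
    have h8 : l (𝔥.mkQ (cocycleDeriv E a (ρ₀.act x g) (maurerCartan g v)))
        = l (φ (maurerCartan g v))
          + directionalDeriv (fun y => l (k y)) (ρ₀.act x g)
            (ρ₀.field (ρ₀.act x g) (maurerCartan g v)) :=
      (congrArg (fun Z => l (𝔥.mkQ Z)) h5.symm).trans (h4.trans
        (congrArg (fun Z => l (φ Z) + directionalDeriv (fun y => l (k y)) (ρ₀.act x g)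
            (ρ₀.field (ρ₀.act x g) (maurerCartan g v))) h6))
    linarith
  have hconst := eq_of_mfderiv_eq_zero (fun g => (hzero g).mdifferentiableAt)
    (fun g => (hzero g).mfderiv) s 1
  simp only [Pi.sub_apply, h.map_one, hP.map_one, hQ.map_one, map_zero, ρ₀.act_one] at hconst
  have h9 : l' (Q s) = l ((LinearMap.ker φ).liftQ φ le_rfl (Q s)) := rfl
  linarith

variable [CompactSpace M]

omit [FiniteDimensional ℝ F] [SimplyConnectedSpace S] [IsManifold 𝓘(ℝ, F) ∞ M] h in
theorem _root_.IsSmoothVectorMap.exists_abs_le {W : Type*} [AddCommGroup W] [Module ℝ W] {k : M → W}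
    (hk : IsSmoothVectorMap F k) (l : Module.Dual ℝ W) : ∃ C, ∀ y y', |l (k y) - l (k y')| ≤ C := by
  obtain ⟨C, hC⟩ := isCompact_univ.exists_bound_of_continuousOn (hk l).continuous.continuousOn
  refine ⟨C + C, fun y y' => (abs_sub _ _).trans ?_⟩
  exact add_le_add (hC y (mem_univ _)) (hC y' (mem_univ _))

omit h in
theorem _root_.eq_zero_of_abs_mul_le {r C : ℝ} (h : ∀ t : ℝ, |t * r| ≤ C) : r = 0 := by
  by_contra hr
  have h1 := h ((|C| + 1) / r)
  rw [div_mul_cancel₀ _ hr, abs_of_pos (by positivity)] at h1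
  linarith [le_abs_self C]

/-- Comparing the two coboundary formulas at `exp(tX)` shows that `t · l(φ X - φ' X)` is bounded in
`t`. -/
theorem isCharacteristicMap_unique [Nonempty M] (h𝔥 : ∀ X Y : GroupLieAlgebra 𝓘(ℝ, E) S, ⁅X, Y⁆ ∈ 𝔥)
    {φ φ' : GroupLieAlgebra 𝓘(ℝ, E) S →ₗ[ℝ] (GroupLieAlgebra 𝓘(ℝ, E) S ⧸ 𝔥)}
    (hφ : IsCharacteristicMap ρ₀ ρ 𝔥 φ) (hφ' : IsCharacteristicMap ρ₀ ρ 𝔥 φ') : φ = φ' := by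
  obtain ⟨P, hP⟩ := exists_isQuotientHom h𝔥
  obtain ⟨Q, hQ⟩ := exists_isQuotientHom (𝔨 := LinearMap.ker φ) hφ.1
  obtain ⟨Q', hQ'⟩ := exists_isQuotientHom (𝔨 := LinearMap.ker φ') hφ'.1
  obtain ⟨k, hk, hkP⟩ := h.exists_coboundary hφ hP hQ
  obtain ⟨k', hk', hkP'⟩ := h.exists_coboundary hφ' hP hQ'
  obtain ⟨x⟩ := ‹Nonempty M›
  ext X
  rw [← sub_eq_zero, ← Module.forall_dual_apply_eq_zero_iff ℝ]
  intro l
  obtain ⟨C, hC⟩ := hk.exists_abs_le l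
  obtain ⟨C', hC'⟩ := hk'.exists_abs_le l
  refine eq_zero_of_abs_mul_le (C := C + C') fun t => ?_
  have h1 := hkP l x (oneParam X t)
  have h2 := hkP' l x (oneParam X t)
  rw [hQ.map_oneParam] at h1
  rw [hQ'.map_oneParam] at h2
  simp only [map_smul, Submodule.mkQ_apply, Submodule.liftQ_apply, smul_eq_mul] at h1 h2
  have h3 := hC (ρ₀.act x (oneParam X t)) x
  have h4 := hC' (ρ₀.act x (oneParam X t)) x
  have h5 : t * l (φ X - φ' X) = (l (k' (ρ₀.act x (oneParam X t))) - l (k' x))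
      - (l (k (ρ₀.act x (oneParam X t))) - l (k x)) := by
    rw [map_sub]; linarith
  rw [h5]
  linarith [abs_sub (l (k' (ρ₀.act x (oneParam X t))) - l (k' x))
    (l (k (ρ₀.act x (oneParam X t))) - l (k x))]

/-- If `l` kills the range of `φ`, then `l(P(a(x, s)))` is a bounded function of `s`. Since `a(x,
·)` is onto, `l ∘ P` is bounded on every one-parameter subgroup, so `l = 0`. -/
theorem surjective_of_isCharacteristicMap [Nonempty M]
    (h𝔥 : ∀ X Y : GroupLieAlgebra 𝓘(ℝ, E) S, ⁅X, Y⁆ ∈ 𝔥) {b : M → S → S}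
    (hb : IsTransitionCocycle ρ ρ₀ b)
    {φ : GroupLieAlgebra 𝓘(ℝ, E) S →ₗ[ℝ] (GroupLieAlgebra 𝓘(ℝ, E) S ⧸ 𝔥)}
    (hφ : IsCharacteristicMap ρ₀ ρ 𝔥 φ) : Function.Surjective φ := by
  obtain ⟨P, hP⟩ := exists_isQuotientHom h𝔥
  obtain ⟨Q, hQ⟩ := exists_isQuotientHom (𝔨 := LinearMap.ker φ) hφ.1
  obtain ⟨k, hk, hkP⟩ := h.exists_coboundary hφ hP hQ
  obtain ⟨x⟩ := ‹Nonempty M›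
  rw [← LinearMap.range_eq_top]
  by_contra hne
  obtain ⟨l, hl0, hl⟩ := Submodule.exists_dual_map_eq_bot_of_lt_top (lt_top_iff_ne_top.2 hne)
    inferInstance
  refine hl0 (LinearMap.ext fun v => ?_)
  obtain ⟨X, rfl⟩ := 𝔥.mkQ_surjective v
  obtain ⟨C, hC⟩ := hk.exists_abs_le l
  refine eq_zero_of_abs_mul_le (C := C) fun t => ?_
  have h1 := hkP l x (b x (oneParam X t))
  rw [hb.leftInverse h x, hP.map_oneParam, map_smul, smul_eq_mul] at h1
  obtain ⟨Y, hY⟩ := (LinearMap.ker φ).mkQ_surjective (Q (b x (oneParam X t)))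
  have h2 : l ((LinearMap.ker φ).liftQ φ le_rfl (Q (b x (oneParam X t)))) = 0 := by
    rw [← hY]
    exact (Submodule.eq_bot_iff _).1 hl _ ⟨φ Y, ⟨Y, rfl⟩, rfl⟩
  rw [h2, zero_add] at h1
  rw [h1]
  exact hC _ _

end IsTransitionCocycle

end Characteristic

/-! ### The cocycle respects the fibers -/

section FiberRespecting

variable {E F S M : Type*}
  [NormedAddCommGroup E] [NormedSpace ℝ E] [FiniteDimensional ℝ E]
  [NormedAddCommGroup F] [NormedSpace ℝ F] [FiniteDimensional ℝ F]
  [TopologicalSpace S] [ChartedSpace E S] [Group S] [LieGroup 𝓘(ℝ, E) ∞ S] [T2Space S]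
  [TopologicalSpace M] [ChartedSpace F M] [IsManifold 𝓘(ℝ, F) ∞ M] [CompactSpace M] [Nonempty M]
  [SimplyConnectedSpace S]

/-- The coboundary term is the only deviation of `P ∘ a(x, ·)` from `φbar ∘ Q`. A bounded deviation
in the base can be corrected by a bounded displacement in `S`, in the target for one inclusion and
in the source for the other. -/
theorem IsTransitionCocycle.exists_isFiberRespecting [IsManifold 𝓘(ℝ, E) 1 S]
    {ρ₀ ρ : LocallyFreeAction E F S M}
    {a b : M → S → S} (h : IsTransitionCocycle ρ₀ ρ a) (hb : IsTransitionCocycle ρ ρ₀ b) (x : M)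
    {𝔥 : Submodule ℝ (GroupLieAlgebra 𝓘(ℝ, E) S)}
    (h𝔥 : ∀ X Y : GroupLieAlgebra 𝓘(ℝ, E) S, ⁅X, Y⁆ ∈ 𝔥)
    (c : InnerProductSpace.Core ℝ (GroupLieAlgebra 𝓘(ℝ, E) S))
    {φ : GroupLieAlgebra 𝓘(ℝ, E) S →ₗ[ℝ] (GroupLieAlgebra 𝓘(ℝ, E) S ⧸ 𝔥)}
    (hφ : IsCharacteristicMap ρ₀ ρ 𝔥 φ) :
    ∃ (eK : (GroupLieAlgebra 𝓘(ℝ, E) S ⧸ LinearMap.ker φ) ≃ₜ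
          (S ⧸ connectedLieSubgroup (LinearMap.ker φ)))
      (eH : (GroupLieAlgebra 𝓘(ℝ, E) S ⧸ 𝔥) ≃ₜ (S ⧸ connectedLieSubgroup 𝔥))
      (φbar : (GroupLieAlgebra 𝓘(ℝ, E) S ⧸ LinearMap.ker φ) ≃ₗ[ℝ]
          (GroupLieAlgebra 𝓘(ℝ, E) S ⧸ 𝔥)),
      IsVectorGroupExp (LinearMap.ker φ) eK ∧ IsVectorGroupExp 𝔥 eH ∧
      (∀ X, φbar ((LinearMap.ker φ).mkQ X) = φ X) ∧
      @IsFiberRespecting S (S ⧸ connectedLieSubgroup (LinearMap.ker φ))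
        S (S ⧸ connectedLieSubgroup 𝔥)
        (leftInvariantMetric c) (quotientEDist c (LinearMap.ker φ))
        (leftInvariantMetric c) (quotientEDist c 𝔥)
        (fun s => (s : S ⧸ connectedLieSubgroup (LinearMap.ker φ)))
        (fun s => (s : S ⧸ connectedLieSubgroup 𝔥))
        (fun b => eH (φbar (eK.symm b)))
        (a x) := by
  obtain ⟨P, hP⟩ := exists_isQuotientHom h𝔥
  obtain ⟨Q, hQ⟩ := exists_isQuotientHom (𝔨 := LinearMap.ker φ) hφ.1
  obtain ⟨k, hk, hkP⟩ := h.exists_coboundary hφ hP hQ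
  obtain ⟨eK, heK, heK'⟩ := hQ.exists_isVectorGroupExp
  obtain ⟨eH, heH, heH'⟩ := hP.exists_isVectorGroupExp
  let φbar := φ.quotKerEquivOfSurjective (h.surjective_of_isCharacteristicMap h𝔥 hb hφ)
  have hφbar : ∀ X, φbar ((LinearMap.ker φ).mkQ X) = φ X := fun X => rfl
  have hlift : ∀ v, (LinearMap.ker φ).liftQ φ le_rfl v = φbar v := by
    rintro ⟨X⟩; rfl
  have hbound : ∀ l : Module.Dual ℝ (GroupLieAlgebra 𝓘(ℝ, E) S ⧸ 𝔥),
      ∃ C, ∀ s, |l (φbar (Q s) - P (a x s))| ≤ C := by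
    intro l
    obtain ⟨C, hC⟩ := hk.exists_abs_le l
    refine ⟨C, fun s => ?_⟩
    rw [map_sub, hkP l x s, hlift, sub_add_cancel_left, abs_neg]
    exact hC _ _
  obtain ⟨C₁, hC₁⟩ := exists_quotientNorm_le c 𝔥 hbound
  -- The displacement from `Q s` to `φbar⁻¹(P(a(x, s)))`, bounded in the source base.
  obtain ⟨C₂, hC₂⟩ := exists_quotientNorm_le c (LinearMap.ker φ)
    (f := fun s => -φbar.symm (φbar (Q s) - P (a x s))) fun l => by
      obtain ⟨C, hC⟩ := hbound (-(l ∘ₗ (φbar.symm : _ →ₗ[ℝ] _)))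
      refine ⟨C, fun s => ?_⟩
      have h1 := hC s
      rwa [LinearMap.neg_apply, LinearMap.comp_apply, ← map_neg] at h1
  obtain ⟨C₃, hC₃⟩ := h.exists_lipschitz c
  let _ := leftInvariantMetric (E := E) (S := S) c
  let _ := quotientEDist c (LinearMap.ker φ)
  let _ := quotientEDist c 𝔥
  refine ⟨eK, eH, φbar, heK, heH, hφbar, hQ.isDistanceRespectingProjection c,
    hP.isDistanceRespectingProjection c,
    -- `C₁ + 1` bounds the correction in the target, `C₂ + 1` the correction in the source, which
    -- `a(x, ·)` stretches by at most `C₃`; the last `1` makes the inequality strict and the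
    -- constant positive.
    max (C₁ + 1).toNNReal (C₃ * (C₂ + 1).toNNReal) + 1, by positivity, ?_⟩
  rintro ⟨g⟩
  refine lt_of_le_of_lt (b := ((max (C₁ + 1).toNNReal (C₃ * (C₂ + 1).toNNReal) : ℝ≥0) : ℝ≥0∞)) ?_
    (by exact_mod_cast lt_add_one _)
  have hsource : ∀ s : S, (s : S ⧸ connectedLieSubgroup (LinearMap.ker φ)) = g ↔ Q s = Q g :=
    fun s => hQ.mk_eq_mk_iff
  have htarget : ∀ s : S, (s : S ⧸ connectedLieSubgroup 𝔥) = eH (φbar (eK.symm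
      (g : S ⧸ connectedLieSubgroup (LinearMap.ker φ)))) ↔ P s = φbar (Q g) := fun s => by
    rw [heK', ← heH', Homeomorph.symm_apply_eq]
  refine Metric.hausdorffEDist_le_of_infEDist ?_ fun g' hg' => ?_
  · rintro _ ⟨s, hs, rfl⟩
    obtain ⟨X, hX⟩ := 𝔥.mkQ_surjective (φbar (Q s) - P (a x s))
    obtain ⟨g', hg', hlt⟩ := hP.exists_edist_lt c (a x s) X
      ((hC₁ s X hX).trans_lt (lt_add_one C₁))
    rw [hX, add_sub_cancel, (hsource s).1 hs] at hg'
    have hmem : g' ∈ (fun s : S => (s : S ⧸ connectedLieSubgroup 𝔥)) ⁻¹' {eH (φbar (eK.symm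
      (g : S ⧸ connectedLieSubgroup (LinearMap.ker φ))))} := (htarget g').2 hg'
    refine (Metric.infEDist_le_edist_of_mem hmem).trans (hlt.le.trans ?_)
    exact ENNReal.coe_le_coe.2 (le_max_left _ _)
  · have hPg' := (htarget g').1 hg'
    -- The preimage `b(x, g')` of a point of the target fiber lies near the source fiber; it is
    -- moved into that fiber and the displacement is carried back by `a(x, ·)`.
    have hab : a x (b x g') = g' := hb.leftInverse h x g'
    obtain ⟨X, hX⟩ := (LinearMap.ker φ).mkQ_surjective
      (-φbar.symm (φbar (Q (b x g')) - P (a x (b x g'))))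
    obtain ⟨s, hs, hlt⟩ := hQ.exists_edist_lt c (b x g') X
      ((hC₂ _ X hX).trans_lt (lt_add_one C₂))
    rw [hX, hab, hPg', map_sub, LinearEquiv.symm_apply_apply, LinearEquiv.symm_apply_apply,
      neg_sub, add_sub_cancel] at hs
    have hmem : s ∈ (fun s : S => (s : S ⧸ connectedLieSubgroup (LinearMap.ker φ))) ⁻¹'
      {(g : S ⧸ connectedLieSubgroup (LinearMap.ker φ))} := (hsource s).2 hs
    refine (Metric.infEDist_le_edist_of_mem (mem_image_of_mem (a x) hmem)).trans ?_
    have h1 := hC₃ x (b x g') s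
    rw [hab] at h1
    refine h1.trans ((mul_le_mul_right hlt.le _).trans ?_)
    refine le_trans (le_of_eq ?_) (ENNReal.coe_le_coe.2 (le_max_right _ _))
    rw [ENNReal.coe_mul]
    rfl

end FiberRespecting

end

theorem proposition4p4
    {E F S M : Type*}
    [NormedAddCommGroup E] [NormedSpace ℝ E] [FiniteDimensional ℝ E]
    [NormedAddCommGroup F] [NormedSpace ℝ F] [FiniteDimensional ℝ F]
    -- a connected simply connected solvable Lie group
    [TopologicalSpace S] [ChartedSpace E S] [Group S] [LieGroup 𝓘(ℝ, E) ∞ S] [T2Space S]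
    [SimplyConnectedSpace S] [Group.IsSolvable S]
    -- a (nonempty) closed manifold
    [TopologicalSpace M] [ChartedSpace F M] [IsManifold 𝓘(ℝ, F) ∞ M] [T2Space M] [CompactSpace M]
    [Nonempty M]
    (ρ₀ ρ : LocallyFreeAction E F S M) (hρ : SameOrbitFoliation ρ₀ ρ)
    (𝔥 : Submodule ℝ (GroupLieAlgebra 𝓘(ℝ, E) S))
    (h𝔥 : ∀ X Y : GroupLieAlgebra 𝓘(ℝ, E) S, ⁅X, Y⁆ ∈ 𝔥)
    (h𝔥' : 𝔥 ≤ lieNilradical E S)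
    (c : InnerProductSpace.Core ℝ (GroupLieAlgebra 𝓘(ℝ, E) S)) :
    -- the cocycle `a` exists and is unique
    (∃! a : M → S → S, IsTransitionCocycle ρ₀ ρ a) ∧
    -- `φ_ρ` exists and is unique under the cohomological assumption which defines it
    (LeafwiseH1EqLieH1 ρ₀ (GroupLieAlgebra 𝓘(ℝ, E) S ⧸ 𝔥) →
      ∃! φ : GroupLieAlgebra 𝓘(ℝ, E) S →ₗ[ℝ] (GroupLieAlgebra 𝓘(ℝ, E) S ⧸ 𝔥),
        IsCharacteristicMap ρ₀ ρ 𝔥 φ) ∧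
    ∀ a : M → S → S, IsTransitionCocycle ρ₀ ρ a → ∀ x : M,
      -- `a(x, ·)` is a biLipschitz diffeomorphism of `S`
      (∃ Φ : Diffeomorph 𝓘(ℝ, E) 𝓘(ℝ, E) S S ∞, ∀ s, Φ s = a x s) ∧
      @IsBiLipschitz S S (leftInvariantMetric c) (leftInvariantMetric c) (a x) ∧
      -- and it is fiber respecting over the linear isomorphism `S ⧸ K_ρ → S ⧸ H` induced by `φ_ρ`
      ∀ φ : GroupLieAlgebra 𝓘(ℝ, E) S →ₗ[ℝ] (GroupLieAlgebra 𝓘(ℝ, E) S ⧸ 𝔥),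
        IsCharacteristicMap ρ₀ ρ 𝔥 φ →
        ∃ (eK : (GroupLieAlgebra 𝓘(ℝ, E) S ⧸ LinearMap.ker φ) ≃ₜ
              (S ⧸ connectedLieSubgroup (LinearMap.ker φ)))
          (eH : (GroupLieAlgebra 𝓘(ℝ, E) S ⧸ 𝔥) ≃ₜ (S ⧸ connectedLieSubgroup 𝔥))
          (φbar : (GroupLieAlgebra 𝓘(ℝ, E) S ⧸ LinearMap.ker φ) ≃ₗ[ℝ]
              (GroupLieAlgebra 𝓘(ℝ, E) S ⧸ 𝔥)),
          IsVectorGroupExp (LinearMap.ker φ) eK ∧ IsVectorGroupExp 𝔥 eH ∧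
          (∀ X, φbar ((LinearMap.ker φ).mkQ X) = φ X) ∧
          @IsFiberRespecting S (S ⧸ connectedLieSubgroup (LinearMap.ker φ))
            S (S ⧸ connectedLieSubgroup 𝔥)
            (leftInvariantMetric c) (quotientEDist c (LinearMap.ker φ))
            (leftInvariantMetric c) (quotientEDist c 𝔥)
            (fun s => (s : S ⧸ connectedLieSubgroup (LinearMap.ker φ)))
            (fun s => (s : S ⧸ connectedLieSubgroup 𝔥))
            (fun b => eH (φbar (eK.symm b)))
            (a x) := by
  have := isManifold_of_lieGroup E S 1
  have hρ' : SameOrbitFoliation ρ ρ₀ := fun x => (hρ x).symm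
  -- The cocycle with the actions exchanged provides the inverse of every `a(x, ·)`.
  obtain ⟨b, hb, -⟩ := hρ'.existsUnique_isTransitionCocycle
  refine ⟨hρ.existsUnique_isTransitionCocycle, fun hH => ?_, fun a ha x => ⟨?_, ?_, ?_⟩⟩
  · obtain ⟨a, ha, -⟩ := hρ.existsUnique_isTransitionCocycle
    obtain ⟨φ, hφ⟩ := ha.exists_isCharacteristicMap h𝔥 hH
    exact ⟨φ, hφ, fun φ' hφ' => ha.isCharacteristicMap_unique h𝔥 hφ' hφ⟩
  · exact ha.exists_diffeomorph hb x
  · exact ha.isBiLipschitz hb x c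
  · exact fun φ hφ => ha.exists_isFiberRespecting hb x h𝔥 c hφ
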